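/- **Setting.** Let $\mathbb K$ be an algebraically closed field, let $n\ge 4$, and let $Q^n$ be the quiver of type $D_n$ with vertices $1,\dots,n$ and arrows $k+1\to k$ for $1\le k\le n-3$, $\;n-1\to n-2$ and $n\to n-2$. Representations of $Q^n$ are finite-dimensional over $\mathbb K$. Let $A$ be the path algebra, that is, the direct sum $A=\bigoplus_k P_k$ of the representations $P_k$ for which $(P_k)_j$ has the paths from $k$ to $j$ as a basis and arrows act by prolonging paths; let $D=\mathrm{Hom}_{\mathbb K}(-,\mathbb K)$. Let $\nu=D\,\mathrm{Hom}(-,A)$ be the Nakayama functor and $\tau=D\,\mathrm{Tr}$ the Auslander–Reiten translation, where $\mathrm{Tr}\,M=\mathrm{Coker}\big(\mathrm{Hom}(P_0,A)\to\mathrm{Hom}(P_1,A)\big)$ for a minimal projective presentation $P_1\to P_0\to M\to 0$. **Curves.** Label the vertices of a regular $(2n-2)$-gon in clockwise order by $1,2,\dots,n-1,-1,-2,\dots,-(n-1)$ and its centre (the puncture) by both $n$ and $-n$. A curve is a geodesic, given by its unordered pair of labelled endpoints $\{i,j\}$, where $i\in\{\pm1,\dots,\pm(n-1)\}$, $j\in\{\pm1,\dots,\pm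 n\}$ and $j\ne\pm i$ (the curves $\{i,n\}$ and $\{i,-n\}$ are regarded as different). Let $\mathrm{Eq}(\Sigma_n)$ be the set of classes $[\gamma]=\{\gamma,\gamma'\}$, where $\gamma'$ has endpoints $-i,-j$ if $\gamma$ has endpoints $i,j$. For a curve $\gamma$ let $\varrho(\gamma)$ be the curve obtained by replacing each boundary endpoint by its immediate counterclockwise neighbour on the boundary and by exchanging the labels $n$ and $-n$ of the puncture; this respects the classes. **The representation $V(\gamma)$.** It depends only on $[\gamma]$. Let $i$ be the smallest positive endpoint occurring in $[\gamma]$ and $\{i,j\}$ the curve of $[\gamma]$ containing it. * If $i<j\le n-1$, then $V(\gamma)_k=\mathbb K$ for $i\le k\le j-1$, and $V(\gamma)_k=0$ otherwise. * If $-(n-1)\le j\le -(i+1)$, then $V(\gamma)_k=\mathbb K^2$ for $-j\le k\le n-2$, $V(\gamma)_k=\mathbb K$ for $i\le k\le -j-1$ and for $k\in\{n-1,n\}$, and $V(\gamma)_k=0$ otherwise. * If $j=n$ (respectively $j=-n$), then $V(\gamma)_k=\mathbb K$ for $i\le k\le n-2$ and for $k=n$ (respectively $k=n-1$), and $V(\gamma)_k=0$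 otherwise. The map of an arrow is the identity if the two spaces have the same nonzero dimension, $\begin{bmatrix}1\\0\end{bmatrix}$ for $n-1\to n-2$ and $\begin{bmatrix}0\\1\end{bmatrix}$ for $n\to n-2$ if it goes from $\mathbb K$ to $\mathbb K^2$, $\begin{bmatrix}1&1\end{bmatrix}$ if it goes from $\mathbb K^2$ to $\mathbb K$, and $0$ otherwise. **Proposition.** The action of $\varrho$ on $\mathrm{Eq}(\Sigma_n)$ induces an action on the indecomposable representations of $Q^n$: every $V(\gamma)$ is indecomposable, every indecomposable representation is isomorphic to some $V(\gamma)$, and $V(\gamma)\mapsto V(\varrho(\gamma))$ is a well-defined permutation of the isomorphism classes of indecomposable representations. Moreover, for every $[\gamma]\in\mathrm{Eq}(\Sigma_n)$, $$V(\varrho(\gamma))\;\simeq\;\begin{cases}\tau V(\gamma)&\text{if }\tau V(\gamma)\neq 0,\\ \nu V(\gamma)&\text{if }\tau V(\gamma)=0,\end{cases}$$ and $\tau V(\gamma)=0$ if and only if $V(\gamma)$ is projective. (The representation $V(\gamma)$ has a minimal projective presentation, and these statements hold for $\tau V(\gamma)$ computed from any such presentation.) -/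

import Mathlib

open CategoryTheory CategoryTheory.Limits

universe u

noncomputable section

/-! ## Finite-dimensional representations of a quiver -/

/-- A (finite-dimensional) representation over `K` of a quiver with vertex type `Q`. -/
structure QRep (K : Type u) [Field K] (Q : Type) [Quiver.{0} Q] where
  /-- the vector space at a vertex -/
  obj : Q → Type u
  [acg : ∀ i, AddCommGroup (obj i)]
  [mod : ∀ i, Module K (obj i)]
  [fin : ∀ i, FiniteDimensional K (obj i)]
  /-- the linear map of an arrow -/
  map : ∀ {i j : Q}, (i ⟶ j) → (obj i →ₗ[K] obj j)

namespace QRep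

attribute [instance] QRep.acg QRep.mod QRep.fin

variable {K : Type u} [Field K] {Q : Type} [Quiver.{0} Q]

/-- The space of morphisms `V → W`: families of linear maps `θ i : V i → W i` with
`θ j ∘ V a = W a ∘ θ i` for every arrow `a : i → j`. -/
def homSpace (V W : QRep K Q) : Submodule K (∀ i, V.obj i →ₗ[K] W.obj i) where
  carrier := {θ | ∀ ⦃i j : Q⦄ (a : i ⟶ j), θ j ∘ₗ V.map a = W.map a ∘ₗ θ i}
  add_mem' := by
    intro θ η hθ hη i j a
    simp only [Pi.add_apply, LinearMap.add_comp, LinearMap.comp_add, hθ a, hη a]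
  zero_mem' := by
    intro i j a
    simp
  smul_mem' := by
    intro c θ hθ i j a
    simp only [Pi.smul_apply, LinearMap.smul_comp, LinearMap.comp_smul, hθ a]

instance : Category (QRep K Q) where
  Hom V W := homSpace V W
  id V := ⟨fun _ => LinearMap.id, fun _ _ _ => rfl⟩
  comp θ η := ⟨fun i => η.1 i ∘ₗ θ.1 i, fun i j a => by
    rw [LinearMap.comp_assoc, θ.2 a, ← LinearMap.comp_assoc, η.2 a, LinearMap.comp_assoc]⟩

instance (V W : QRep K Q) : AddCommGroup (V ⟶ W) :=
  inferInstanceAs (AddCommGroup (homSpace V W))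

instance (V W : QRep K Q) : Module K (V ⟶ W) :=
  inferInstanceAs (Module K (homSpace V W))

instance [Finite Q] (V W : QRep K Q) : FiniteDimensional K (V ⟶ W) :=
  inferInstanceAs (FiniteDimensional K (homSpace V W))

instance : Preadditive (QRep K Q) where
  homGroup _ _ := inferInstance
  add_comp _ _ _ _ _ _ := Subtype.ext (funext fun _ => LinearMap.comp_add _ _ _)
  comp_add _ _ _ _ _ _ := Subtype.ext (funext fun _ => LinearMap.add_comp _ _ _)

/-- The direct sum of two representations. -/
def dirSum (V W : QRep K Q) : QRep K Q where
  obj i := V.obj i × W.obj i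
  map a := (V.map a).prodMap (W.map a)

/-- The direct sum is a biproduct. -/
def dirSumBicone (V W : QRep K Q) : BinaryBicone V W where
  pt := dirSum V W
  fst := ⟨fun _ => LinearMap.fst K _ _, fun _ _ _ => rfl⟩
  snd := ⟨fun _ => LinearMap.snd K _ _, fun _ _ _ => rfl⟩
  inl := ⟨fun _ => LinearMap.inl K _ _, fun _ _ a => by
    refine LinearMap.ext fun x => Prod.ext ?_ ?_
    · rfl
    · exact (map_zero (W.map a)).symm⟩
  inr := ⟨fun _ => LinearMap.inr K _ _, fun _ _ a => by
    refine LinearMap.ext fun x => Prod.ext ?_ ?_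
    · exact (map_zero (V.map a)).symm
    · rfl⟩
  inl_fst := Subtype.ext (funext fun _ => LinearMap.fst_comp_inl _ _ _)
  inl_snd := Subtype.ext (funext fun _ => LinearMap.snd_comp_inl _ _ _)
  inr_fst := Subtype.ext (funext fun _ => LinearMap.fst_comp_inr _ _ _)
  inr_snd := Subtype.ext (funext fun _ => LinearMap.snd_comp_inr _ _ _)

instance : HasBinaryBiproducts (QRep K Q) where
  has_binary_biproduct V W := HasBinaryBiproduct.mk
    { bicone := dirSumBicone V W
      isBilimit := isBinaryBilimitOfTotal _ (Subtype.ext (funext fun i => by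
        change LinearMap.inl K _ _ ∘ₗ LinearMap.fst K _ _ +
          LinearMap.inr K _ _ ∘ₗ LinearMap.snd K _ _ = LinearMap.id
        ext x <;> simp)) }

/-- The kernel of a morphism of representations. -/
def ker {V W : QRep K Q} (θ : V ⟶ W) : QRep K Q where
  obj i := LinearMap.ker (θ.1 i)
  map {i j} a := (V.map a).restrict (p := LinearMap.ker (θ.1 i)) (q := LinearMap.ker (θ.1 j))
    fun x hx => by
      have h := LinearMap.congr_fun (θ.2 a) x
      simp only [LinearMap.comp_apply] at h
      rw [LinearMap.mem_ker] at hx ⊢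
      rw [h, hx, map_zero]

/-- The inclusion of the kernel. -/
def kerι {V W : QRep K Q} (θ : V ⟶ W) : ker θ ⟶ V :=
  ⟨fun i => (LinearMap.ker (θ.1 i)).subtype, fun _ _ _ => rfl⟩

/-! ## The regular bimodule, the Nakayama functor, the Auslander–Reiten translation -/

section PathAlgebra

variable [∀ i j : Q, Finite (Quiver.Path i j)]

/-- The indecomposable projective summand `P k` of the path algebra `A` regarded as a
representation: the space at `j` has the paths from `k` to `j` as a basis, and an arrow
acts by prolonging paths. Thus `A = ⨁ k, P k`. -/
def proj (K : Type u) [Field K] (k : Q) : QRep K Q where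
  obj j := Quiver.Path k j →₀ K
  map a := Finsupp.lmapDomain K K fun p => p.cons a

/-- An arrow `a : j → k` acts on `A` from the other side, by the morphism `P k → P j` which
precedes each path by `a`. -/
def projMap (K : Type u) [Field K] {j k : Q} (a : j ⟶ k) : proj K k ⟶ proj K j :=
  ⟨fun _ => Finsupp.lmapDomain K K fun p => a.toPath.comp p, fun i l b => by
    change Finsupp.lmapDomain K K (fun p => a.toPath.comp p) ∘ₗ
        Finsupp.lmapDomain K K (fun p => p.cons b) =
      Finsupp.lmapDomain K K (fun p => p.cons b) ∘ₗ
        Finsupp.lmapDomain K K (fun p => a.toPath.comp p)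
    rw [← Finsupp.lmapDomain_comp, ← Finsupp.lmapDomain_comp]
    rfl⟩

/-- Composition `θ ↦ η ∘ θ` as a linear map `Hom(M, V) → Hom(M, W)`. -/
def homPost (M : QRep K Q) {V W : QRep K Q} (η : V ⟶ W) : (M ⟶ V) →ₗ[K] (M ⟶ W) where
  toFun θ := θ ≫ η
  map_add' _ _ := Preadditive.add_comp _ _ _ _ _ _
  map_smul' _ _ := Subtype.ext (funext fun _ => LinearMap.comp_smul _ _ _)

/-- Composition `θ ↦ θ ∘ η` as a linear map `Hom(N, V) → Hom(M, V)`. -/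
def homPre {M N : QRep K Q} (η : M ⟶ N) (V : QRep K Q) : (N ⟶ V) →ₗ[K] (M ⟶ V) where
  toFun θ := η ≫ θ
  map_add' _ _ := Preadditive.comp_add _ _ _ _ _ _
  map_smul' _ _ := Subtype.ext (funext fun _ => LinearMap.smul_comp _ _ _)

/-- The Nakayama functor on objects, `ν M = D Hom(M, A)` with `D = Hom_K(-, K)`. The summand
`Hom(M, P k)` of `Hom(M, A)` sits at the vertex `k`. -/
def nakayama [Finite Q] (M : QRep K Q) : QRep K Q where
  obj k := Module.Dual K (M ⟶ proj K k)
  map a := (homPost M (projMap K a)).dualMap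

/-- A projective cover: an epimorphism `f` from a projective object which is essential, i.e.
`g` is an epimorphism whenever `g ≫ f` is one. -/
structure IsProjectiveCover {P M : QRep K Q} (f : P ⟶ M) : Prop where
  projective : Projective P
  epi : Epi f
  essential : ∀ ⦃N : QRep K Q⦄ (g : N ⟶ P), Epi (g ≫ f) → Epi g

/-- A minimal projective presentation `P₁ → P₀ → M → 0`: projective covers
`p₀ : P₀ → M` and `p₁ : P₁ → ker p₀`. -/
structure MinProjPres (M : QRep K Q) where
  P₀ : QRep K Q
  P₁ : QRep K Q
  p₀ : P₀ ⟶ M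
  p₁ : P₁ ⟶ ker p₀
  cover₀ : IsProjectiveCover p₀
  cover₁ : IsProjectiveCover p₁

namespace MinProjPres

variable {M : QRep K Q} (p : MinProjPres M)

/-- The map `P₁ → P₀` of the presentation. -/
def d : p.P₁ ⟶ p.P₀ := p.p₁ ≫ kerι p.p₀

/-- The part at `k` of the transpose
`Tr M = Coker(Hom(d, A) : Hom(P₀, A) → Hom(P₁, A))`. -/
abbrev Tr (k : Q) : Type u :=
  (p.P₁ ⟶ proj K k) ⧸ LinearMap.range (homPre p.d (proj K k))

/-- The action of an arrow on the transpose (a representation of the opposite quiver). -/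
def trMap {j k : Q} (a : j ⟶ k) : p.Tr k →ₗ[K] p.Tr j :=
  Submodule.mapQ _ _ (homPost p.P₁ (projMap K a)) <| by
    rintro _ ⟨θ, rfl⟩
    exact ⟨θ ≫ projMap K a, (Category.assoc p.d θ (projMap K a)).symm⟩

/-- The Auslander–Reiten translate `τ M = D Tr M`, computed from the minimal projective
presentation `p` of `M`. -/
def tau [Finite Q] : QRep K Q where
  obj k := Module.Dual K (p.Tr k)
  map a := (p.trMap a).dualMap

end MinProjPres

end PathAlgebra

/-- The indecomposable representations up to isomorphism. -/
def indecSetoid (K : Type u) [Field K] (Q : Type) [Quiver.{0} Q] :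
    Setoid {M : QRep K Q // Indecomposable M} where
  r M N := Nonempty (M.1 ≅ N.1)
  iseqv :=
    { refl := fun M => ⟨Iso.refl M.1⟩
      symm := fun ⟨e⟩ => ⟨e.symm⟩
      trans := fun ⟨e⟩ ⟨f⟩ => ⟨e.trans f⟩ }

/-- The set of isomorphism classes of indecomposable representations. -/
def IndecClass (K : Type u) [Field K] (Q : Type) [Quiver.{0} Q] : Type (u + 1) :=
  Quotient (indecSetoid K Q)

/-- The isomorphism class of an indecomposable representation. -/
def indecClass (M : QRep K Q) (hM : Indecomposable M) : IndecClass K Q :=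
  Quotient.mk (indecSetoid K Q) ⟨M, hM⟩

end QRep

/-! ## The quiver of type `D` -/

/-- The vertices `1, …, n` of the quiver of type `D_n`. -/
def DVertex (n : ℕ) : Type := Set.Icc 1 n

/-- The number of a vertex. -/
def DVertex.num {n : ℕ} (k : DVertex n) : ℕ := k.1

instance (n : ℕ) : Finite (DVertex n) := inferInstanceAs (Finite (Set.Icc 1 n))

/-- The quiver `1 ← 2 ← ⋯ ← n-2` together with arrows `n-1 → n-2` and `n → n-2`. -/
instance (n : ℕ) : Quiver.{0} (DVertex n) where
  Hom k l := PLift ((l.num + 1 = k.num ∧ k.num + 1 ≤ n) ∨ (k.num = n ∧ l.num + 2 = n))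

theorem DVertex.num_lt {n : ℕ} {k l : DVertex n} (a : k ⟶ l) : l.num < k.num := by
  have h := a.down
  omega

instance DVertex.finite_path {n : ℕ} (i j : DVertex n) : Finite (Quiver.Path i j) := by
  have key : ∀ (m : ℕ) (j : DVertex n), n ≤ j.num + m → Finite (Quiver.Path i j) := by
    intro m
    induction m with
    | zero =>
      intro j hj
      have h0 : ∀ p : Quiver.Path i j, ∃ h : i = j, p = h ▸ Quiver.Path.nil := by
        intro p
        cases p with
        | nil => exact ⟨rfl, rfl⟩
        | @cons k _ q a =>
          have h1 := DVertex.num_lt a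
          have h2 : k.num ≤ n := k.2.2
          omega
      have : Subsingleton (Quiver.Path i j) := by
        constructor
        intro p q
        obtain ⟨h, rfl⟩ := h0 p
        obtain ⟨_, rfl⟩ := h0 q
        rfl
      infer_instance
    | succ m ih =>
      intro j hj
      have hfin : ∀ k : {k : DVertex n // j.num < k.num}, Finite (Quiver.Path i k.1) :=
        fun k => ih k.1 (by have := k.2; omega)
      have hhom : ∀ k : DVertex n, Finite (k ⟶ j) := fun k =>
        Finite.of_subsingleton (α := PLift _)
      let g : PLift (i = j) ⊕ (Σ k : {k : DVertex n // j.num < k.num},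
          Quiver.Path i k.1 × (k.1 ⟶ j)) → Quiver.Path i j := fun s =>
        match s with
        | .inl h => h.down ▸ Quiver.Path.nil
        | .inr ⟨_, q, a⟩ => q.cons a
      refine Finite.of_surjective g ?_
      intro p
      cases p with
      | nil => exact ⟨.inl ⟨rfl⟩, rfl⟩
      | @cons k _ q a => exact ⟨.inr ⟨⟨k, DVertex.num_lt a⟩, q, a⟩, rfl⟩
  exact key n j (by omega)

/-! ## Curves on the punctured disk

The `2n-2` boundary points carry, in clockwise order, the labels
`1, …, n-1, -1, …, -(n-1)`, and the puncture carries the labels `n` and `-n`. A geodesic curve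
is determined by the labels of its endpoints (the two curves which join a boundary point `i` to
the puncture are told apart by the label `n` or `-n`). -/

/-- An unordered pair of labels is a curve if one is the label `i` of a boundary point and the
other is a label `j` with `j ≠ i` and `j ≠ -i`. -/
def IsCurve (n : ℕ) (e : Sym2 ℤ) : Prop :=
  ∃ i j : ℤ, e = s(i, j) ∧ (1 ≤ i.natAbs ∧ i.natAbs + 1 ≤ n) ∧
    (1 ≤ j.natAbs ∧ j.natAbs ≤ n) ∧ j ≠ i ∧ j ≠ -i

/-- The geodesic curves. -/
def Curve (n : ℕ) : Type := {e : Sym2 ℤ // IsCurve n e}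

/-- The curve `γ'` whose endpoints are `-i` and `-j` if those of `γ` are `i` and `j`. -/
def Curve.opp {n : ℕ} (γ : Curve n) : Curve n :=
  ⟨γ.1.map (fun x => -x), by
    obtain ⟨i, j, h, hi, hj, h1, h2⟩ := γ.2
    refine ⟨-i, -j, by rw [h, Sym2.map_mk], ?_, ?_, ?_, ?_⟩ <;> omega⟩

theorem Curve.opp_opp {n : ℕ} (γ : Curve n) : γ.opp.opp = γ := by
  apply Subtype.ext
  change (γ.1.map (fun x => -x)).map (fun x => -x) = γ.1
  rw [Sym2.map_map]
  have : ((fun x : ℤ => -x) ∘ fun x : ℤ => -x) = id := by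
    funext x
    simp
  rw [this, Sym2.map_id, id]

/-- The equivalence relation with classes `{γ, γ'}`. -/
def curveSetoid (n : ℕ) : Setoid (Curve n) where
  r γ δ := δ = γ ∨ δ = γ.opp
  iseqv :=
    { refl := fun _ => Or.inl rfl
      symm := by
        rintro γ δ (rfl | rfl)
        · exact Or.inl rfl
        · exact Or.inr (Curve.opp_opp γ).symm
      trans := by
        rintro γ δ ε (rfl | rfl) (rfl | rfl)
        · exact Or.inl rfl
        · exact Or.inr rfl
        · exact Or.inr rfl
        · exact Or.inl (Curve.opp_opp γ) }

/-- The set of equivalence classes of curves. -/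
def CurveClass (n : ℕ) : Type := Quotient (curveSetoid n)

/-- The effect of the rotation on the label of an endpoint: a boundary point goes to its
counterclockwise neighbour, and the labels `n` and `-n` of the puncture are exchanged. -/
def rotLabel (n : ℕ) (x : ℤ) : ℤ :=
  if x = n ∨ x = -n then -x
  else if x = 1 then -((n : ℤ) - 1)
  else if x = -1 then (n : ℤ) - 1
  else if 0 < x then x - 1
  else x + 1

/-- The rotation `ϱ` of a curve. -/
def Curve.rot {n : ℕ} (γ : Curve n) : Curve n :=
  ⟨γ.1.map (rotLabel n), by
    obtain ⟨i, j, h, hi, hj, h1, h2⟩ := γ.2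
    refine ⟨rotLabel n i, rotLabel n j, by rw [h, Sym2.map_mk], ?_, ?_, ?_, ?_⟩ <;>
    · unfold rotLabel
      split_ifs <;> omega⟩

/-- The rotation `ϱ` of a class of curves. -/
def CurveClass.rot {n : ℕ} : CurveClass n → CurveClass n :=
  Quotient.map' Curve.rot <| by
    rintro γ δ (rfl | rfl)
    · exact Or.inl rfl
    · refine Or.inr (Subtype.ext ?_)
      obtain ⟨i, j, h, hi, hj, h1, h2⟩ := γ.2
      change (γ.1.map (fun x => -x)).map (rotLabel n) =
        (γ.1.map (rotLabel n)).map (fun x => -x)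
      have key : ∀ x : ℤ, 1 ≤ x.natAbs → rotLabel n (-x) = -rotLabel n x := by
        intro x hx
        unfold rotLabel
        split_ifs <;> omega
      rw [h, Sym2.map_mk, Sym2.map_mk, Sym2.map_mk, Sym2.map_mk, key i hi.1, key j hj.1]

/-- The endpoints `(i, j)` of the essential curve among `γ` and `γ'`, where `i` is the smallest
positive endpoint of these two curves. -/
def essentialEnds : Sym2 ℤ → ℤ × ℤ :=
  Sym2.lift ⟨fun a b =>
    if a.natAbs ≤ b.natAbs then (|a|, a.sign * b) else (|b|, b.sign * a), by
      intro a b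
      dsimp only
      split_ifs with h1 h2 h2
      · rcases Int.natAbs_eq_natAbs_iff.1 (le_antisymm h1 h2) with rfl | rfl
        · rfl
        · rw [abs_neg, Int.sign_neg]
          ring_nf
      · rfl
      · rfl
      · omega⟩

/-- `essentialEnds` does give the essential curve. -/
theorem essentialEnds_spec {n : ℕ} (γ : Curve n) :
    (s((essentialEnds γ.1).1, (essentialEnds γ.1).2) = γ.1 ∨
      s((essentialEnds γ.1).1, (essentialEnds γ.1).2) = γ.opp.1) ∧
    0 < (essentialEnds γ.1).1 ∧
    ∀ x : ℤ, x ∈ γ.1 ∨ x ∈ γ.opp.1 → 0 < x → (essentialEnds γ.1).1 ≤ x := by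
  obtain ⟨e, i, j, rfl, hi, hj, h1, h2⟩ := γ
  have habs : ∀ a : ℤ, 1 ≤ a.natAbs → (0 < a ∧ |a| = a ∧ a.sign = 1) ∨
      (a < 0 ∧ |a| = -a ∧ a.sign = -1) := by
    intro a ha
    rcases lt_or_gt_of_ne (show a ≠ 0 by omega) with h | h
    · exact Or.inr ⟨h, abs_of_neg h, Int.sign_eq_neg_one_of_neg h⟩
    · exact Or.inl ⟨h, abs_of_pos h, Int.sign_eq_one_of_pos h⟩
  simp only [Curve.opp, essentialEnds, Sym2.lift_mk, Sym2.map_mk, Sym2.mem_iff]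
  rcases habs i hi.1 with ⟨hi0, hi1, hi2⟩ | ⟨hi0, hi1, hi2⟩ <;>
  rcases habs j hj.1 with ⟨hj0, hj1, hj2⟩ | ⟨hj0, hj1, hj2⟩ <;>
  split_ifs with hle <;>
  simp only [hi1, hi2, hj1, hj2, one_mul, neg_mul, Sym2.eq_iff, and_self,
    true_or, or_true] <;>
  refine ⟨?_, ?_, ?_⟩ <;> first | trivial | omega

/-! ## The representation of a curve -/

/-- The dimension at the vertex `k` of the representation of the essential curve with
endpoints `i` and `j`, where `i` is the smallest positive endpoint. -/
def curveDim (n : ℕ) (i j : ℤ) (k : ℕ) : ℕ :=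
  if j = n then
    if (i ≤ k ∧ k + 2 ≤ n) ∨ k = n then 1 else 0
  else if j = -n then
    if (i ≤ k ∧ k + 2 ≤ n) ∨ k + 1 = n then 1 else 0
  else if 0 < j then
    if i ≤ k ∧ k ≤ j - 1 then 1 else 0
  else
    if -j ≤ k ∧ k + 2 ≤ n then 2
    else if (i ≤ k ∧ k ≤ -j - 1) ∨ k + 1 = n ∨ k = n then 1
    else 0

/-- The matrix of an arrow whose source is the vertex `s`, between spaces of dimensions `ds`
and `dt`: the identity for equal dimensions, the first and the second coordinate vector of `K²`
for the arrows `n-1 → n-2` and `n → n-2`, and the row `[1 1]` for an arrow from dimension two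
to dimension one. -/
def curveMatrix (K : Type u) [Field K] (n s ds dt : ℕ) : Matrix (Fin dt) (Fin ds) K :=
  Matrix.of fun r c =>
    if ds = dt then (if r.val = c.val then 1 else 0)
    else if ds = 1 ∧ dt = 2 ∧ s + 1 = n then (if r.val = 0 then 1 else 0)
    else if ds = 1 ∧ dt = 2 ∧ s = n then (if r.val = 1 then 1 else 0)
    else if ds = 2 ∧ dt = 1 then 1
    else 0

/-- The representation of the essential curve with endpoints `i` and `j`. -/
def endsRep (K : Type u) [Field K] (n : ℕ) (i j : ℤ) : QRep K (DVertex n) where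
  obj k := Fin (curveDim n i j k.num) → K
  map {k l} _ :=
    (curveMatrix K n k.num (curveDim n i j k.num) (curveDim n i j l.num)).mulVecLin

/-- The representation `V(γ)` of a curve, defined through the essential curve of its class. -/
def Curve.rep (K : Type u) [Field K] {n : ℕ} (γ : Curve n) : QRep K (DVertex n) :=
  endsRep K n (essentialEnds γ.1).1 (essentialEnds γ.1).2

/-- The representation `V(γ)` as a function of the class of `γ`. -/
def CurveClass.rep (K : Type u) [Field K] {n : ℕ} (x : CurveClass n) : QRep K (DVertex n) :=
  Quotient.liftOn' x (Curve.rep K) <| by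
    rintro γ δ (rfl | rfl)
    · rfl
    · have key : ∀ e : Sym2 ℤ, essentialEnds (e.map fun x => -x) = essentialEnds e := by
        intro e
        induction e using Sym2.ind with
        | _ a b => simp [essentialEnds, Int.sign_neg]
      unfold Curve.rep
      rw [show (γ.opp).1 = γ.1.map fun x => -x from rfl, key]

end

noncomputable section

namespace QRep

/-! ### Representations in general: kernels, epimorphisms, projective covers, indecomposability. -/

section General

variable {K : Type u} [Field K] {Q : Type} [Quiver.{0} Q]

/-! The representations of curves are of two kinds. A thin one, for `j > 0` or `j = -n`, has spaces
of dimension at most one and a single generator, at a vertex `a`. If its smallest endpoint is `i ≥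
2`, it is the cokernel of an embedding `P_{i-1} → P_a`; if `i = 1`, it is `P_a` itself. A thick one,
for `j = -m` with `m < n`, is a quotient of `P_{n-1} ⊕ P_n`. With `e₁, e₂` the two generators, the
relations are `e₁ = e₂` at `m - 1` and `e₂ = 0` at `i - 1`, so that the kernel is `P_{m-1} ⊕
P_{i-1}`; the second relation disappears if `i = 1`.

Since `τ` is the kernel of `ν P₁ → ν P₀`, and `Hom(P_c, P_k)` is `K` or `0` according to whether
there is a path from `k` to `c`, all translates can be read off from the matrix of relations
(`dualKerIso`). In the coordinates `y, x + y` of the planes, each arrow of a thick representation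
merely deletes coordinates, and the kernel just described is again a thick representation with `i`
and `m` lowered by one, or a thin one if `i = 1` (`thickRep_tau`, `thickRep_tau_of_eq_one`). The
thin case is `thinRep_tau`, and the projective case `ν P_a = I_a` is `thinRep_nakayama`. Comparison
with the rotation of endpoints gives `endsRep_tau_or_nakayama`. The translate does not depend on the
presentation (`MinProjPres.nonempty_tau_iso`). It vanishes for projectives; otherwise it is
isomorphic to the nonzero `V(ϱγ)`.

Indecomposability follows from `End = K`. Conversely, every nonzero representation has a thin or a
thick retract (`exists_retract`), and an indecomposable one is isomorphic to any of its nonzero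
retracts. Finally, dimension vectors separate the classes of curves (`IsEssential.eq_of_curveDim`),
so that the bijective rotation of classes carries over to the indecomposables. -/

theorem comp_apply {U V W : QRep K Q} (f : U ⟶ V) (g : V ⟶ W) (i : Q) (x : U.obj i) :
    (f ≫ g).1 i x = g.1 i (f.1 i x) := rfl

theorem hom_ext {V W : QRep K Q} {f g : V ⟶ W} (h : ∀ i x, f.1 i x = g.1 i x) : f = g :=
  Subtype.ext (funext fun i => LinearMap.ext (h i))

theorem hom_map {V W : QRep K Q} (f : V ⟶ W) {i j : Q} (a : i ⟶ j) (x : V.obj i) :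
    f.1 j (V.map a x) = W.map a (f.1 i x) :=
  LinearMap.congr_fun (f.2 a) x

/-- Evaluation of a morphism at an element of the source. -/
def evalAt {V : QRep K Q} (W : QRep K Q) {i : Q} (x : V.obj i) : (V ⟶ W) →ₗ[K] W.obj i where
  toFun f := f.1 i x
  map_add' _ _ := rfl
  map_smul' _ _ := rfl

/-- A pointwise bijective morphism is an isomorphism. -/
def isoOfBijective {V W : QRep K Q} (f : V ⟶ W) (h : ∀ i, Function.Bijective (f.1 i)) :
    V ≅ W where
  hom := f
  inv := ⟨fun i => (LinearEquiv.ofBijective (f.1 i) (h i)).symm, fun i j a => by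
    refine LinearMap.ext fun x => (h j).1 ?_
    rw [LinearMap.comp_apply, LinearMap.comp_apply]
    change f.1 j ((LinearEquiv.ofBijective (f.1 j) (h j)).symm (W.map a x)) =
      f.1 j (V.map a ((LinearEquiv.ofBijective (f.1 i) (h i)).symm x))
    rw [hom_map f]
    exact (LinearEquiv.apply_symm_apply (LinearEquiv.ofBijective (f.1 j) (h j)) _).trans
      (congrArg (W.map a)
        (LinearEquiv.apply_symm_apply (LinearEquiv.ofBijective (f.1 i) (h i)) x).symm)⟩
  hom_inv_id := hom_ext fun i x =>
    LinearEquiv.symm_apply_apply (LinearEquiv.ofBijective (f.1 i) (h i)) x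
  inv_hom_id := hom_ext fun i x =>
    LinearEquiv.apply_symm_apply (LinearEquiv.ofBijective (f.1 i) (h i)) x

/-- The linear equivalence at a vertex given by an isomorphism of representations. -/
def isoEquiv {V W : QRep K Q} (e : V ≅ W) (i : Q) : V.obj i ≃ₗ[K] W.obj i :=
  LinearEquiv.ofLinearMap (e.hom.1 i) (e.inv.1 i)
    (congrArg (fun f : W ⟶ W => f.1 i) e.inv_hom_id)
    (congrArg (fun f : V ⟶ V => f.1 i) e.hom_inv_id)

theorem isZero_of_subsingleton {V : QRep K Q} (h : ∀ i, Subsingleton (V.obj i)) : IsZero V := by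
  rw [IsZero.iff_id_eq_zero]
  exact hom_ext fun i x => Subsingleton.elim _ _

theorem eq_zero_of_isZero {V : QRep K Q} (h : IsZero V) {i : Q} (x : V.obj i) : x = 0 := by
  rw [IsZero.iff_id_eq_zero] at h
  exact congrArg (fun f : V ⟶ V => f.1 i x) h

theorem epi_of_surjective {V W : QRep K Q} (f : V ⟶ W)
    (h : ∀ i, Function.Surjective (f.1 i)) : Epi f where
  left_cancellation _ _ hg := hom_ext fun i x => by
    obtain ⟨y, rfl⟩ := h i x
    exact congrArg (fun φ : V ⟶ _ => φ.1 i y) hg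

/-- The cokernel of a morphism of representations. -/
def coker {V W : QRep K Q} (f : V ⟶ W) : QRep K Q where
  obj i := W.obj i ⧸ LinearMap.range (f.1 i)
  map {i j} a := Submodule.mapQ _ _ (W.map a) <| by
    rintro _ ⟨x, rfl⟩
    exact ⟨V.map a x, hom_map f a x⟩

/-- The projection to the cokernel. -/
def cokerπ {V W : QRep K Q} (f : V ⟶ W) : W ⟶ coker f :=
  ⟨fun i => Submodule.mkQ (LinearMap.range (f.1 i)), fun _ _ _ => rfl⟩

/-- The projection to the cokernel is killed by the epimorphism `f`, hence is zero, so each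
pointwise cokernel vanishes. -/
theorem surjective_of_epi {V W : QRep K Q} (f : V ⟶ W) [Epi f] (i : Q) :
    Function.Surjective (f.1 i) := by
  have h : cokerπ f = 0 := by
    rw [← cancel_epi f]
    exact hom_ext fun i x =>
      (Submodule.Quotient.mk_eq_zero (LinearMap.range (f.1 i))).2 ⟨x, rfl⟩
  intro y
  have hy := congrArg (fun φ : W ⟶ coker f => φ.1 i y) h
  exact (Submodule.Quotient.mk_eq_zero (LinearMap.range (f.1 i))).1 hy

/-- The factorization of a morphism through a kernel. -/
def kerLift {U V W : QRep K Q} (f : V ⟶ W) (g : U ⟶ V) (h : g ≫ f = 0) : U ⟶ ker f :=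
  ⟨fun i => (g.1 i).codRestrict (LinearMap.ker (f.1 i)) fun x =>
      congrArg (fun φ : U ⟶ W => φ.1 i x) h, fun i j a => by
    refine LinearMap.ext fun x => Subtype.ext ?_
    exact hom_map g a x⟩

theorem kerLift_kerι {U V W : QRep K Q} (f : V ⟶ W) (g : U ⟶ V) (h : g ≫ f = 0) :
    kerLift f g h ≫ kerι f = g := rfl

theorem kerι_comp {V W : QRep K Q} (f : V ⟶ W) : kerι f ≫ f = 0 :=
  hom_ext fun _ x => x.2

instance {V W : QRep K Q} (f : V ⟶ W) : Mono (kerι f) where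
  right_cancellation _ _ hg := hom_ext fun i x => Subtype.ext
    (congrArg (fun φ : _ ⟶ V => φ.1 i x) hg)

/-- Isomorphic morphisms have isomorphic kernels. -/
def kerIso {V V' W : QRep K Q} (f : V ⟶ W) (f' : V' ⟶ W) (e : V ≅ V') (h : e.hom ≫ f' = f) :
    ker f ≅ ker f' where
  hom := kerLift f' (kerι f ≫ e.hom) (by rw [Category.assoc, h, kerι_comp])
  inv := kerLift f (kerι f' ≫ e.inv) (by
    rw [Category.assoc, ← h, Iso.inv_hom_id_assoc, kerι_comp])
  hom_inv_id := by
    rw [← cancel_mono (kerι f), Category.assoc, kerLift_kerι, ← Category.assoc, kerLift_kerι,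
      Category.assoc, Iso.hom_inv_id, Category.comp_id, Category.id_comp]
  inv_hom_id := by
    rw [← cancel_mono (kerι f'), Category.assoc, kerLift_kerι, ← Category.assoc, kerLift_kerι,
      Category.assoc, Iso.inv_hom_id, Category.comp_id, Category.id_comp]

theorem IsProjectiveCover.comp_iso {P M N : QRep K Q} {f : P ⟶ M} (hf : IsProjectiveCover f)
    (e : M ≅ N) : IsProjectiveCover (f ≫ e.hom) where
  projective := hf.projective
  epi := by
    have := hf.epi
    infer_instance
  essential N g hg := hf.essential g <| by
    have : g ≫ f = (g ≫ f ≫ e.hom) ≫ e.inv := by simp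
    rw [this]
    infer_instance

/-- Projective covers are unique up to isomorphism. -/
theorem IsProjectiveCover.exists_iso {P P' M : QRep K Q} {f : P ⟶ M} {f' : P' ⟶ M}
    (hf : IsProjectiveCover f) (hf' : IsProjectiveCover f') :
    ∃ e : P ≅ P', e.hom ≫ f' = f := by
  have := hf.projective
  have := hf'.projective
  have := hf.epi
  have := hf'.epi
  obtain ⟨g, hg⟩ := Projective.factors f f'
  have hge : Epi g := hf'.essential g (by rw [hg]; infer_instance)
  obtain ⟨t, ht⟩ := Projective.factors (𝟙 P') g
  have hte : Epi t := hf.essential t (by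
    rw [← hg, ← Category.assoc, ht, Category.id_comp]; infer_instance)
  have : IsSplitMono t := ⟨⟨⟨g, ht⟩⟩⟩
  have : IsIso t := isIso_of_epi_of_isSplitMono t
  have hgi : IsIso g := by
    have h : g = inv t := by rw [eq_comm, IsIso.inv_eq_of_hom_inv_id ht]
    rw [h]
    infer_instance
  exact ⟨asIso g, hg⟩

theorem IsProjectiveCover.of_isIso {P M : QRep K Q} (f : P ⟶ M) [Projective P] [IsIso f] :
    IsProjectiveCover f where
  projective := inferInstance
  epi := inferInstance
  essential N g hg := by
    have : g = (g ≫ f) ≫ inv f := by simp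
    rw [this]
    infer_instance

/-- A representation all of whose endomorphisms are scalars is indecomposable. -/
theorem indecomposable_of_end {V : QRep K Q} (h0 : ¬ IsZero V)
    (h : ∀ f : V ⟶ V, ∃ c : K, f = c • 𝟙 V) : Indecomposable V := by
  refine ⟨h0, fun Y Z e => ?_⟩
  -- The idempotent onto the summand `Y` is a scalar `c`. It restricts to the identity on `Y` and to
  -- zero on `Z`, so `Y = 0` if `c = 0` and `Z = 0` otherwise.
  obtain ⟨c, hc⟩ := h (e.hom ≫ biprod.fst ≫ biprod.inl ≫ e.inv)
  have comp_smul' : ∀ {A B C : QRep K Q} (f : A ⟶ B) (c : K) (g : B ⟶ C),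
      f ≫ (c • g) = c • (f ≫ g) := fun f c g => hom_ext fun i x => rfl
  have smul_comp' : ∀ {A B C : QRep K Q} (f : A ⟶ B) (c : K) (g : B ⟶ C),
      (c • f) ≫ g = c • (f ≫ g) := fun f c g =>
    hom_ext fun i x => LinearMap.map_smul (g.1 i) c (f.1 i x)
  have h1 : (biprod.inl ≫ e.inv) ≫ (e.hom ≫ biprod.fst ≫ biprod.inl ≫ e.inv) ≫
      (e.hom ≫ biprod.fst) = 𝟙 Y := by simp
  have h2 : (biprod.inr ≫ e.inv) ≫ (e.hom ≫ biprod.fst ≫ biprod.inl ≫ e.inv) ≫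
      (e.hom ≫ biprod.snd) = 0 := by simp
  rw [hc, smul_comp', comp_smul', Category.id_comp] at h1 h2
  have h3 : (biprod.inl ≫ e.inv) ≫ e.hom ≫ biprod.fst = 𝟙 Y := by simp
  have h4 : (biprod.inr ≫ e.inv) ≫ e.hom ≫ biprod.snd = 𝟙 Z := by simp
  rw [h3] at h1
  rw [h4] at h2
  by_cases hc0 : c = 0
  · left
    rw [IsZero.iff_id_eq_zero, ← h1, hc0, zero_smul]
  · right
    rw [IsZero.iff_id_eq_zero]
    exact (smul_eq_zero.1 h2).resolve_left hc0

/-- A nonzero retract of an indecomposable representation is isomorphic to it. -/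
theorem iso_of_retract {V M : QRep K Q} (hM : Indecomposable M) (hV : ¬ IsZero V)
    (f : V ⟶ M) (g : M ⟶ V) (h : f ≫ g = 𝟙 V) : Nonempty (M ≅ V) := by
  have hs : (𝟙 M - g ≫ f) ≫ g = 0 := by
    rw [Preadditive.sub_comp, Category.assoc, h, Category.id_comp, Category.comp_id, sub_self]
  -- The retraction splits `M` as `V ⊕ ker g`; indecomposability then forces `ker g = 0`.
  let b : BinaryBicone V (ker g) :=
    { pt := M
      fst := g
      snd := kerLift g (𝟙 M - g ≫ f) hs
      inl := f
      inr := kerι g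
      inl_fst := h
      inl_snd := by
        rw [← cancel_mono (kerι g), Category.assoc, kerLift_kerι, Preadditive.comp_sub,
          ← Category.assoc, h, Category.comp_id, Category.id_comp, sub_self, zero_comp]
      inr_fst := kerι_comp g
      inr_snd := by
        rw [← cancel_mono (kerι g), Category.assoc, kerLift_kerι, Preadditive.comp_sub,
          ← Category.assoc, kerι_comp, Category.comp_id, Category.id_comp, zero_comp, sub_zero] }
  have hb : b.IsBilimit := isBinaryBilimitOfTotal b (by
    change g ≫ f + kerLift g (𝟙 M - g ≫ f) hs ≫ kerι g = 𝟙 M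
    rw [kerLift_kerι]
    abel)
  have hz : IsZero (ker g) := (hM.2 _ _ (biprod.uniqueUpToIso V (ker g) hb)).resolve_left hV
  refine ⟨⟨g, f, ?_, h⟩⟩
  have h2 : g ≫ f + kerLift g (𝟙 M - g ≫ f) hs ≫ kerι g = 𝟙 M := by
    rw [kerLift_kerι]
    abel
  rw [hz.eq_of_src (kerι g) 0, comp_zero, add_zero] at h2
  exact h2

theorem indecomposable_of_iso {M N : QRep K Q} (e : M ≅ N) (h : Indecomposable M) :
    Indecomposable N :=
  ⟨fun hz => h.1 (hz.of_iso e), fun Y Z f => h.2 Y Z (e ≪≫ f)⟩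

end General

/-! ### Dual cokernels: invariance of the translate, and the Nakayama functor as a special case. -/

section Translate

variable {K : Type u} [Field K] {Q : Type} [Quiver.{0} Q]
variable [∀ i j : Q, Finite (Quiver.Path i j)]

/-- The dual of the cokernel of `Hom(d, A)` for a morphism `d`. -/
def dualCoker [Finite Q] {P P' : QRep K Q} (d : P ⟶ P') : QRep K Q where
  obj k := Module.Dual K ((P ⟶ proj K k) ⧸ LinearMap.range (homPre d (proj K k)))
  map a := (Submodule.mapQ _ _ (homPost P (projMap K a)) (by
    rintro _ ⟨θ, rfl⟩
    exact ⟨θ ≫ projMap K a, (Category.assoc d θ (projMap K a)).symm⟩)).dualMap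

/-- The dual cokernel only depends on the isomorphism class of the morphism. -/
def dualCokerIso [Finite Q] {P P' R R' : QRep K Q} (d : P ⟶ P') (d' : R ⟶ R')
    (e : P ≅ R) (e' : P' ≅ R') (h : d ≫ e'.hom = e.hom ≫ d') : dualCoker d ≅ dualCoker d' := by
  have hinv : d' ≫ e'.inv = e.inv ≫ d := by
    rw [Iso.eq_inv_comp, ← Category.assoc, ← h, Category.assoc, Iso.hom_inv_id, Category.comp_id]
  -- Quantified over all commutative squares, so that it serves both for the given isomorphisms and
  -- for their inverses.
  have aux : ∀ {P P' R R' : QRep K Q} (d : P ⟶ P') (d' : R ⟶ R') (f : P ⟶ R) (f' : P' ⟶ R')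
      (_ : d ≫ f' = f ≫ d') (k : Q),
      LinearMap.range (homPre d' (proj K k)) ≤
        (LinearMap.range (homPre d (proj K k))).comap (homPre f (proj K k)) := by
    rintro P P' R R' d d' f f' h k _ ⟨θ, rfl⟩
    exact ⟨f' ≫ θ, show d ≫ f' ≫ θ = f ≫ d' ≫ θ by
      rw [← Category.assoc, h, Category.assoc]⟩
  let F : ∀ k, (R ⟶ proj K k) ⧸ LinearMap.range (homPre d' (proj K k)) →ₗ[K]
      (P ⟶ proj K k) ⧸ LinearMap.range (homPre d (proj K k)) :=
    fun k => Submodule.mapQ _ _ (homPre e.hom (proj K k)) (aux d d' e.hom e'.hom h k)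
  let G : ∀ k, (P ⟶ proj K k) ⧸ LinearMap.range (homPre d (proj K k)) →ₗ[K]
      (R ⟶ proj K k) ⧸ LinearMap.range (homPre d' (proj K k)) :=
    fun k => Submodule.mapQ _ _ (homPre e.inv (proj K k)) (aux d' d e.inv e'.inv hinv k)
  have hFG : ∀ k x, F k (G k x) = x := by
    intro k x
    induction x using Submodule.Quotient.induction_on with
    | _ θ =>
      exact congrArg (Submodule.mkQ _) (show e.hom ≫ e.inv ≫ θ = θ by simp)
  have hGF : ∀ k x, G k (F k x) = x := by
    intro k x
    induction x using Submodule.Quotient.induction_on with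
    | _ θ =>
      exact congrArg (Submodule.mkQ _) (show e.inv ≫ e.hom ≫ θ = θ by simp)
  refine isoOfBijective ⟨fun k => (F k).dualMap, fun i j a => ?_⟩ fun k => ?_
  · refine LinearMap.ext fun (φ : Module.Dual K _) => LinearMap.ext fun x => ?_
    induction x using Submodule.Quotient.induction_on with
    | _ θ =>
      exact congrArg (fun y => φ (Submodule.mkQ _ y))
        (Category.assoc e.hom θ (projMap K a)).symm
  · constructor
    · intro (φ : Module.Dual K _) (ψ : Module.Dual K _) h
      refine LinearMap.ext fun x => ?_
      have := LinearMap.congr_fun h (G k x)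
      change φ (F k (G k x)) = ψ (F k (G k x)) at this
      rwa [hFG] at this
    · intro (φ : Module.Dual K _)
      refine ⟨(G k).dualMap φ, LinearMap.ext fun x => ?_⟩
      change φ (G k (F k x)) = φ x
      rw [hGF]

/-- The translate does not depend on the minimal projective presentation. -/
theorem MinProjPres.nonempty_tau_iso [Finite Q] {M : QRep K Q} (p q : MinProjPres M) :
    Nonempty (p.tau ≅ q.tau) := by
  obtain ⟨e, he⟩ := p.cover₀.exists_iso q.cover₀
  -- The comparison of the covers of `M` identifies the two kernels, after which `P₁` on both sides
  -- covers the same object.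
  obtain ⟨e', he'⟩ := (p.cover₁.comp_iso (kerIso p.p₀ q.p₀ e he)).exists_iso q.cover₁
  refine ⟨dualCokerIso p.d q.d e' e ?_⟩
  rw [MinProjPres.d, MinProjPres.d, ← Category.assoc, he', Category.assoc, Category.assoc]
  rfl

/-- If `M` is projective, a section of the cover `P₀ → M` is an epimorphism by essentiality, so the
cover is an isomorphism. Its kernel is zero, hence so are `P₁` and `Tr M`. -/
theorem MinProjPres.isZero_tau [Finite Q] {M : QRep K Q} (p : MinProjPres M)
    (hM : Projective M) : IsZero p.tau := by
  have := p.cover₀.epi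
  obtain ⟨t, ht⟩ := Projective.factors (𝟙 M) p.p₀
  have hte : Epi t := p.cover₀.essential t (by rw [ht]; infer_instance)
  have : IsSplitMono t := ⟨⟨⟨p.p₀, ht⟩⟩⟩
  have : IsIso t := isIso_of_epi_of_isSplitMono t
  have hp : Mono p.p₀ := by
    have h : p.p₀ = inv t := by rw [eq_comm, IsIso.inv_eq_of_hom_inv_id ht]
    rw [h]
    infer_instance
  have hk : IsZero (ker p.p₀) := by
    rw [IsZero.iff_id_eq_zero, ← cancel_mono (kerι p.p₀), ← cancel_mono p.p₀, Category.assoc,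
      kerι_comp, comp_zero, zero_comp, zero_comp]
  have h1 : IsZero p.P₁ := by
    -- Every morphism into the zero kernel is an epimorphism; essentiality applied to the zero
    -- endomorphism therefore gives `P₁ = 0`.
    have : Epi (0 : p.P₁ ⟶ p.P₁) := p.cover₁.essential 0 ⟨fun g g' _ => hk.eq_of_src g g'⟩
    rw [IsZero.iff_id_eq_zero, ← cancel_epi (0 : p.P₁ ⟶ p.P₁), zero_comp, zero_comp]
  refine isZero_of_subsingleton fun k =>
    ⟨fun (φ : Module.Dual K (p.Tr k)) (ψ : Module.Dual K (p.Tr k)) => LinearMap.ext fun x => ?_⟩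
  induction x using Submodule.Quotient.induction_on with
  | _ θ =>
    rw [h1.eq_of_src θ 0]
    exact (map_zero φ).trans (map_zero ψ).symm

/-- The Nakayama functor as a dual cokernel. -/
def nakayamaIso [Finite Q] {M Z : QRep K Q} (hZ : IsZero Z) (d : M ⟶ Z) :
    nakayama M ≅ dualCoker d := by
  have h : ∀ k, LinearMap.range (homPre d (proj K k)) = ⊥ := by
    intro k
    rw [LinearMap.range_eq_bot]
    refine LinearMap.ext fun θ => ?_
    rw [hZ.eq_of_src θ 0]
    exact comp_zero (f := d)
  refine Iso.symm (isoOfBijective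
    ⟨fun k => (Submodule.mkQ (LinearMap.range (homPre d (proj K k)))).dualMap,
      fun i j a => rfl⟩ fun k => ⟨?_, ?_⟩)
  · exact LinearMap.dualMap_injective_of_surjective (Submodule.mkQ_surjective _)
  · exact LinearMap.dualMap_surjective_of_injective (by
      rw [← LinearMap.ker_eq_bot, Submodule.ker_mkQ, h k])

end Translate

end QRep

end

noncomputable section

/-! ### Paths in the quiver of type `D`. -/

namespace DVertex

variable {n : ℕ}

theorem num_pos (k : DVertex n) : 1 ≤ k.num := k.2.1

theorem num_le (k : DVertex n) : k.num ≤ n := k.2.2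

theorem num_injective {k l : DVertex n} (h : k.num = l.num) : k = l := Subtype.ext h

/-- The vertex with a given number. -/
def ofNum (m : ℕ) (h1 : 1 ≤ m) (h2 : m ≤ n) : DVertex n := ⟨m, h1, h2⟩

@[simp]
theorem num_ofNum (m : ℕ) (h1 : 1 ≤ m) (h2 : m ≤ n) : (ofNum m h1 h2 : DVertex n).num = m := rfl

/-- There is a path from `k` to `l`. -/
def Reach (k l : DVertex n) : Prop :=
  k.num = l.num ∨ (l.num < k.num ∧ l.num + 2 ≤ n)

instance (k l : DVertex n) : Decidable (Reach k l) := inferInstanceAs (Decidable (_ ∨ _))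

theorem Reach.refl (k : DVertex n) : Reach k k := Or.inl rfl

theorem Reach.arrow {k l m : DVertex n} (h : Reach k l) (a : l ⟶ m) : Reach k m := by
  have := a.down
  unfold Reach at *
  omega

theorem reach_of_path {k l : DVertex n} (p : Quiver.Path k l) : Reach k l := by
  induction p with
  | nil => exact Reach.refl k
  | cons p a ih => exact ih.arrow a

theorem Reach.nonempty_path {k l : DVertex n} (h : Reach k l) : Nonempty (Quiver.Path k l) := by
  obtain ⟨d, hd⟩ : ∃ d, k.num = l.num + d := ⟨k.num - l.num, by unfold Reach at h; omega⟩
  induction d generalizing l with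
  | zero =>
    obtain rfl : k = l := num_injective hd
    exact ⟨.nil⟩
  | succ d ih =>
    -- The arrow `n → n - 2` is the only one that lowers the number by two; every other path ends
    -- with the arrow `l + 1 → l`.
    by_cases hkl : k.num = n ∧ l.num + 2 = n
    · have a : k ⟶ l := ⟨Or.inr hkl⟩
      exact ⟨a.toPath⟩
    · have hk := k.num_le
      have hl := l.num_pos
      let m : DVertex n := ofNum (l.num + 1) (by omega) (by omega)
      have hm : m.num = l.num + 1 := rfl
      have a : m ⟶ l := ⟨Or.inl (by unfold Reach at h; omega)⟩
      obtain ⟨p⟩ := ih (l := m) (by unfold Reach at *; omega) (by omega)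
      exact ⟨p.cons a⟩

instance (k l : DVertex n) : Subsingleton (k ⟶ l) := inferInstanceAs (Subsingleton (PLift _))

/-- The last arrow of a path from `k` is determined by its target. Only `n - 2` has two incoming
arrows, and their sources `n - 1` and `n` are not both reachable from one vertex. -/
theorem path_eq {k l : DVertex n} (p q : Quiver.Path k l) : p = q := by
  induction p with
  | nil =>
    cases q with
    | nil => rfl
    | cons q a =>
      have h1 := reach_of_path q
      have h2 := a.down
      unfold Reach at h1
      omega
  | @cons l m p a ih =>
    cases q with
    | nil =>
      have h1 := reach_of_path p
      have h2 := a.down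
      unfold Reach at h1
      omega
    | @cons l' _ q b =>
      have h1 := reach_of_path p
      have h2 := reach_of_path q
      have h3 := a.down
      have h4 := b.down
      obtain rfl : l = l' := num_injective (by unfold Reach at h1 h2; omega)
      rw [ih q, Subsingleton.elim a b]

instance (k l : DVertex n) : Subsingleton (Quiver.Path k l) := ⟨path_eq⟩

end DVertex

open DVertex

namespace QRep

variable {K : Type u} [Field K] {n : ℕ}

/-! ### Transport along paths -/

/-- The linear map of a path. -/
def mapPath {Q : Type} [Quiver.{0} Q] (M : QRep K Q) {i : Q} :
    ∀ {j : Q}, Quiver.Path i j → (M.obj i →ₗ[K] M.obj j)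
  | _, .nil => LinearMap.id
  | _, .cons p a => M.map a ∘ₗ mapPath M p

/-- The linear map of the path from `k` to `l`, and zero if there is none. -/
def trans (M : QRep K (DVertex n)) (k l : DVertex n) : M.obj k →ₗ[K] M.obj l :=
  if h : Reach k l then M.mapPath h.nonempty_path.some else 0

theorem trans_eq_mapPath (M : QRep K (DVertex n)) {k l : DVertex n} (p : Quiver.Path k l) :
    M.trans k l = M.mapPath p := by
  rw [trans, dif_pos (reach_of_path p), Subsingleton.elim p (reach_of_path p).nonempty_path.some]

theorem trans_of_not_reach (M : QRep K (DVertex n)) {k l : DVertex n} (h : ¬ Reach k l) :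
    M.trans k l = 0 := dif_neg h

@[simp]
theorem trans_self (M : QRep K (DVertex n)) (k : DVertex n) (x : M.obj k) :
    M.trans k k x = x := by
  rw [trans_eq_mapPath M .nil]
  rfl

theorem map_trans (M : QRep K (DVertex n)) {k l m : DVertex n} (h : Reach k l) (a : l ⟶ m)
    (x : M.obj k) : M.map a (M.trans k l x) = M.trans k m x := by
  obtain ⟨p⟩ := h.nonempty_path
  rw [trans_eq_mapPath M p, trans_eq_mapPath M (p.cons a)]
  rfl

theorem trans_trans (M : QRep K (DVertex n)) {k l m : DVertex n} (h : Reach k l)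
    (h' : Reach l m) (x : M.obj k) : M.trans l m (M.trans k l x) = M.trans k m x := by
  obtain ⟨p⟩ := h'.nonempty_path
  induction p with
  | nil => rw [trans_self]
  | cons p a ih =>
    have hp := reach_of_path p
    obtain ⟨q⟩ := h.nonempty_path
    rw [← map_trans M hp a, ih hp, map_trans M (reach_of_path (q.comp p))]

theorem trans_map (M : QRep K (DVertex n)) {k l m : DVertex n} (a : k ⟶ l) (h : Reach l m)
    (x : M.obj k) : M.trans l m (M.map a x) = M.trans k m x := by
  have h1 := M.map_trans (Reach.refl k) a x
  rw [trans_self] at h1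
  rw [h1, trans_trans M ((Reach.refl k).arrow a) h]

/-- With `trans` set to zero where there is no path, naturality needs no case distinction by the
user. -/
theorem hom_trans {M N : QRep K (DVertex n)} (f : M ⟶ N) (k l : DVertex n) (x : M.obj k) :
    f.1 l (M.trans k l x) = N.trans k l (f.1 k x) := by
  by_cases h : Reach k l
  · obtain ⟨p⟩ := h.nonempty_path
    induction p with
    | nil => rw [trans_self, trans_self]
    | cons p a ih =>
      have hp := reach_of_path p
      rw [← map_trans M hp a, hom_map, ih hp, map_trans N hp a]
  · rw [trans_of_not_reach M h, trans_of_not_reach N h]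
    exact map_zero (f.1 l)

/-! ### Free representations -/

section Free

variable {ι : Type}

/-- The coordinates supported at the generators from which `k` can be reached. -/
def freeSpace (K : Type u) [Field K] (s : ι → DVertex n) (k : DVertex n) :
    Submodule K (ι → K) where
  carrier := {w | ∀ b, ¬ Reach (s b) k → w b = 0}
  add_mem' {v w} hv hw b h := by simp [hv b h, hw b h]
  zero_mem' _ _ := rfl
  smul_mem' c w hw b h := by simp [hw b h]

variable [Fintype ι]

/-- The projective representation with one generator at each vertex `s b`. -/
def free (K : Type u) [Field K] (s : ι → DVertex n) : QRep K (DVertex n) where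
  obj k := freeSpace K s k
  map a := Submodule.inclusion fun _ hw b h => hw b fun h' => h (h'.arrow a)

/-- The coordinates of an element of a free representation. -/
def freeVal (s : ι → DVertex n) (k : DVertex n) : (free K s).obj k →ₗ[K] (ι → K) :=
  (freeSpace K s k).subtype

/-- The element of a free representation with given coordinates. -/
def freeMk (s : ι → DVertex n) (k : DVertex n) (w : ι → K)
    (h : ∀ b, ¬ Reach (s b) k → w b = 0) : (free K s).obj k :=
  (⟨w, h⟩ : freeSpace K s k)

@[simp]
theorem freeVal_mk (s : ι → DVertex n) (k : DVertex n) (w : ι → K)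
    (h : ∀ b, ¬ Reach (s b) k → w b = 0) : freeVal s k (freeMk s k w h) = w := rfl

theorem freeVal_ext {s : ι → DVertex n} {k : DVertex n} {v w : (free K s).obj k}
    (h : ∀ b, freeVal s k v b = freeVal s k w b) : v = w :=
  Subtype.ext (funext h)

theorem freeVal_eq_zero {s : ι → DVertex n} {k : DVertex n} {b : ι} (h : ¬ Reach (s b) k)
    (w : (free K s).obj k) : freeVal s k w b = 0 :=
  (show freeSpace K s k from w).2 b h

theorem freeVal_map (s : ι → DVertex n) {k l : DVertex n} (a : k ⟶ l) (w : (free K s).obj k) :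
    freeVal s l ((free K s).map a w) = freeVal s k w := rfl

theorem freeVal_trans (s : ι → DVertex n) {k l : DVertex n} (h : Reach k l)
    (w : (free K s).obj k) : freeVal s l ((free K s).trans k l w) = freeVal s k w := by
  obtain ⟨p⟩ := h.nonempty_path
  induction p with
  | nil => rw [trans_self]
  | cons p a ih =>
    have hp := reach_of_path p
    rw [← map_trans _ hp a, freeVal_map, ih hp]

/-- The morphism from a free representation with given images of the generators. -/
def freeLift (s : ι → DVertex n) (M : QRep K (DVertex n)) (m : ∀ b, M.obj (s b)) :
    free K s ⟶ M :=
  ⟨fun k => Fintype.linearCombination K (fun b => M.trans (s b) k (m b)) ∘ₗ freeVal s k,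
    fun k l a => by
    refine LinearMap.ext fun w => ?_
    rw [LinearMap.comp_apply, LinearMap.comp_apply, LinearMap.comp_apply, LinearMap.comp_apply,
      Fintype.linearCombination_apply, Fintype.linearCombination_apply, map_sum, freeVal_map]
    refine Finset.sum_congr rfl fun b _ => ?_
    by_cases h : Reach (s b) k
    · rw [map_smul, map_trans M h a]
    · rw [freeVal_eq_zero h, zero_smul, zero_smul, map_zero]⟩

theorem freeLift_apply (s : ι → DVertex n) (M : QRep K (DVertex n)) (m : ∀ b, M.obj (s b))
    (k : DVertex n) (w : (free K s).obj k) :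
    (freeLift s M m).1 k w = ∑ b, freeVal s k w b • M.trans (s b) k (m b) := rfl

variable {κ : Type} [Fintype κ]

/-- The morphism of free representations given by a matrix. -/
def freeMap (t : ι → DVertex n) (s : κ → DVertex n) (D : ι → κ → K)
    (hD : ∀ c b, Reach (s b) (t c) ∨ D c b = 0) : free K t ⟶ free K s :=
  freeLift t (free K s) fun c => freeMk s (t c) (D c) fun b h => (hD c b).resolve_left h

theorem freeMap_apply (t : ι → DVertex n) (s : κ → DVertex n) (D : ι → κ → K)
    (hD : ∀ c b, Reach (s b) (t c) ∨ D c b = 0) (k : DVertex n) (w : (free K t).obj k) (b : κ) :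
    freeVal s k ((freeMap t s D hD).1 k w) b = ∑ c, freeVal t k w c * D c b := by
  rw [freeMap, freeLift_apply, map_sum, Finset.sum_apply]
  refine Finset.sum_congr rfl fun c _ => ?_
  by_cases h : Reach (t c) k
  · rw [map_smul, freeVal_trans s h, freeVal_mk, Pi.smul_apply, smul_eq_mul]
  · rw [freeVal_eq_zero h, zero_smul, map_zero, Pi.zero_apply, zero_mul]

variable [DecidableEq ι]

/-- The generators of a free representation. -/
def gen (K : Type u) [Field K] (s : ι → DVertex n) (b : ι) : (free K s).obj (s b) :=
  freeMk s (s b) (Pi.single b 1) fun c h => Pi.single_eq_of_ne (by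
    rintro rfl
    exact h (Reach.refl _)) _

theorem freeVal_gen (s : ι → DVertex n) (b : ι) :
    freeVal s (s b) (gen K s b) = Pi.single b 1 := rfl

theorem free_eq_sum (s : ι → DVertex n) (k : DVertex n) (w : (free K s).obj k) :
    w = ∑ b, freeVal s k w b • (free K s).trans (s b) k (gen K s b) := by
  refine freeVal_ext fun c => ?_
  rw [map_sum, Finset.sum_apply, Finset.sum_eq_single c]
  · by_cases h : Reach (s c) k
    · rw [map_smul, freeVal_trans s h, freeVal_gen]
      simp
    · rw [map_smul, freeVal_eq_zero h, zero_smul, Pi.zero_apply]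
  · intro b _ hb
    by_cases h : Reach (s b) k
    · rw [map_smul, freeVal_trans s h, freeVal_gen]
      simp [hb.symm]
    · rw [map_smul, freeVal_eq_zero h, zero_smul, Pi.zero_apply]
  · simp

/-- A morphism from a free representation is determined by the images of the generators. -/
theorem free_hom_apply (s : ι → DVertex n) {M : QRep K (DVertex n)} (f : free K s ⟶ M)
    (k : DVertex n) (w : (free K s).obj k) :
    f.1 k w = ∑ b, freeVal s k w b • M.trans (s b) k (f.1 (s b) (gen K s b)) := by
  conv_lhs => rw [free_eq_sum s k w]
  rw [map_sum]
  refine Finset.sum_congr rfl fun b _ => ?_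
  rw [map_smul, hom_trans]

theorem free_hom_ext {s : ι → DVertex n} {M : QRep K (DVertex n)} {f g : free K s ⟶ M}
    (h : ∀ b, f.1 (s b) (gen K s b) = g.1 (s b) (gen K s b)) : f = g :=
  hom_ext fun k w => by
    rw [free_hom_apply, free_hom_apply]
    simp only [h]

theorem freeLift_gen (s : ι → DVertex n) (M : QRep K (DVertex n)) (m : ∀ b, M.obj (s b)) (b : ι) :
    (freeLift s M m).1 (s b) (gen K s b) = m b := by
  rw [freeLift_apply, Finset.sum_eq_single b]
  · rw [freeVal_gen, Pi.single_eq_same, one_smul, trans_self]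
  · intro c _ hc
    rw [freeVal_gen, Pi.single_eq_of_ne hc, zero_smul]
  · simp

theorem projective_free (s : ι → DVertex n) : Projective (free K s) where
  factors {E X} f e he := by
    choose m hm using fun b => surjective_of_epi e (s b) (f.1 (s b) (gen K s b))
    exact ⟨freeLift s E m, free_hom_ext fun b => by rw [comp_apply, freeLift_gen, hm]⟩

end Free

/-! ### The summands of the path algebra -/

/-- The sum of the coefficients of an element of `proj K k`. -/
def aug (K : Type u) [Field K] (k j : DVertex n) : (proj K k).obj j →ₗ[K] K :=
  Finsupp.linearCombination K fun _ : Quiver.Path k j => (1 : K)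

theorem aug_map {k i j : DVertex n} (a : i ⟶ j) (x : (proj K k).obj i) :
    aug K k j ((proj K k).map a x) = aug K k i x :=
  Finsupp.linearCombination_mapDomain K _ x

theorem aug_projMap {k l j : DVertex n} (a : k ⟶ l) (x : (proj K l).obj j) :
    aug K k j ((projMap K a).1 j x) = aug K l j x :=
  Finsupp.linearCombination_mapDomain K _ x

theorem aug_trans {k i j : DVertex n} (h : Reach i j) (x : (proj K k).obj i) :
    aug K k j ((proj K k).trans i j x) = aug K k i x := by
  obtain ⟨p⟩ := h.nonempty_path
  induction p with
  | nil => rw [trans_self]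
  | cons p a ih =>
    have hp := reach_of_path p
    rw [← map_trans _ hp a, aug_map, ih hp]

/-- At most one path runs from `k` to `j`, so the sum of the coefficients is the only coefficient.
-/
theorem aug_injective (k j : DVertex n) : Function.Injective (aug K k j) := by
  intro (x : Quiver.Path k j →₀ K) (y : Quiver.Path k j →₀ K) h
  refine Finsupp.ext fun p => ?_
  have : ∀ z : Quiver.Path k j →₀ K, aug K k j z = z p := by
    intro z
    change Finsupp.linearCombination K _ z = _
    have : z = Finsupp.single p (z p) := Finsupp.ext fun q => by
      rw [Subsingleton.elim q p, Finsupp.single_eq_same]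
    rw [this]
    simp
  rw [← this, ← this, h]

theorem aug_eq_zero {k j : DVertex n} (h : ¬ Reach k j) (x : (proj K k).obj j) :
    aug K k j x = 0 := by
  have : x = (0 : Quiver.Path k j →₀ K) := Finsupp.ext fun p => (h (reach_of_path p)).elim
  rw [this]
  exact map_zero _

theorem exists_aug_eq {k j : DVertex n} (c : K) (h : Reach k j ∨ c = 0) :
    ∃ x, aug K k j x = c := by
  rcases h with h | rfl
  · obtain ⟨p⟩ := h.nonempty_path
    refine ⟨(Finsupp.single p c : Quiver.Path k j →₀ K), ?_⟩
    change Finsupp.linearCombination K _ _ = _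
    simp
  · exact ⟨0, map_zero _⟩

section Coords

variable {ι : Type} [Fintype ι] [DecidableEq ι]

/-- The coordinates of a morphism from a free representation to `proj K k`. -/
def coord (t : ι → DVertex n) (k : DVertex n) (c : ι) : (free K t ⟶ proj K k) →ₗ[K] K :=
  aug K k (t c) ∘ₗ evalAt (proj K k) (gen K t c)

theorem coord_apply (t : ι → DVertex n) (k : DVertex n) (c : ι) (θ : free K t ⟶ proj K k) :
    coord t k c θ = aug K k (t c) (θ.1 (t c) (gen K t c)) := rfl

theorem coord_ext {t : ι → DVertex n} {k : DVertex n} {θ η : free K t ⟶ proj K k}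
    (h : ∀ c, coord t k c θ = coord t k c η) : θ = η :=
  free_hom_ext fun c => aug_injective _ _ (h c)

theorem coord_eq_zero {t : ι → DVertex n} {k : DVertex n} {c : ι} (h : ¬ Reach k (t c))
    (θ : free K t ⟶ proj K k) : coord t k c θ = 0 := aug_eq_zero h _

/-- Preceding paths by an arrow preserves coefficient sums. Hence the arrows of `Hom(P, A)` become
inclusions of coordinates, and their duals delete coordinates. -/
theorem coord_projMap (t : ι → DVertex n) {k l : DVertex n} (a : k ⟶ l) (c : ι)
    (θ : free K t ⟶ proj K l) : coord t k c (θ ≫ projMap K a) = coord t l c θ :=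
  aug_projMap a _

theorem exists_coord_eq (t : ι → DVertex n) (k : DVertex n) (w : ι → K)
    (h : ∀ c, Reach k (t c) ∨ w c = 0) : ∃ θ : free K t ⟶ proj K k, ∀ c, coord t k c θ = w c := by
  choose m hm using fun c => exists_aug_eq (w c) (h c)
  exact ⟨freeLift t _ m, fun c => by rw [coord_apply, freeLift_gen, hm]⟩

theorem aug_free_hom (s : ι → DVertex n) {k l : DVertex n} (η : free K s ⟶ proj K k)
    (u : (free K s).obj l) : aug K k l (η.1 l u) = ∑ b, freeVal s l u b * coord s k b η := by
  rw [free_hom_apply, map_sum]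
  refine Finset.sum_congr rfl fun b _ => ?_
  rw [map_smul, smul_eq_mul]
  by_cases h : Reach (s b) l
  · rw [aug_trans h]
    rfl
  · rw [freeVal_eq_zero h, zero_mul, zero_mul]

theorem coord_freeMap_comp {κ : Type} [Fintype κ] [DecidableEq κ] (t : ι → DVertex n)
    (s : κ → DVertex n)
    (D : ι → κ → K) (hD : ∀ c b, Reach (s b) (t c) ∨ D c b = 0) (k : DVertex n)
    (η : free K s ⟶ proj K k) (c : ι) :
    coord t k c (freeMap t s D hD ≫ η) = ∑ b, D c b * coord s k b η := by
  rw [coord_apply, comp_apply, freeMap, freeLift_gen, aug_free_hom]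
  rfl

end Coords

/-! ### Representations on subspaces of coordinate spaces -/

section CoordRep

variable {ι κ : Type}

/-- The linear map which replaces the coordinates outside `p` by zero. -/
def cut (K : Type u) [Field K] (p : ι → Prop) [DecidablePred p] : (ι → K) →ₗ[K] (ι → K) where
  toFun w c := if p c then w c else 0
  map_add' v w := funext fun c => by by_cases h : p c <;> simp [h]
  map_smul' r w := funext fun c => by by_cases h : p c <;> simp [h]

theorem cut_apply (p : ι → Prop) [DecidablePred p] (w : ι → K) (c : ι) :
    cut K p w c = if p c then w c else 0 := rfl

variable [Fintype ι]

/-- A representation by subspaces of a coordinate space, where arrows delete coordinates. -/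
def coordRep (X : DVertex n → Submodule K (ι → K)) (T : DVertex n → ι → Prop)
    [∀ k, DecidablePred (T k)]
    (h : ∀ k l (_ : k ⟶ l), ∀ w ∈ X k, cut K (T l) w ∈ X l) : QRep K (DVertex n) where
  obj k := X k
  map {k l} a := (cut K (T l)).restrict (h k l a)

/-- The kernel of the Nakayama functor on the morphism of free representations given by a
matrix, in coordinates. -/
def dualKer (t : ι → DVertex n) (s : κ → DVertex n) (D : ι → κ → K) (k : DVertex n) :
    Submodule K (ι → K) where
  carrier := {w | (∀ c, ¬ Reach k (t c) → w c = 0) ∧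
    ∀ b, Reach k (s b) → ∑ c, w c * D c b = 0}
  add_mem' {v w} hv hw := ⟨fun c h => by simp [hv.1 c h, hw.1 c h], fun b h => by
    simp [add_mul, Finset.sum_add_distrib, hv.2 b h, hw.2 b h]⟩
  zero_mem' := by simp
  smul_mem' r w hw := ⟨fun c h => by simp [hw.1 c h], fun b h => by
    simp [mul_assoc, ← Finset.mul_sum, hw.2 b h]⟩

/-- This is the functoriality of the kernel of `ν P₁ → ν P₀`: the equation at `s b` survives because
every deleted coordinate has coefficient zero in it. -/
theorem cut_mem_dualKer {t : ι → DVertex n} {s : κ → DVertex n} {D : ι → κ → K}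
    (hD : ∀ c b, Reach (s b) (t c) ∨ D c b = 0) {k l : DVertex n} (a : k ⟶ l) {w : ι → K}
    (hw : w ∈ dualKer t s D k) : cut K (fun c => Reach l (t c)) w ∈ dualKer t s D l := by
  refine ⟨fun c h => if_neg h, fun b hb => ?_⟩
  rw [← hw.2 b ?_]
  · refine Finset.sum_congr rfl fun c _ => ?_
    rw [cut_apply]
    split_ifs with h
    · rfl
    -- A path from `s b` to `t c`, preceded by the one from `l` to `s b`, would give a path from `l`
    -- to `t c`, against the deletion of `c`.
    · rw [(hD c b).resolve_left ?_, mul_zero, mul_zero]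
      unfold Reach at *
      omega
  · have := a.down
    unfold Reach at *
    omega

/-- The dual cokernel of a morphism of free representations in coordinates. -/
def dualKerRep (t : ι → DVertex n) (s : κ → DVertex n) (D : ι → κ → K)
    (hD : ∀ c b, Reach (s b) (t c) ∨ D c b = 0) : QRep K (DVertex n) :=
  coordRep (dualKer t s D) (fun k c => Reach k (t c)) fun _ _ a _ hw => cut_mem_dualKer hD a hw

end CoordRep

end QRep

end

noncomputable section

open DVertex

namespace QRep

variable {K : Type u} [Field K] {n : ℕ}

/-! ### Isomorphisms with representations on coordinate subspaces. -/

section CoordRep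

variable {ι κ : Type} [Fintype ι] {X : DVertex n → Submodule K (ι → K)}
  {T : DVertex n → ι → Prop} [∀ k, DecidablePred (T k)]
  {h : ∀ k l (_ : k ⟶ l), ∀ w ∈ X k, cut K (T l) w ∈ X l}

/-- The coordinates of an element of a representation by subspaces of a coordinate space. -/
def coordVal (h : ∀ k l (_ : k ⟶ l), ∀ w ∈ X k, cut K (T l) w ∈ X l) (k : DVertex n) :
    (coordRep X T h).obj k →ₗ[K] (ι → K) := (X k).subtype

/-- The element with given coordinates. -/
def coordMk (h : ∀ k l (_ : k ⟶ l), ∀ w ∈ X k, cut K (T l) w ∈ X l) (k : DVertex n) (w : ι → K)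
    (hw : w ∈ X k) : (coordRep X T h).obj k := (⟨w, hw⟩ : X k)

theorem coordVal_mem (k : DVertex n) (w : (coordRep X T h).obj k) : coordVal h k w ∈ X k :=
  (show X k from w).2

theorem coordVal_ext {k : DVertex n} {v w : (coordRep X T h).obj k}
    (hvw : ∀ c, coordVal h k v c = coordVal h k w c) : v = w := Subtype.ext (funext hvw)

/-- Representations by equal subspaces of a coordinate space. -/
def coordRepIso {X' : DVertex n → Submodule K (ι → K)} {T' : DVertex n → ι → Prop}
    [∀ k, DecidablePred (T' k)] {h' : ∀ k l (_ : k ⟶ l), ∀ w ∈ X' k, cut K (T' l) w ∈ X' l}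
    (hX : ∀ k w, w ∈ X k ↔ w ∈ X' k)
    (hT : ∀ k l (_ : k ⟶ l), ∀ w ∈ X k, cut K (T l) w = cut K (T' l) w) :
    coordRep X T h ≅ coordRep X' T' h' :=
  isoOfBijective (W := coordRep X' T' h')
    ⟨fun k => (coordVal h k).codRestrict (X' k) fun w => (hX k _).1 (coordVal_mem k w),
      fun k l a => LinearMap.ext fun w => Subtype.ext (hT k l a _ (coordVal_mem k w))⟩
    fun k => ⟨fun _ _ hvw => Subtype.ext (congrArg (fun z : X' k => z.1) hvw),
      fun w => ⟨coordMk h k w.1 ((hX k _).2 w.2), rfl⟩⟩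

/-- A representation with injective coordinates is a representation by subspaces. -/
def isoCoordRep (V : QRep K (DVertex n)) (f : ∀ k, V.obj k →ₗ[K] (ι → K))
    (hinj : ∀ k, Function.Injective (f k)) (hX : ∀ k w, w ∈ X k ↔ ∃ v, f k v = w)
    (hmap : ∀ k l (a : k ⟶ l) (v : V.obj k), f l (V.map a v) = cut K (T l) (f k v)) :
    V ≅ coordRep X T h :=
  isoOfBijective (W := coordRep X T h)
    ⟨fun k => (f k).codRestrict (X k) fun v => (hX k _).2 ⟨v, rfl⟩,
      fun k l a => LinearMap.ext fun v => Subtype.ext (hmap k l a v)⟩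
    fun k => ⟨fun v w hvw => hinj k (congrArg Subtype.val hvw), fun w => by
      obtain ⟨v, hv⟩ := (hX k w.1).1 w.2
      exact ⟨v, Subtype.ext hv⟩⟩

end CoordRep

/-! ### Translates and Nakayama images of free presentations in coordinates. -/

section Pres

variable {ι κ : Type} [Fintype ι] [Fintype κ] [DecidableEq ι] [DecidableEq κ]
  (t : ι → DVertex n) (s : κ → DVertex n) (D : ι → κ → K)
  (hD : ∀ c b, Reach (s b) (t c) ∨ D c b = 0)

/-- The coordinates of an element of the dual cokernel. -/
def dualKerVal (k : DVertex n) : (dualKerRep t s D hD).obj k →ₗ[K] (ι → K) :=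
  (dualKer t s D k).subtype

/-- The functional on the cokernel of `Hom(d, A)` with given coordinates. -/
def dualKerFunctional (k : DVertex n) :
    (dualKerRep t s D hD).obj k →ₗ[K] (dualCoker (freeMap t s D hD)).obj k where
  toFun w := Submodule.liftQ _
    (∑ c, dualKerVal t s D hD k w c • coord t k c) (by
      rintro _ ⟨η, rfl⟩
      have hw : dualKerVal t s D hD k w ∈ dualKer t s D k := w.2
      rw [LinearMap.mem_ker, LinearMap.sum_apply]
      set v := dualKerVal t s D hD k w
      calc ∑ c, (v c • coord t k c) (freeMap t s D hD ≫ η)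
          = ∑ c, ∑ b, v c * D c b * coord s k b η := by
            refine Finset.sum_congr rfl fun c _ => ?_
            rw [LinearMap.smul_apply, coord_freeMap_comp, smul_eq_mul, Finset.mul_sum]
            simp only [mul_assoc]
        _ = ∑ b, (∑ c, v c * D c b) * coord s k b η := by
            rw [Finset.sum_comm]
            simp only [Finset.sum_mul]
        _ = 0 := Finset.sum_eq_zero fun b _ => by
            by_cases hb : Reach k (s b)
            · rw [hw.2 b hb, zero_mul]
            · rw [coord_eq_zero hb, mul_zero])
  map_add' v w := by
    refine LinearMap.ext fun (x : _ ⧸ _) => ?_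
    induction x using Submodule.Quotient.induction_on with
    | _ θ =>
      change (∑ c, _ : _ →ₗ[K] K) θ = (∑ c, _ : _ →ₗ[K] K) θ + (∑ c, _ : _ →ₗ[K] K) θ
      rw [← LinearMap.add_apply, ← Finset.sum_add_distrib]
      simp only [map_add, Pi.add_apply, add_smul]
  map_smul' r w := by
    refine LinearMap.ext fun (x : _ ⧸ _) => ?_
    induction x using Submodule.Quotient.induction_on with
    | _ θ =>
      change (∑ c, _ : _ →ₗ[K] K) θ = r • (∑ c, _ : _ →ₗ[K] K) θ
      rw [← LinearMap.smul_apply, Finset.smul_sum]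
      simp only [map_smul, Pi.smul_apply, smul_assoc]

theorem dualKerFunctional_apply (k : DVertex n) (w : (dualKerRep t s D hD).obj k)
    (θ : free K t ⟶ proj K k) :
    (show Module.Dual K (_ ⧸ _) from dualKerFunctional t s D hD k w) (Submodule.Quotient.mk θ) =
      ∑ c, dualKerVal t s D hD k w c * coord t k c θ :=
  LinearMap.sum_apply _ _ _

/-- The dual cokernel of a morphism of free representations. -/
def dualKerIso : dualKerRep t s D hD ≅ dualCoker (freeMap t s D hD) := by
  refine isoOfBijective ⟨dualKerFunctional t s D hD, fun k l a => ?_⟩ fun k => ⟨?_, ?_⟩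
  · refine LinearMap.ext fun w => LinearMap.ext fun (x : _ ⧸ _) => ?_
    induction x using Submodule.Quotient.induction_on with
    | _ θ =>
      refine (dualKerFunctional_apply t s D hD l _ θ).trans
        (Eq.trans ?_ (dualKerFunctional_apply t s D hD k w (θ ≫ projMap K a)).symm)
      refine Finset.sum_congr rfl fun c _ => ?_
      rw [coord_projMap]
      by_cases hc : Reach l (t c)
      · refine congrArg (· * _) ?_
        exact if_pos hc
      · rw [coord_eq_zero hc, mul_zero, mul_zero]
  · refine (injective_iff_map_eq_zero (dualKerFunctional t s D hD k)).2 fun w hw => ?_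
    refine coordVal_ext (h := fun _ _ a _ hw => cut_mem_dualKer hD a hw) fun c => ?_
    change dualKerVal t s D hD k w c = 0
    by_cases hc : Reach k (t c)
    · obtain ⟨θ, hθ⟩ := exists_coord_eq (K := K) t k (Pi.single c 1) fun c' => by
        by_cases h : c' = c
        · exact Or.inl (h ▸ hc)
        · exact Or.inr (Pi.single_eq_of_ne h _)
      have h1 := dualKerFunctional_apply t s D hD k w θ
      rw [hw] at h1
      simp only [hθ] at h1
      rw [Finset.sum_eq_single c (fun b _ hb => by rw [Pi.single_eq_of_ne hb, mul_zero])
        (by simp), Pi.single_eq_same, mul_one] at h1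
      exact h1.symm
    · exact (show dualKer t s D k from w).2.1 c hc
  · intro (F : Module.Dual K (_ ⧸ _))
    -- A dual basis for the coordinates of `Hom(free K t, P k)`; its member is zero at each `c` that
    -- `k` does not reach.
    choose θ hθ using fun c => exists_coord_eq (K := K) t k
      (Pi.single c (if Reach k (t c) then 1 else 0)) fun c' => by
        by_cases h : c' = c
        · subst h
          by_cases hc : Reach k (t c')
          · exact Or.inl hc
          · exact Or.inr (by rw [Pi.single_eq_same, if_neg hc])
        · exact Or.inr (Pi.single_eq_of_ne h _)
    have hF : ∀ η : free K t ⟶ proj K k, F (Submodule.Quotient.mk η) =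
        ∑ c, F (Submodule.Quotient.mk (θ c)) * coord t k c η := by
      intro η
      have hη : η = ∑ c, coord t k c η • θ c := by
        refine coord_ext fun c => ?_
        rw [map_sum, Finset.sum_eq_single c]
        · rw [map_smul, hθ, Pi.single_eq_same]
          by_cases hc : Reach k (t c)
          · rw [if_pos hc, smul_eq_mul, mul_one]
          · rw [coord_eq_zero hc, zero_smul]
        · intro b _ hb
          rw [map_smul, hθ, Pi.single_eq_of_ne hb.symm, smul_zero]
        · simp
      conv_lhs => rw [hη]
      rw [← Submodule.mkQ_apply, map_sum, map_sum]
      refine Finset.sum_congr rfl fun c _ => ?_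
      rw [map_smul, map_smul, smul_eq_mul, mul_comm]
      rfl
    refine ⟨coordMk (fun _ _ a _ hw => cut_mem_dualKer hD a hw) k
      (fun c => F (Submodule.Quotient.mk (θ c))) ⟨fun c hc => ?_, fun b hb => ?_⟩, ?_⟩
    · have : θ c = 0 := coord_ext fun c' => by
        rw [hθ, if_neg hc, Pi.single_zero, map_zero, Pi.zero_apply]
      exact (congrArg (fun z => F (Submodule.Quotient.mk z)) this).trans (map_zero F)
    -- The functional vanishes on the image of `Hom(d, A)`. Testing it on the morphism dual to the
    -- generator `b` isolates the equation at `b`.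
    · obtain ⟨η, hη⟩ := exists_coord_eq (K := K) s k (Pi.single b 1) fun b' => by
        by_cases h : b' = b
        · exact Or.inl (h ▸ hb)
        · exact Or.inr (Pi.single_eq_of_ne h _)
      have h1 := hF (freeMap t s D hD ≫ η)
      have h2 : (Submodule.Quotient.mk (freeMap t s D hD ≫ η) :
          (free K t ⟶ proj K k) ⧸ LinearMap.range (homPre (freeMap t s D hD) (proj K k))) = 0 :=
        (Submodule.Quotient.mk_eq_zero _).2 ⟨η, rfl⟩
      rw [h2, map_zero] at h1
      rw [h1]
      refine Finset.sum_congr rfl fun c _ => ?_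
      rw [coord_freeMap_comp, Finset.sum_eq_single b (fun b' _ hb' => by
        rw [hη, Pi.single_eq_of_ne hb', mul_zero]) (by simp), hη, Pi.single_eq_same, mul_one]
    · refine LinearMap.ext fun (x : _ ⧸ _) => ?_
      induction x using Submodule.Quotient.induction_on with
      | _ η => exact (dualKerFunctional_apply t s D hD k _ η).trans (hF η).symm

/-- A minimal projective presentation by free representations. -/
def minProjPres {M : QRep K (DVertex n)} (p : free K s ⟶ M)
    (hp : ∀ k, Function.Surjective (p.1 k)) (hs : ∀ b, Function.Injective (p.1 (s b)))
    (hinj : ∀ k, Function.Injective ((freeMap t s D hD).1 k))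
    (hex : ∀ k w, p.1 k w = 0 ↔ ∃ v, (freeMap t s D hD).1 k v = w) : MinProjPres M where
  P₀ := free K s
  P₁ := free K t
  p₀ := p
  p₁ := kerLift p (freeMap t s D hD) (hom_ext fun k v => (hex k _).2 ⟨v, rfl⟩)
  cover₀ :=
    { projective := projective_free s
      epi := epi_of_surjective p hp
      essential := fun N g hg => epi_of_surjective g fun k w => by
        have hb : ∀ b, ∃ y, g.1 (s b) y = gen K s b := fun b => by
          -- Injectivity of `p` at the vertices of the generators is what minimality needs: a lift
          -- of the image of a generator is a lift of the generator itself, and so `g` has a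
          -- section.
          obtain ⟨y, hy⟩ := surjective_of_epi (g ≫ p) (s b) (p.1 (s b) (gen K s b))
          exact ⟨y, hs b hy⟩
        choose y hy using hb
        have h1 : freeLift s N y ≫ g = 𝟙 _ := free_hom_ext fun b => by
          rw [comp_apply, freeLift_gen, hy]
          rfl
        exact ⟨(freeLift s N y).1 k w,
          congrArg (fun φ : free K s ⟶ free K s => φ.1 k w) h1⟩ }
  cover₁ := by
    have := projective_free (K := K) t
    have h1 : IsIso (kerLift p (freeMap t s D hD)
        (hom_ext fun k v => (hex k _).2 ⟨v, rfl⟩)) :=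
      (isoOfBijective (kerLift p (freeMap t s D hD)
        (hom_ext fun k v => (hex k _).2 ⟨v, rfl⟩)) fun k => ⟨fun v w hvw =>
          hinj k (congrArg Subtype.val hvw), fun w => by
            obtain ⟨v, hv⟩ := (hex k w.1).1 w.2
            exact ⟨v, Subtype.ext hv⟩⟩).isIso_hom
    exact IsProjectiveCover.of_isIso _

end Pres

theorem exists_minProjPres {ι κ : Type} [Fintype ι] [Fintype κ] [DecidableEq ι] [DecidableEq κ]
    (t : ι → DVertex n) (s : κ → DVertex n) (D : ι → κ → K)
    (hD : ∀ c b, Reach (s b) (t c) ∨ D c b = 0) {M : QRep K (DVertex n)} (p : free K s ⟶ M)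
    (hp : ∀ k, Function.Surjective (p.1 k)) (hs : ∀ b, Function.Injective (p.1 (s b)))
    (hinj : ∀ k, Function.Injective ((freeMap t s D hD).1 k))
    (hex : ∀ k w, p.1 k w = 0 ↔ ∃ v, (freeMap t s D hD).1 k v = w) :
    ∃ q : MinProjPres M, Nonempty (dualKerRep t s D hD ≅ q.tau) :=
  ⟨minProjPres t s D hD p hp hs hinj hex, ⟨dualKerIso t s D hD⟩⟩

/-- The free representation without generators is a zero target, so no equations remain: `ν P_c`
consists of the coordinates supported where `c` can be reached. -/
theorem nonempty_nakayama_free_iso {ι : Type} [Fintype ι] [DecidableEq ι] (t : ι → DVertex n) :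
    Nonempty (dualKerRep t (fun b : Empty => b.elim) (fun _ b => b.elim) (fun _ b => b.elim) ≅
      nakayama (free K t)) :=
  ⟨dualKerIso t _ _ _ ≪≫ (nakayamaIso (isZero_of_subsingleton fun _ =>
    ⟨fun _ _ => freeVal_ext fun b => b.elim⟩) _).symm⟩

/-- The Nakayama functor respects isomorphisms. -/
theorem nonempty_nakayama_iso {M N : QRep K (DVertex n)} (e : M ≅ N) :
    Nonempty (nakayama M ≅ nakayama N) := by
  let Z : QRep K (DVertex n) := free K fun b : Empty => b.elim
  have hZ : IsZero Z := isZero_of_subsingleton fun _ => ⟨fun _ _ => freeVal_ext fun b => b.elim⟩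
  exact ⟨nakayamaIso hZ (0 : M ⟶ Z) ≪≫ dualCokerIso _ _ e (Iso.refl Z)
    (hZ.eq_of_tgt _ _) ≪≫ (nakayamaIso hZ (0 : N ⟶ Z)).symm⟩

end QRep

end

noncomputable section

open DVertex

namespace QRep

variable {K : Type u} [Field K] {n : ℕ}

/-! ### Thin representations -/

/-- The space at `k` of the thin representation with support `S`. -/
def thinSpace (K : Type u) [Field K] (S : DVertex n → Prop) (k : DVertex n) :
    Submodule K (Unit → K) where
  carrier := {w | ¬ S k → w () = 0}
  add_mem' {v w} hv hw h := by simp [hv h, hw h]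
  zero_mem' _ := rfl
  smul_mem' r w hw h := by simp [hw h]

/-- The representation with one-dimensional spaces on `S` and identity maps. -/
def thinRep (K : Type u) [Field K] (S : DVertex n → Prop) [DecidablePred S] :
    QRep K (DVertex n) :=
  coordRep (thinSpace K S) (fun k _ => S k) fun _ _ _ _ _ h => if_neg h

theorem curveDim_eq_zero_or_one {S : DVertex n → Prop} [DecidablePred S] {i j : ℤ}
    (hd : ∀ k : DVertex n, curveDim n i j k.num = if S k then 1 else 0) (k : DVertex n) :
    (S k ∧ curveDim n i j k.num = 1) ∨ (¬ S k ∧ curveDim n i j k.num = 0) := by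
  have := hd k
  split_ifs at this with h
  · exact Or.inl ⟨h, this⟩
  · exact Or.inr ⟨h, this⟩

/-- The sum of the coordinates makes sense for every dimension. Using it as the coordinate of a thin
representation avoids any transport along equalities of dimensions. -/
theorem sum_curveMatrix (n s ds dt : ℕ) (hs : ds = 1 ∨ ds = 0) (ht : dt = 1) (v : Fin ds → K) :
    ∑ r, (curveMatrix K n s ds dt).mulVecLin v r = ∑ r, v r := by
  subst ht
  rcases hs with rfl | rfl
  · simp [curveMatrix, Matrix.mulVec, dotProduct]
  · simp [curveMatrix, Matrix.mulVec, dotProduct]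

/-- The sum of the coordinates. -/
def sumVal (K : Type u) [Field K] (d : ℕ) : (Fin d → K) →ₗ[K] (Unit → K) :=
  LinearMap.pi fun _ => ∑ r, LinearMap.proj r

theorem sumVal_apply (d : ℕ) (v : Fin d → K) (c : Unit) : sumVal K d v c = ∑ r, v r := by
  simp [sumVal]

theorem endsRep_iso_thinRep {S : DVertex n → Prop} [DecidablePred S] {i j : ℤ}
    (hd : ∀ k : DVertex n, curveDim n i j k.num = if S k then 1 else 0) :
    Nonempty (endsRep K n i j ≅ thinRep K S) := by
  refine ⟨isoCoordRep _ (fun k => sumVal K _) (fun k => ?_) (fun k w => ?_) fun k l a v => ?_⟩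
  · have key : ∀ d, d = 1 ∨ d = 0 → Function.Injective (sumVal K d) := by
      rintro d (rfl | rfl) v w h
      · have := congrFun h ()
        rw [sumVal_apply, sumVal_apply, Fin.sum_univ_one, Fin.sum_univ_one] at this
        funext r
        rw [Subsingleton.elim r 0, this]
      · exact Subsingleton.elim _ _
    exact key _ ((curveDim_eq_zero_or_one hd k).imp And.right And.right)
  · have key : ∀ d, (S k ∧ d = 1) ∨ (¬ S k ∧ d = 0) →
        (w ∈ thinSpace K S k ↔ ∃ v : Fin d → K, sumVal K d v = w) := by
      rintro d (⟨h, rfl⟩ | ⟨h, rfl⟩)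
      · refine ⟨fun _ => ⟨fun _ => w (), funext fun _ => ?_⟩, fun _ h' => (h' h).elim⟩
        rw [sumVal_apply, Fin.sum_univ_one]
      · refine ⟨fun hw => ⟨0, funext fun _ => ?_⟩, ?_⟩
        · rw [sumVal_apply, Fin.sum_univ_zero]
          exact (hw h).symm
        · rintro ⟨v, rfl⟩ _
          rw [sumVal_apply, Fin.sum_univ_zero]
    exact key _ (curveDim_eq_zero_or_one hd k)
  · funext c
    refine (sumVal_apply _ _ c).trans (Eq.trans ?_ (cut_apply (fun _ => S l) _ c).symm)
    split_ifs with h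
    · exact (sum_curveMatrix n _ _ _ ((curveDim_eq_zero_or_one hd k).imp And.right And.right)
        (by rw [hd, if_pos h]) v).trans (sumVal_apply _ _ c).symm
    · have hl : curveDim n i j l.num = 0 := by rw [hd, if_neg h]
      have : IsEmpty (Fin (curveDim n i j l.num)) := by
        rw [hl]
        infer_instance
      exact Finset.sum_of_isEmpty _

/-! ### Thick representations -/

/-- The dimension of the thick representation at a vertex. -/
def thickDim (n i m k : ℕ) : ℕ :=
  if m ≤ k ∧ k + 2 ≤ n then 2 else if i ≤ k then 1 else 0

/-- The space at `k` of a thick representation. -/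
def thickSpace (K : Type u) [Field K] (i m : ℕ) (k : DVertex n) : Submodule K (Fin 2 → K) where
  carrier := {w | (k.num < m → w 0 = 0) ∧ (k.num < i → w 1 = 0) ∧ (k.num + 1 = n → w 0 = 0) ∧
    (k.num = n → w 0 = w 1)}
  add_mem' {v w} hv hw := ⟨fun h => by simp [hv.1 h, hw.1 h],
    fun h => by simp [hv.2.1 h, hw.2.1 h], fun h => by simp [hv.2.2.1 h, hw.2.2.1 h],
    fun h => by simp [hv.2.2.2 h, hw.2.2.2 h]⟩
  zero_mem' := by simp
  smul_mem' r w hw := ⟨fun h => by simp [hw.1 h], fun h => by simp [hw.2.1 h],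
    fun h => by simp [hw.2.2.1 h], fun h => by simp [hw.2.2.2 h]⟩

/-- The representation with the dimensions `thickDim n i m`, in the coordinates `y` and `x + y`
of the spaces of dimension two. -/
def thickRep (K : Type u) [Field K] (n i m : ℕ) : QRep K (DVertex n) :=
  coordRep (thickSpace K i m) (fun k c => ![m, i] c ≤ k.num) fun k l a w hw => by
    have ha := a.down
    refine ⟨fun h => if_neg (not_le.2 h), fun h => if_neg (not_le.2 h), fun h => by omega,
      fun h => by omega⟩

/-- The coordinates of a thick representation. -/
def thickVal (K : Type u) [Field K] (d : ℕ) (top : Prop) [Decidable top] :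
    (Fin d → K) →ₗ[K] (Fin 2 → K) :=
  LinearMap.pi ![∑ r, if (d = 2 ∧ r.val = 1) ∨ (d = 1 ∧ top) then LinearMap.proj r else 0,
    ∑ r, LinearMap.proj r]

theorem thickVal_zero_two (top : Prop) [Decidable top] (v : Fin 2 → K) :
    thickVal K 2 top v 0 = v 1 := by
  simp [thickVal]

theorem thickVal_zero_one (top : Prop) [Decidable top] (v : Fin 1 → K) :
    thickVal K 1 top v 0 = if top then v 0 else 0 := by
  by_cases h : top <;> simp [thickVal, h]

theorem thickVal_zero_zero (top : Prop) [Decidable top] (v : Fin 0 → K) :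
    thickVal K 0 top v 0 = 0 := by
  simp [thickVal]

theorem thickVal_one (d : ℕ) (top : Prop) [Decidable top] (v : Fin d → K) :
    thickVal K d top v 1 = ∑ r, v r := by
  simp [thickVal]

/-- In the coordinates `(y, x + y)` the line at `n - 1` becomes `(0, *)`, the line at `n` becomes
the diagonal, and the row `[1 1]` becomes the projection to the second coordinate. So each arrow
keeps coordinate `0` exactly for targets `≥ m` and coordinate `1` exactly for targets `≥ i`. -/
theorem thickVal_curveMatrix (n i m s t ds dt : ℕ) (him : i < m) (hm : m + 1 ≤ n)
    (hst : (t + 1 = s ∧ s + 1 ≤ n) ∨ (s = n ∧ t + 2 = n))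
    (hds : ds = thickDim n i m s) (hdt : dt = thickDim n i m t) (v : Fin ds → K) :
    thickVal K dt (t = n) ((curveMatrix K n s ds dt).mulVecLin v) =
      cut K (fun c => ![m, i] c ≤ t) (thickVal K ds (s = n) v) := by
  have hcase : (dt = 0 ∧ t < i) ∨ (dt = 1 ∧ i ≤ t ∧ t < m ∧ (ds = 1 ∨ ds = 2)) ∨
      (dt = 2 ∧ m ≤ t ∧ ((ds = 2 ∧ s + 2 ≤ n) ∨ (ds = 1 ∧ s + 1 = n) ∨ (ds = 1 ∧ s = n))) := by
    unfold thickDim at *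
    split_ifs at * <;> omega
  have htn : t ≠ n := by omega
  have key : thickVal K dt (t = n) ((curveMatrix K n s ds dt).mulVecLin v) 0 =
        (if m ≤ t then thickVal K ds (s = n) v 0 else 0) ∧
      thickVal K dt (t = n) ((curveMatrix K n s ds dt).mulVecLin v) 1 =
        (if i ≤ t then thickVal K ds (s = n) v 1 else 0) := by
    rcases hcase with ⟨rfl, h⟩ | ⟨rfl, h1, h2, rfl | rfl⟩ |
      ⟨rfl, h1, ⟨rfl, h2⟩ | ⟨rfl, h2⟩ | ⟨rfl, h2⟩⟩
    · rw [if_neg (show ¬ m ≤ t by omega), if_neg (show ¬ i ≤ t by omega)]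
      exact ⟨thickVal_zero_zero _ _, thickVal_one _ _ _⟩
    · rw [if_neg (show ¬ m ≤ t by omega), if_pos h1, thickVal_zero_one, if_neg htn]
      simp [thickVal_one, curveMatrix, Matrix.mulVec, dotProduct]
    · rw [if_neg (show ¬ m ≤ t by omega), if_pos h1, thickVal_zero_one, if_neg htn]
      simp [thickVal_one, curveMatrix, Matrix.mulVec, dotProduct]
    · rw [if_pos h1, if_pos (show i ≤ t by omega), thickVal_zero_two]
      simp [thickVal_zero_two, thickVal_one, curveMatrix, Matrix.mulVec, dotProduct]
    · rw [if_pos h1, if_pos (show i ≤ t by omega), thickVal_zero_two, thickVal_zero_one,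
        if_neg (by omega)]
      simp [thickVal_one, curveMatrix, Matrix.mulVec, dotProduct, h2]
    · rw [if_pos h1, if_pos (show i ≤ t by omega), thickVal_zero_two, thickVal_zero_one,
        if_pos h2]
      simp [thickVal_one, curveMatrix, Matrix.mulVec, dotProduct, h2]
  funext c
  fin_cases c
  · exact key.1
  · exact key.2

theorem thickDim_cases {i m : ℕ} (him : i < m) (k : DVertex n) :
    (thickDim n i m k.num = 2 ∧ m ≤ k.num ∧ k.num + 2 ≤ n) ∨
    (thickDim n i m k.num = 1 ∧ i ≤ k.num ∧ (k.num < m ∨ k.num + 1 = n) ∧ k.num ≠ n) ∨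
    (thickDim n i m k.num = 1 ∧ k.num = n) ∨ (thickDim n i m k.num = 0 ∧ k.num < i) := by
  have := k.num_le
  unfold thickDim
  split_ifs <;> omega

theorem endsRep_iso_thickRep {i m : ℕ} (him : i < m) (hm : m + 1 ≤ n) {i' j : ℤ}
    (hd : ∀ k : DVertex n, curveDim n i' j k.num = thickDim n i m k.num) :
    Nonempty (endsRep K n i' j ≅ thickRep K n i m) := by
  refine ⟨isoCoordRep _ (fun k => thickVal K _ (k.num = n)) (fun k => ?_) (fun k w => ?_)
    fun k l a v => thickVal_curveMatrix n i m _ _ _ _ him hm a.down (hd k) (hd l) v⟩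
  · have key : ∀ d, d = 2 ∨ d = 1 ∨ d = 0 → Function.Injective (thickVal K d (k.num = n)) := by
      rintro d (rfl | rfl | rfl) v w h
      · have h0 := congrFun h 0
        have h1 := congrFun h 1
        rw [thickVal_zero_two, thickVal_zero_two] at h0
        rw [thickVal_one, thickVal_one, Fin.sum_univ_two, Fin.sum_univ_two, h0] at h1
        have h2 := add_right_cancel h1
        funext r
        fin_cases r
        · exact h2
        · exact h0
      · have h1 := congrFun h 1
        rw [thickVal_one, thickVal_one, Fin.sum_univ_one, Fin.sum_univ_one] at h1
        funext r
        rw [Subsingleton.elim r 0, h1]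
      · exact Subsingleton.elim _ _
    refine key _ ?_
    rw [hd]
    rcases thickDim_cases him k with h | h | h | h <;> omega
  · have key : ∀ d, d = thickDim n i m k.num →
        (w ∈ thickSpace K i m k ↔ ∃ v : Fin d → K, thickVal K d (k.num = n) v = w) := by
      intro d hdk
      rcases thickDim_cases him k with h | h | h | h
      · obtain rfl : d = 2 := by omega
        -- Inverse of the change of coordinates `(x, y) ↦ (y, x + y)`.
        refine ⟨fun hw => ⟨![w 1 - w 0, w 0], ?_⟩, ?_⟩
        · funext c
          fin_cases c
          · exact thickVal_zero_two _ _
          · refine (thickVal_one _ _ _).trans ?_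
            simp
        · rintro ⟨v, rfl⟩
          refine ⟨?_, ?_, ?_, ?_⟩ <;> intro <;> omega
      · obtain rfl : d = 1 := by omega
        refine ⟨fun hw => ⟨![w 1], ?_⟩, ?_⟩
        · funext c
          fin_cases c
          · refine (thickVal_zero_one _ _).trans ?_
            rw [if_neg h.2.2.2]
            rcases h.2.2.1 with h' | h'
            · exact (hw.1 h').symm
            · exact (hw.2.2.1 h').symm
          · refine (thickVal_one _ _ _).trans ?_
            simp
        · rintro ⟨v, rfl⟩
          have h0 := (thickVal_zero_one (k.num = n) v).trans (if_neg h.2.2.2)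
          exact ⟨fun _ => h0, fun _ => by omega, fun _ => h0, fun h' => (h.2.2.2 h').elim⟩
      · obtain rfl : d = 1 := by omega
        refine ⟨fun hw => ⟨![w 1], ?_⟩, ?_⟩
        · funext c
          fin_cases c
          · refine (thickVal_zero_one _ _).trans ?_
            rw [if_pos h.2]
            exact (hw.2.2.2 h.2).symm
          · refine (thickVal_one _ _ _).trans ?_
            simp
        · rintro ⟨v, rfl⟩
          refine ⟨fun _ => by omega, fun _ => by omega, fun _ => by omega, fun h' => ?_⟩
          rw [thickVal_zero_one, thickVal_one, if_pos h', Fin.sum_univ_one]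
      · obtain rfl : d = 0 := by omega
        refine ⟨fun hw => ⟨0, ?_⟩, ?_⟩
        · rw [map_zero]
          funext c
          fin_cases c
          · exact (hw.1 (by omega)).symm
          · exact (hw.2.1 h.2).symm
        · rintro ⟨v, rfl⟩
          rw [Subsingleton.elim v 0, map_zero]
          exact zero_mem _
    exact key _ (hd k)

end QRep

end

noncomputable section

open DVertex

/-! ### Endomorphisms, presentations and translates of thin representations. -/

namespace QRep

variable {K : Type u} [Field K] {n : ℕ}

/-- The morphism to a representation by subspaces with given coordinates. -/
def coordLift {ι : Type} [Fintype ι] {X : DVertex n → Submodule K (ι → K)}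
    {T : DVertex n → ι → Prop} [∀ k, DecidablePred (T k)]
    (h : ∀ k l (_ : k ⟶ l), ∀ w ∈ X k, cut K (T l) w ∈ X l) {V : QRep K (DVertex n)}
    (f : ∀ k, V.obj k →ₗ[K] (ι → K)) (hX : ∀ k v, f k v ∈ X k)
    (hmap : ∀ k l (a : k ⟶ l) (v : V.obj k), f l (V.map a v) = cut K (T l) (f k v)) :
    V ⟶ coordRep X T h :=
  ⟨fun k => (f k).codRestrict (X k) (hX k),
    fun k l a => LinearMap.ext fun v => Subtype.ext (hmap k l a v)⟩

/-- Transport of a minimal projective presentation along an isomorphism. -/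
def MinProjPres.ofIso {M N : QRep K (DVertex n)} (p : MinProjPres M) (e : M ≅ N) :
    MinProjPres N where
  P₀ := p.P₀
  P₁ := p.P₁
  p₀ := p.p₀ ≫ e.hom
  p₁ := p.p₁ ≫ (kerLift (p.p₀ ≫ e.hom) (kerι p.p₀) (by
    rw [← Category.assoc, kerι_comp, zero_comp]))
  cover₀ := p.cover₀.comp_iso e
  cover₁ := by
    let e' : ker p.p₀ ≅ ker (p.p₀ ≫ e.hom) :=
      { hom := kerLift (p.p₀ ≫ e.hom) (kerι p.p₀) (by
          rw [← Category.assoc, kerι_comp, zero_comp])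
        inv := kerLift p.p₀ (kerι (p.p₀ ≫ e.hom)) (by
          rw [← cancel_mono e.hom, Category.assoc, kerι_comp, zero_comp])
        hom_inv_id := rfl
        inv_hom_id := rfl }
    exact p.cover₁.comp_iso e'

/-- Endomorphisms which act on generators by a scalar. -/
theorem end_eq_smul {ι : Type} [Fintype ι] [DecidableEq ι] {s : ι → DVertex n}
    {V : QRep K (DVertex n)} (p : free K s ⟶ V) (hp : ∀ k, Function.Surjective (p.1 k))
    (θ : V ⟶ V) (c : K)
    (h : ∀ b, θ.1 (s b) (p.1 (s b) (gen K s b)) = c • p.1 (s b) (gen K s b)) : θ = c • 𝟙 V := by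
  have h1 : p ≫ θ = c • p := free_hom_ext h
  refine hom_ext fun k x => ?_
  obtain ⟨w, rfl⟩ := hp k x
  exact congrArg (fun φ : free K s ⟶ V => φ.1 k w) h1

/-! ### Thin representations -/

section Thin

variable (a : DVertex n) (S : DVertex n → Prop) [DecidablePred S]

/-- The projection from an indecomposable projective to a thin representation. -/
def thinCover (K : Type u) [Field K]
    (h : ∀ k l (_ : k ⟶ l), Reach a k → S l → S k) :
    free K (fun _ : Unit => a) ⟶ thinRep K S :=
  coordLift _ (fun k => cut K (fun _ => S k) ∘ₗ freeVal _ k) (fun _ _ hk => if_neg hk)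
    fun k l α v => funext fun c => by
      rw [LinearMap.comp_apply, LinearMap.comp_apply, freeVal_map, cut_apply, cut_apply, cut_apply]
      by_cases hk : Reach a k
      · have := h k l α hk
        by_cases hl : S l
        · rw [if_pos hl, if_pos hl, if_pos (this hl)]
        · rw [if_neg hl, if_neg hl]
      · rw [freeVal_eq_zero hk]
        simp

variable {a S}

theorem thinCover_surjective (h : ∀ k l (_ : k ⟶ l), Reach a k → S l → S k)
    (hS : ∀ k, S k → Reach a k) (k : DVertex n) :
    Function.Surjective ((thinCover a S K h).1 k) := by
  intro (w : thinSpace K S k)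
  refine ⟨freeMk _ k w.1 fun b hb => w.2 fun hk => hb (hS k hk), ?_⟩
  refine Subtype.ext (funext fun c => ?_)
  refine (cut_apply (fun _ => S k) _ c).trans ?_
  split_ifs with hk
  · rfl
  · exact (w.2 hk).symm

theorem thinRep_ne_zero {k : DVertex n} (hk : S k) : ¬ IsZero (thinRep K S) := by
  intro h
  have := eq_zero_of_isZero h (i := k) (⟨fun _ => 1, fun h' => (h' hk).elim⟩ : thinSpace K S k)
  exact one_ne_zero (congrFun (congrArg (fun z : thinSpace K S k => z.1) this) ())

/-- An endomorphism is determined by the image of the generator, which lies in the one-dimensional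
space at `a`; hence it is a scalar. -/
theorem thinRep_indecomposable (h : ∀ k l (_ : k ⟶ l), Reach a k → S l → S k)
    (hS : ∀ k, S k → Reach a k) (ha : S a) : Indecomposable (thinRep K S) := by
  refine indecomposable_of_end (thinRep_ne_zero ha) fun θ => ?_
  let g : thinSpace K S a := (thinCover a S K h).1 a (gen K (fun _ : Unit => a) ())
  have hg : g.1 () = 1 := by
    refine (cut_apply (fun _ => S a) _ ()).trans ?_
    rw [if_pos ha]
    exact Pi.single_eq_same (M := fun _ => K) () 1
  let x : thinSpace K S a := θ.1 a g
  refine ⟨x.1 (), end_eq_smul _ (thinCover_surjective h hS) θ _ fun b => ?_⟩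
  refine Subtype.ext (funext fun c => ?_)
  change x.1 () = x.1 () * g.1 ()
  rw [hg, mul_one]

theorem free_iso_thinRep (hS : ∀ k, S k ↔ Reach a k) :
    Nonempty (free K (fun _ : Unit => a) ≅ thinRep K S) := by
  refine ⟨isoCoordRep _ (fun k => freeVal _ k) (fun k => ?_) (fun k w => ?_) fun k l α v => ?_⟩
  · exact fun v w h => freeVal_ext (congrFun h)
  · refine ⟨fun hw => ⟨freeMk _ k w fun b hb => hw fun h => hb ((hS k).1 h), rfl⟩, ?_⟩
    rintro ⟨v, rfl⟩ hk
    exact freeVal_eq_zero (fun h => hk ((hS k).2 h)) v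
  · funext c
    rw [cut_apply, freeVal_map]
    split_ifs with h
    · rfl
    · exact freeVal_eq_zero (fun h' => h ((hS l).2 (h'.arrow α))) v

/-- The minimal presentation is `0 → P_b → P_a → M → 0`, and the translate is the kernel of `I_b →
I_a`. It is supported at the vertices that reach `b` but not `a`. -/
theorem thinRep_tau {b : DVertex n} (hab : Reach a b) (hne : a ≠ b)
    (hS : ∀ k, S k ↔ Reach a k ∧ ¬ Reach b k) {S' : DVertex n → Prop} [DecidablePred S']
    (hS' : ∀ k, S' k ↔ Reach k b ∧ ¬ Reach k a) :
    ∃ q : MinProjPres (thinRep K S), Nonempty (thinRep K S' ≅ q.tau) := by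
  have h : ∀ k l (_ : k ⟶ l), Reach a k → S l → S k := fun k l α hk hl =>
    (hS k).2 ⟨hk, fun hb => ((hS l).1 hl).2 (hb.arrow α)⟩
  have hD : ∀ (_ _ : Unit), Reach a b ∨ (1 : K) = 0 := fun _ _ => Or.inl hab
  have hmap : ∀ k v, freeVal _ k ((freeMap (fun _ : Unit => b) (fun _ : Unit => a)
      (fun _ _ => (1 : K)) hD).1 k v) () = freeVal _ k v () := by
    intro k v
    rw [freeMap_apply]
    simp
  have hs : ∀ _ : Unit, Function.Injective ((thinCover a S K h).1 a) := by
    intro _ v w hvw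
    refine freeVal_ext fun _ => ?_
    have ha : S a := (hS a).2 ⟨Reach.refl a, fun hba => hne (num_injective (by
      unfold Reach at *; omega))⟩
    have h1 := congrFun (congrArg (fun z : thinSpace K S a => z.1) hvw) ()
    have h2 : ∀ z, ((thinCover a S K h).1 a z : thinSpace K S a).1 () =
      freeVal (fun _ : Unit => a) a z () := fun z => if_pos ha
    exact (h2 v).symm.trans (h1.trans (h2 w))
  have hinj : ∀ k, Function.Injective ((freeMap (fun _ : Unit => b) (fun _ : Unit => a)
      (fun _ _ => (1 : K)) hD).1 k) := by
    intro k v w hvw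
    refine freeVal_ext fun _ => ?_
    exact (hmap k v).symm.trans ((congrArg (fun z => freeVal _ k z ()) hvw).trans (hmap k w))
  have hex : ∀ k w, (thinCover a S K h).1 k w = 0 ↔ ∃ v, (freeMap (fun _ : Unit => b)
      (fun _ : Unit => a) (fun _ _ => (1 : K)) hD).1 k v = w := by
    intro k w
    constructor
    · intro hw
      by_cases hb : Reach b k
      · refine ⟨freeMk _ k (freeVal _ k w) fun _ hb' => (hb' hb).elim,
          freeVal_ext fun _ => hmap k _⟩
      · refine ⟨0, ?_⟩
        rw [map_zero]
        refine freeVal_ext fun _ => ?_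
        rw [map_zero, Pi.zero_apply]
        by_cases ha : Reach a k
        · have hk : S k := (hS k).2 ⟨ha, hb⟩
          have h2 : ((thinCover a S K h).1 k w : thinSpace K S k).1 () =
            freeVal (fun _ : Unit => a) k w () := if_pos hk
          rw [hw] at h2
          exact h2
        · exact (freeVal_eq_zero ha w).symm
    · rintro ⟨v, rfl⟩
      refine Subtype.ext (funext fun _ => ?_)
      refine (cut_apply (fun _ => S k) _ ()).trans ?_
      split_ifs with hk
      · exact (hmap k v).trans (freeVal_eq_zero ((hS k).1 hk).2 v)
      · rfl
  obtain ⟨q, ⟨e⟩⟩ := exists_minProjPres (fun _ : Unit => b) (fun _ : Unit => a)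
    (fun _ _ => (1 : K)) hD (thinCover a S K h)
    (thinCover_surjective h fun k hk => ((hS k).1 hk).1) hs hinj hex
  refine ⟨q, ⟨coordRepIso (fun k w => ?_) (fun k l α w hw => funext fun c => ?_) ≪≫ e⟩⟩
  · constructor
    · refine fun hw => ⟨fun _ hb => hw fun h' => hb ((hS' k).1 h').1, fun _ ha => ?_⟩
      rw [Finset.univ_unique, Finset.sum_singleton, mul_one]
      exact hw fun h' => ((hS' k).1 h').2 ha
    · intro hw hk
      by_cases hb : Reach k b
      · have := hw.2 () (by_contra fun ha => hk ((hS' k).2 ⟨hb, ha⟩))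
        rwa [Finset.univ_unique, Finset.sum_singleton, mul_one] at this
      · exact hw.1 () hb
  · rw [cut_apply, cut_apply]
    by_cases hb : Reach l b
    · rw [if_pos hb]
      split_ifs with hl
      · rfl
      · refine (hw fun hk => hl ((hS' l).2 ⟨hb, fun ha => ((hS' k).1 hk).2 ?_⟩)).symm
        have := α.down
        unfold Reach at *
        omega
    · rw [if_neg hb, if_neg fun hl => hb ((hS' l).1 hl).1]

/-- Here the thin representation is `P_a`, and `ν P_a` is the injective `I_a`. -/
theorem thinRep_nakayama (hS : ∀ k, S k ↔ Reach a k) {S' : DVertex n → Prop} [DecidablePred S']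
    (hS' : ∀ k, S' k ↔ Reach k a) : Nonempty (thinRep K S' ≅ nakayama (thinRep K S)) := by
  obtain ⟨e⟩ := free_iso_thinRep (K := K) hS
  obtain ⟨e'⟩ := nonempty_nakayama_iso e
  obtain ⟨e''⟩ := nonempty_nakayama_free_iso (K := K) (fun _ : Unit => a)
  refine ⟨coordRepIso (fun k w => ?_) (fun k l α w _ => funext fun c => ?_) ≪≫ e'' ≪≫ e'⟩
  · exact ⟨fun hw => ⟨fun _ hk => hw fun h => hk ((hS' k).1 h), fun b => b.elim⟩,
      fun hw hk => hw.1 () fun h => hk ((hS' k).2 h)⟩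
  · rw [cut_apply, cut_apply]
    exact if_congr (hS' l) rfl rfl

theorem projective_thinRep (hS : ∀ k, S k ↔ Reach a k) : Projective (thinRep K S) := by
  obtain ⟨e⟩ := free_iso_thinRep (K := K) hS
  exact Projective.of_iso e (projective_free _)

/-- `P_a` covers itself by the identity, with `P₁` free on no generators. -/
theorem nonempty_minProjPres_thinRep (hS : ∀ k, S k ↔ Reach a k) :
    Nonempty (MinProjPres (thinRep K S)) := by
  obtain ⟨e⟩ := free_iso_thinRep (K := K) hS
  have hz : ∀ k (v : (free K fun b : Empty => (b.elim : DVertex n)).obj k), v = 0 :=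
    fun k v => freeVal_ext fun b => b.elim
  obtain ⟨q, -⟩ := exists_minProjPres (fun b : Empty => b.elim) (fun _ : Unit => a)
    (fun b _ => b.elim) (fun b _ => b.elim) (𝟙 (free K (fun _ : Unit => a)))
    (fun k w => ⟨w, rfl⟩) (fun _ _ _ h => h) (fun k v w _ => (hz k v).trans (hz k w).symm)
    fun k w => ⟨fun hw => ⟨0, (map_zero _).trans hw.symm⟩, fun ⟨v, hv⟩ => by
      rw [← hv, hz k v, map_zero, map_zero]⟩
  exact ⟨q.ofIso e⟩

end Thin

end QRep

end

noncomputable section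

open DVertex

/-! ### Endomorphisms, presentations and translates of thick representations. -/

namespace QRep

variable {K : Type u} [Field K] {n : ℕ}

/-! ### Thick representations -/

section Thick

/-- The coordinates `y` and `x + y` of a pair `x, y`. -/
def shear (K : Type u) [Field K] : (Fin 2 → K) →ₗ[K] (Fin 2 → K) :=
  LinearMap.pi ![LinearMap.proj (R := K) (φ := fun _ => K) 1,
    LinearMap.proj (R := K) (φ := fun _ => K) 0 + LinearMap.proj 1]

theorem shear_zero (v : Fin 2 → K) : shear K v 0 = v 1 := rfl

theorem shear_one (v : Fin 2 → K) : shear K v 1 = v 0 + v 1 := rfl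

theorem freeVal_zero_eq_zero {v₁ v₂ : DVertex n} (h₁ : v₁.num + 1 = n) {k : DVertex n}
    (hk : k.num = n) (u : (free K ![v₁, v₂]).obj k) : freeVal _ k u 0 = 0 :=
  freeVal_eq_zero (b := 0) (fun h : Reach v₁ k => by unfold Reach at h; omega) u

theorem freeVal_one_eq_zero {v₁ v₂ : DVertex n} (h₂ : v₂.num = n) {k : DVertex n}
    (hk : k.num + 1 = n) (u : (free K ![v₁, v₂]).obj k) : freeVal _ k u 1 = 0 :=
  freeVal_eq_zero (b := 1) (fun h : Reach v₂ k => by unfold Reach at h; omega) u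

theorem thickSpace_ext {i m : ℕ} {k : DVertex n} {v w : (thickRep K n i m).obj k}
    (h0 : (v : thickSpace K i m k).1 0 = (w : thickSpace K i m k).1 0)
    (h1 : (v : thickSpace K i m k).1 1 = (w : thickSpace K i m k).1 1) : v = w :=
  Subtype.ext (funext (Fin.forall_fin_two.2 ⟨h0, h1⟩))

variable {v₁ v₂ : DVertex n} (h₁ : v₁.num + 1 = n) (h₂ : v₂.num = n) {i m : ℕ}
  (hi : 1 ≤ i) (him : i < m) (hm : m + 1 ≤ n)

include h₁ h₂ him hm

/-- The projection from the sum of the projectives at `n - 1` and `n` to a thick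
representation. -/
def thickCover (K : Type u) [Field K] : free K ![v₁, v₂] ⟶ thickRep K n i m :=
  coordLift _ (fun k => cut K (fun c => ![m, i] c ≤ k.num) ∘ₗ shear K ∘ₗ freeVal _ k)
    (fun k u => by
      refine ⟨fun h => if_neg (not_le.2 h), fun h => if_neg (not_le.2 h), fun h => ?_,
        fun h => ?_⟩
      · refine (if_pos (show m ≤ k.num by omega)).trans ?_
        exact freeVal_one_eq_zero h₂ h u
      · refine (if_pos (show m ≤ k.num by omega)).trans
          (Eq.trans ?_ (if_pos (show i ≤ k.num by omega)).symm)
        change shear K (freeVal _ k u) 0 = shear K (freeVal _ k u) 1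
        rw [shear_zero, shear_one, freeVal_zero_eq_zero h₁ h, zero_add])
    fun k l a u => funext fun c => by
      have := a.down
      rw [LinearMap.comp_apply, LinearMap.comp_apply, cut_apply, cut_apply, LinearMap.comp_apply,
        LinearMap.comp_apply, cut_apply, freeVal_map]
      split_ifs with h3 h4
      · rfl
      · omega
      · rfl

theorem thickCover_zero (k : DVertex n) (u : (free K ![v₁, v₂]).obj k) :
    ((thickCover h₁ h₂ him hm K).1 k u : thickSpace K i m k).1 0 =
      if m ≤ k.num then freeVal _ k u 1 else 0 := rfl

theorem thickCover_one (k : DVertex n) (u : (free K ![v₁, v₂]).obj k) :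
    ((thickCover h₁ h₂ him hm K).1 k u : thickSpace K i m k).1 1 =
      if i ≤ k.num then freeVal _ k u 0 + freeVal _ k u 1 else 0 := rfl

theorem thickCover_surjective (k : DVertex n) :
    Function.Surjective ((thickCover h₁ h₂ him hm K).1 k) := by
  intro (w : thickSpace K i m k)
  have hk := k.num_le
  refine ⟨freeMk _ k ![w.1 1 - w.1 0, w.1 0] (Fin.forall_fin_two.2
    ⟨fun (h : ¬ Reach v₁ k) => ?_, fun (h : ¬ Reach v₂ k) => ?_⟩),
    thickSpace_ext ?_ ?_⟩
  · change w.1 1 - w.1 0 = 0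
    rw [w.2.2.2.2 (by unfold Reach at h; omega), sub_self]
  · exact w.2.2.2.1 (by unfold Reach at h; omega)
  · rw [thickCover_zero]
    split_ifs with h
    · rfl
    · exact (w.2.1 (not_le.1 h)).symm
  · rw [thickCover_one]
    split_ifs with h
    · exact sub_add_cancel (w.1 1) (w.1 0)
    · exact (w.2.2.1 (not_le.1 h)).symm

theorem thickCover_injective (b : Fin 2) :
    Function.Injective ((thickCover h₁ h₂ him hm K).1 (![v₁, v₂] b)) := by
  revert b
  refine Fin.forall_fin_two.2 ⟨?_, ?_⟩
  · intro (v : (free K ![v₁, v₂]).obj v₁) (w : (free K ![v₁, v₂]).obj v₁) hvw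
    have h1 := congrArg (fun z : thickSpace K i m v₁ => z.1 1) hvw
    have h2 := (thickCover_one h₁ h₂ him hm v₁ v).symm.trans
      (h1.trans (thickCover_one h₁ h₂ him hm v₁ w))
    rw [if_pos (by omega), if_pos (by omega), freeVal_one_eq_zero h₂ h₁,
      freeVal_one_eq_zero h₂ h₁, add_zero, add_zero] at h2
    refine freeVal_ext (Fin.forall_fin_two.2 ⟨h2, ?_⟩)
    exact (freeVal_one_eq_zero h₂ h₁ v).trans
      (freeVal_one_eq_zero h₂ h₁ w).symm
  · intro (v : (free K ![v₁, v₂]).obj v₂) (w : (free K ![v₁, v₂]).obj v₂) hvw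
    have h1 := congrArg (fun z : thickSpace K i m v₂ => z.1 1) hvw
    have h2 := (thickCover_one h₁ h₂ him hm v₂ v).symm.trans
      (h1.trans (thickCover_one h₁ h₂ him hm v₂ w))
    rw [if_pos (by omega), if_pos (by omega), freeVal_zero_eq_zero h₁ h₂,
      freeVal_zero_eq_zero h₁ h₂, zero_add, zero_add] at h2
    refine freeVal_ext (Fin.forall_fin_two.2 ⟨?_, h2⟩)
    exact (freeVal_zero_eq_zero h₁ h₂ v).trans
      (freeVal_zero_eq_zero h₁ h₂ w).symm

/-- These are the relations: both coordinates die below `m` except for their sum, which survives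
down to `i`. -/
theorem thickCover_eq_zero_iff (k : DVertex n) (u : (free K ![v₁, v₂]).obj k) :
    (thickCover h₁ h₂ him hm K).1 k u = 0 ↔
      (m ≤ k.num → freeVal _ k u 0 = 0 ∧ freeVal _ k u 1 = 0) ∧
      (i ≤ k.num → freeVal _ k u 0 + freeVal _ k u 1 = 0) := by
  constructor
  · intro h
    have h0 := (thickCover_zero h₁ h₂ him hm k u).symm.trans
      (congrArg (fun z : thickSpace K i m k => z.1 0) h)
    have h1 := (thickCover_one h₁ h₂ him hm k u).symm.trans
      (congrArg (fun z : thickSpace K i m k => z.1 1) h)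
    refine ⟨fun hk => ?_, fun hk => ?_⟩
    · rw [if_pos hk] at h0
      rw [if_pos (by omega)] at h1
      change freeVal _ k u 1 = 0 at h0
      change freeVal _ k u 0 + freeVal _ k u 1 = 0 at h1
      rw [h0, add_zero] at h1
      exact ⟨h1, h0⟩
    · rw [if_pos hk] at h1
      exact h1
  · rintro ⟨h0, h1⟩
    refine thickSpace_ext ?_ ?_
    · rw [thickCover_zero]
      split_ifs with h
      · exact (h0 h).2
      · rfl
    · rw [thickCover_one]
      split_ifs with h
      · exact h1 h
      · rfl

theorem thickRep_ne_zero : ¬ IsZero (thickRep K n i m) := by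
  intro h
  have := eq_zero_of_isZero h (i := v₁) (⟨![0, 1], fun _ => rfl, fun _ => by omega, fun _ => rfl,
    fun _ => by omega⟩ : thickSpace K i m v₁)
  exact one_ne_zero (congrArg (fun z : thickSpace K i m v₁ => z.1 1) this)

-- The spaces at `n - 1` and `n` are lines, so an endomorphism multiplies each of the two generators
-- by a scalar. The generators have the same nonzero image at `m - 1`, so the scalars agree.
include hi in
theorem thickRep_indecomposable : Indecomposable (thickRep K n i m) := by
  refine indecomposable_of_end (thickRep_ne_zero h₁ h₂ him hm) fun θ => ?_
  let p := thickCover h₁ h₂ him hm K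
  let g₁ : thickSpace K i m v₁ := p.1 v₁ (gen K ![v₁, v₂] 0)
  let g₂ : thickSpace K i m v₂ := p.1 v₂ (gen K ![v₁, v₂] 1)
  have hg₁0 : g₁.1 0 = 0 := g₁.2.2.2.1 h₁
  have hg₁1 : g₁.1 1 = 1 := by
    refine (thickCover_one h₁ h₂ him hm v₁ _).trans ?_
    rw [if_pos (by omega)]
    exact (congrArg₂ (· + ·) (congrFun (freeVal_gen (K := K) ![v₁, v₂] 0) 0)
      (congrFun (freeVal_gen (K := K) ![v₁, v₂] 0) 1)).trans (by simp)
  have hg₂1 : g₂.1 1 = 1 := by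
    refine (thickCover_one h₁ h₂ him hm v₂ _).trans ?_
    rw [if_pos (by omega)]
    exact (congrArg₂ (· + ·) (congrFun (freeVal_gen (K := K) ![v₁, v₂] 1) 0)
      (congrFun (freeVal_gen (K := K) ![v₁, v₂] 1) 1)).trans (by simp)
  have hg₂0 : g₂.1 0 = 1 := (g₂.2.2.2.2 h₂).trans hg₂1
  let x : thickSpace K i m v₁ := θ.1 v₁ g₁
  let y : thickSpace K i m v₂ := θ.1 v₂ g₂
  have hx : θ.1 v₁ g₁ = (x.1 1 • g₁ : thickSpace K i m v₁) := by
    refine thickSpace_ext ?_ ?_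
    · change x.1 0 = x.1 1 * g₁.1 0
      rw [hg₁0, mul_zero, x.2.2.2.1 h₁]
    · change x.1 1 = x.1 1 * g₁.1 1
      rw [hg₁1, mul_one]
  have hy : θ.1 v₂ g₂ = (y.1 1 • g₂ : thickSpace K i m v₂) := by
    refine thickSpace_ext ?_ ?_
    · change y.1 0 = y.1 1 * g₂.1 0
      rw [hg₂0, mul_one, y.2.2.2.2 h₂]
    · change y.1 1 = y.1 1 * g₂.1 1
      rw [hg₂1, mul_one]
  have hxy : x.1 1 = y.1 1 := by
    -- As `i ≤ m - 1 < m`, at this vertex only coordinate `1` is left, and both generators map to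
    -- `(0, 1)`.
    let k : DVertex n := ofNum (m - 1) (by omega) (by omega)
    have hk : k.num = m - 1 := rfl
    have hr₁ : Reach v₁ k := Or.inr (by omega)
    have hr₂ : Reach v₂ k := Or.inr (by omega)
    let z₁ := (thickRep K n i m).trans v₁ k g₁
    let z₂ := (thickRep K n i m).trans v₂ k g₂
    have hz₁ : (z₁ : thickSpace K i m k).1 0 = 0 ∧ (z₁ : thickSpace K i m k).1 1 = 1 := by
      refine ⟨(z₁ : thickSpace K i m k).2.1 (by omega), ?_⟩
      have : z₁ = p.1 k ((free K ![v₁, v₂]).trans v₁ k (gen K ![v₁, v₂] 0)) :=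
        (hom_trans p v₁ k _).symm
      rw [this]
      refine (thickCover_one h₁ h₂ him hm k _).trans ?_
      rw [if_pos (by omega)]
      have hv := freeVal_trans (K := K) ![v₁, v₂] (k := ![v₁, v₂] 0) hr₁ (gen K ![v₁, v₂] 0)
      refine (congrArg₂ (· + ·) (congrFun hv 0) (congrFun hv 1)).trans ?_
      exact (congrArg₂ (· + ·) (congrFun (freeVal_gen (K := K) ![v₁, v₂] 0) 0)
        (congrFun (freeVal_gen (K := K) ![v₁, v₂] 0) 1)).trans (by simp)
    have hz₂ : (z₂ : thickSpace K i m k).1 0 = 0 ∧ (z₂ : thickSpace K i m k).1 1 = 1 := by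
      refine ⟨(z₂ : thickSpace K i m k).2.1 (by omega), ?_⟩
      have : z₂ = p.1 k ((free K ![v₁, v₂]).trans v₂ k (gen K ![v₁, v₂] 1)) :=
        (hom_trans p v₂ k _).symm
      rw [this]
      refine (thickCover_one h₁ h₂ him hm k _).trans ?_
      rw [if_pos (by omega)]
      have hv := freeVal_trans (K := K) ![v₁, v₂] (k := ![v₁, v₂] 1) hr₂ (gen K ![v₁, v₂] 1)
      refine (congrArg₂ (· + ·) (congrFun hv 0) (congrFun hv 1)).trans ?_
      exact (congrArg₂ (· + ·) (congrFun (freeVal_gen (K := K) ![v₁, v₂] 1) 0)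
        (congrFun (freeVal_gen (K := K) ![v₁, v₂] 1) 1)).trans (by simp)
    have hz : z₁ = z₂ := thickSpace_ext (hz₁.1.trans hz₂.1.symm)
      (hz₁.2.trans hz₂.2.symm)
    have e₁ : θ.1 k z₁ = x.1 1 • z₁ := by
      refine (hom_trans θ v₁ k g₁).trans ?_
      rw [hx]
      exact map_smul ((thickRep K n i m).trans v₁ k) (x.1 1) g₁
    have e₂ : θ.1 k z₂ = y.1 1 • z₂ := by
      refine (hom_trans θ v₂ k g₂).trans ?_
      rw [hy]
      exact map_smul ((thickRep K n i m).trans v₂ k) (y.1 1) g₂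
    have e₃ : x.1 1 • z₁ = y.1 1 • z₁ := by rw [← e₁, hz, e₂]
    have e₄ : x.1 1 * (z₁ : thickSpace K i m k).1 1 = y.1 1 * (z₁ : thickSpace K i m k).1 1 :=
      congrArg (fun z : thickSpace K i m k => z.1 1) e₃
    rwa [hz₁.2, mul_one, mul_one] at e₄
  exact ⟨x.1 1, end_eq_smul p (thickCover_surjective h₁ h₂ him hm) θ _
    (Fin.forall_fin_two.2 ⟨hx, hxy ▸ hy⟩)⟩

/-- The kernel of the cover is `P_{m-1} ⊕ P_{i-1}`. Dually, `w 0` lives on the vertices `≥ m - 1`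
and `w 1` on those `≥ i - 1`, with the equations `w 0 = 0` at `n - 1` and `w 1 = w 0` at `n`. These
are literally the conditions of `thickSpace` for `i - 1` and `m - 1`. -/
theorem thickRep_tau (hi' : 2 ≤ i) : ∃ q : MinProjPres (thickRep K n i m),
    Nonempty (thickRep K n (i - 1) (m - 1) ≅ q.tau) := by
  let t₀ : DVertex n := ofNum (m - 1) (by omega) (by omega)
  let t₁ : DVertex n := ofNum (i - 1) (by omega) (by omega)
  have ht₀ : t₀.num = m - 1 := rfl
  have ht₁ : t₁.num = i - 1 := rfl
  -- The rows are the relations: `e₁ - e₂` at `m - 1` and `e₂` at `i - 1`.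
  let D : Fin 2 → Fin 2 → K := ![![1, -1], ![0, 1]]
  have hD : ∀ c b, Reach (![v₁, v₂] b) (![t₀, t₁] c) ∨ D c b = 0 := by
    refine Fin.forall_fin_two.2 ⟨Fin.forall_fin_two.2 ⟨Or.inl ?_, Or.inl ?_⟩,
      Fin.forall_fin_two.2 ⟨Or.inr rfl, Or.inl ?_⟩⟩
    · exact Or.inr (show t₀.num < v₁.num ∧ t₀.num + 2 ≤ n by omega)
    · exact Or.inr (show t₀.num < v₂.num ∧ t₀.num + 2 ≤ n by omega)
    · exact Or.inr (show t₁.num < v₂.num ∧ t₁.num + 2 ≤ n by omega)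
  have hmap0 : ∀ k v, freeVal _ k ((freeMap ![t₀, t₁] ![v₁, v₂] D hD).1 k v) 0 =
      freeVal _ k v 0 := by
    intro k v
    rw [freeMap_apply]
    simp [D]
  have hmap1 : ∀ k v, freeVal _ k ((freeMap ![t₀, t₁] ![v₁, v₂] D hD).1 k v) 1 =
      -freeVal _ k v 0 + freeVal _ k v 1 := by
    intro k v
    rw [freeMap_apply]
    simp [D]
  have hinj : ∀ k, Function.Injective ((freeMap ![t₀, t₁] ![v₁, v₂] D hD).1 k) := by
    intro k v w hvw
    have e0 := (hmap0 k v).symm.trans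
      ((congrArg (fun z => freeVal _ k z 0) hvw).trans (hmap0 k w))
    have e1 := (hmap1 k v).symm.trans
      ((congrArg (fun z => freeVal _ k z 1) hvw).trans (hmap1 k w))
    rw [e0] at e1
    exact freeVal_ext (Fin.forall_fin_two.2 ⟨e0, add_left_cancel e1⟩)
  have hex : ∀ k w, (thickCover h₁ h₂ him hm K).1 k w = 0 ↔
      ∃ v, (freeMap ![t₀, t₁] ![v₁, v₂] D hD).1 k v = w := by
    intro k w
    rw [thickCover_eq_zero_iff]
    constructor
    · rintro ⟨e0, e1⟩
      refine ⟨freeMk _ k ![freeVal _ k w 0, freeVal _ k w 0 + freeVal _ k w 1]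
        (Fin.forall_fin_two.2 ⟨fun (h : ¬ Reach t₀ k) => ?_, fun (h : ¬ Reach t₁ k) => ?_⟩),
        freeVal_ext (Fin.forall_fin_two.2 ⟨hmap0 k _, (hmap1 k _).trans ?_⟩)⟩
      · exact (e0 (by unfold Reach at h; omega)).1
      · exact e1 (by unfold Reach at h; omega)
      · exact neg_add_cancel_left _ _
    · rintro ⟨v, rfl⟩
      rw [hmap0, hmap1]
      refine ⟨fun hk => ?_, fun hk => ?_⟩
      · have e0 : freeVal _ k v 0 = 0 := freeVal_eq_zero (b := 0)
          (fun h : Reach t₀ k => by unfold Reach at h; omega) v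
        have e1 : freeVal _ k v 1 = 0 := freeVal_eq_zero (b := 1)
          (fun h : Reach t₁ k => by unfold Reach at h; omega) v
        rw [e0, e1]
        simp
      · have e1 : freeVal _ k v 1 = 0 := freeVal_eq_zero (b := 1)
          (fun h : Reach t₁ k => by unfold Reach at h; omega) v
        rw [e1]
        simp
  obtain ⟨q, ⟨e⟩⟩ := exists_minProjPres ![t₀, t₁] ![v₁, v₂] D hD (thickCover h₁ h₂ him hm K)
    (thickCover_surjective h₁ h₂ him hm) (thickCover_injective h₁ h₂ him hm) hinj hex
  have hr₀ : ∀ k, Reach k t₀ ↔ m - 1 ≤ k.num := fun k => by unfold Reach; omega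
  have hr₁ : ∀ k, Reach k t₁ ↔ i - 1 ≤ k.num := fun k => by unfold Reach; omega
  refine ⟨q, ⟨coordRepIso (fun k w => ?_) (fun k l α w _ => funext fun c => ?_) ≪≫ e⟩⟩
  · have hv₁ : Reach k v₁ ↔ k.num + 1 = n := by unfold Reach; omega
    have hk := k.num_le
    have hv₂ : Reach k v₂ ↔ k.num = n := by unfold Reach; omega
    change _ ↔ (∀ c, ¬ Reach k (![t₀, t₁] c) → w c = 0) ∧
      ∀ b, Reach k (![v₁, v₂] b) → ∑ c, w c * D c b = 0
    rw [Fin.forall_fin_two, Fin.forall_fin_two, Fin.sum_univ_two, Fin.sum_univ_two]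
    change _ ↔ ((¬ Reach k t₀ → _) ∧ (¬ Reach k t₁ → _)) ∧ (Reach k v₁ → _) ∧ (Reach k v₂ → _)
    rw [hr₀, hr₁, hv₁, hv₂, not_le, not_le, and_assoc]
    refine and_congr Iff.rfl (and_congr Iff.rfl (and_congr ?_ ?_))
    · simp [D]
    · have e1 : w 0 * D 0 1 + w 1 * D 1 1 = w 1 - w 0 := by simp [D, sub_eq_neg_add]
      rw [e1, sub_eq_zero, eq_comm (a := w 1)]
  · rw [cut_apply, cut_apply]
    refine if_congr ?_ rfl rfl
    revert c
    exact Fin.forall_fin_two.2 ⟨(hr₀ l).symm, (hr₁ l).symm⟩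

/-- There is no vertex `i - 1 = 0`, so `e₁ - e₂` at `m - 1` is the only relation. The translate is
the kernel of `I_{m-1} → I_{n-1} ⊕ I_n`, in which the vertices `n - 1` and `n` drop out. -/
theorem thickRep_tau_of_eq_one (hi' : i = 1) {S : DVertex n → Prop} [DecidablePred S]
    (hS : ∀ k, S k ↔ m - 1 ≤ k.num ∧ k.num + 2 ≤ n) : ∃ q : MinProjPres (thickRep K n i m),
    Nonempty (thinRep K S ≅ q.tau) := by
  let t₀ : DVertex n := ofNum (m - 1) (by omega) (by omega)
  have ht₀ : t₀.num = m - 1 := rfl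
  let D : Unit → Fin 2 → K := fun _ => ![1, -1]
  have hD : ∀ c b, Reach (![v₁, v₂] b) ((fun _ : Unit => t₀) c) ∨ D c b = 0 := by
    refine fun _ => Fin.forall_fin_two.2 ⟨Or.inl ?_, Or.inl ?_⟩
    · exact Or.inr (show t₀.num < v₁.num ∧ t₀.num + 2 ≤ n by omega)
    · exact Or.inr (show t₀.num < v₂.num ∧ t₀.num + 2 ≤ n by omega)
  have hmap0 : ∀ k v, freeVal _ k ((freeMap (fun _ : Unit => t₀) ![v₁, v₂] D hD).1 k v) 0 =
      freeVal _ k v () := by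
    intro k v
    rw [freeMap_apply]
    simp [D]
  have hmap1 : ∀ k v, freeVal _ k ((freeMap (fun _ : Unit => t₀) ![v₁, v₂] D hD).1 k v) 1 =
      -freeVal _ k v () := by
    intro k v
    rw [freeMap_apply]
    simp [D]
  have hinj : ∀ k, Function.Injective ((freeMap (fun _ : Unit => t₀) ![v₁, v₂] D hD).1 k) := by
    intro k v w hvw
    exact freeVal_ext fun _ => (hmap0 k v).symm.trans
      ((congrArg (fun z => freeVal _ k z 0) hvw).trans (hmap0 k w))
  have hex : ∀ k w, (thickCover h₁ h₂ him hm K).1 k w = 0 ↔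
      ∃ v, (freeMap (fun _ : Unit => t₀) ![v₁, v₂] D hD).1 k v = w := by
    intro k w
    have hk := k.num_pos
    rw [thickCover_eq_zero_iff]
    constructor
    · rintro ⟨e0, e1⟩
      refine ⟨freeMk _ k (fun _ => freeVal _ k w 0) (fun _ (h : ¬ Reach t₀ k) => ?_),
        freeVal_ext (Fin.forall_fin_two.2 ⟨hmap0 k _, (hmap1 k _).trans ?_⟩)⟩
      · exact (e0 (by unfold Reach at h; omega)).1
      · exact neg_eq_of_add_eq_zero_right (e1 (by omega))
    · rintro ⟨v, rfl⟩
      rw [hmap0, hmap1]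
      refine ⟨fun hk => ?_, fun hk => add_neg_cancel _⟩
      have e0 : freeVal _ k v () = 0 := freeVal_eq_zero (b := ())
        (fun h : Reach t₀ k => by unfold Reach at h; omega) v
      rw [e0]
      simp
  obtain ⟨q, ⟨e⟩⟩ := exists_minProjPres (fun _ : Unit => t₀) ![v₁, v₂] D hD
    (thickCover h₁ h₂ him hm K) (thickCover_surjective h₁ h₂ him hm)
    (thickCover_injective h₁ h₂ him hm) hinj hex
  have hr₀ : ∀ k, Reach k t₀ ↔ m - 1 ≤ k.num := fun k => by unfold Reach; omega
  refine ⟨q, ⟨coordRepIso (fun k w => ?_) (fun k l α w _ => funext fun c => ?_) ≪≫ e⟩⟩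
  · have hv₁ : Reach k v₁ ↔ k.num + 1 = n := by unfold Reach; omega
    have hk := k.num_le
    have hv₂ : Reach k v₂ ↔ k.num = n := by unfold Reach; omega
    change (¬ S k → w () = 0) ↔ (∀ c, ¬ Reach k t₀ → w c = 0) ∧
      ∀ b, Reach k (![v₁, v₂] b) → ∑ c, w c * D c b = 0
    rw [Fin.forall_fin_two]
    change _ ↔ _ ∧ (Reach k v₁ → _) ∧ (Reach k v₂ → _)
    rw [hr₀, hv₁, hv₂, hS]
    have e0 : ∑ c, w c * D c 0 = w () := by simp [D]
    have e1 : ∑ c, w c * D c 1 = -w () := by simp [D]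
    rw [e0, e1, neg_eq_zero]
    constructor
    · exact fun h => ⟨fun _ h' => h (by omega), fun h' => h (by omega), fun h' => h (by omega)⟩
    · rintro ⟨h, h', h''⟩ hk'
      by_cases h3 : m - 1 ≤ k.num
      · rcases (show k.num + 1 = n ∨ k.num = n by omega) with h4 | h4
        · exact h' h4
        · exact h'' h4
      · exact h () h3
  · have := α.down
    rw [cut_apply, cut_apply]
    refine if_congr ?_ rfl rfl
    rw [hr₀, hS]
    omega

end Thick

end QRep

end

noncomputable section

open DVertex

/-! ### Splitting thin and thick summands off an arbitrary representation. -/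

namespace QRep

variable {K : Type u} [Field K] {n : ℕ}

/-- `V` is a retract of `M`. -/
def IsRetract (V M : QRep K (DVertex n)) : Prop := ∃ (f : V ⟶ M) (g : M ⟶ V), f ≫ g = 𝟙 V

/-- The transports of `x` embed the thin representation, because `x` dies beyond `b`. Transport to
`b` followed by `φ` is a retraction, because `φ` kills whatever enters from outside the support. -/
theorem thinRep_isRetract (M : QRep K (DVertex n)) {a b : DVertex n} {S : DVertex n → Prop}
    [DecidablePred S] (hS : ∀ k, S k ↔ Reach a k ∧ Reach k b) (x : M.obj a)
    (φ : M.obj b →ₗ[K] K) (h1 : φ (M.trans a b x) = 1)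
    (hx : ∀ l, Reach a l → ¬ Reach l b → M.trans a l x = 0)
    (hφ : ∀ k y, Reach k b → ¬ Reach a k → φ (M.trans k b y) = 0) :
    IsRetract (thinRep K S) M := by
  let f : thinRep K S ⟶ M := ⟨fun k => LinearMap.toSpanSingleton K _ (M.trans a k x) ∘ₗ
      LinearMap.proj () ∘ₗ (thinSpace K S k).subtype, fun k l α => LinearMap.ext fun w => by
    let w' : thinSpace K S k := w
    change (if S l then w'.1 () else 0) • M.trans a l x = M.map α (w'.1 () • M.trans a k x)
    rw [map_smul]
    by_cases hk : S k
    · rw [map_trans M ((hS k).1 hk).1]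
      split_ifs with hl
      · rfl
      · have ha := ((hS k).1 hk).1.arrow α
        rw [hx l ha fun hb => hl ((hS l).2 ⟨ha, hb⟩), smul_zero, smul_zero]
    · rw [w'.2 hk, ite_self, zero_smul, zero_smul]⟩
  let g : M ⟶ thinRep K S := coordLift _
    (fun k => LinearMap.pi fun _ => if S k then φ ∘ₗ M.trans k b else 0)
    (fun k v hk => by
      rw [LinearMap.pi_apply, if_neg hk]
      rfl)
    fun k l α v => funext fun c => by
      rw [cut_apply, LinearMap.pi_apply, LinearMap.pi_apply]
      by_cases hl : S l
      · rw [if_pos hl, if_pos hl, LinearMap.comp_apply, trans_map M α ((hS l).1 hl).2]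
        split_ifs with hk
        · rfl
        · have hb : Reach k b := by
            have h2 := ((hS l).1 hl).2
            have h3 := α.down
            have h4 := b.num_le
            unfold Reach at *
            omega
          exact hφ k v hb fun ha => hk ((hS k).2 ⟨ha, hb⟩)
      · rw [if_neg hl, if_neg hl]
        rfl
  refine ⟨f, g, hom_ext fun k w => Subtype.ext (funext fun c => ?_)⟩
  let w' : thinSpace K S k := w
  change (LinearMap.pi (fun _ => if S k then φ ∘ₗ M.trans k b else 0) : _ →ₗ[K] (Unit → K))
    (w'.1 () • M.trans a k x) c = w'.1 ()
  rw [LinearMap.pi_apply]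
  by_cases hk : S k
  · rw [if_pos hk, map_smul, LinearMap.comp_apply,
      trans_trans M ((hS k).1 hk).1 ((hS k).1 hk).2, h1, smul_eq_mul, mul_one]
  · rw [if_neg hk, w'.2 hk]
    rfl

/-- The generators of the thick representation go to `x` and `y`, which agree below `m` and die
below `i`. In the retraction, `χ` after transport to `b` gives the coordinate `x + y`, and `β` gives
the coordinate `y`: it vanishes on what comes from `n - 1` and agrees with `χ` on what comes from
`n`. -/
theorem thickRep_isRetract (M : QRep K (DVertex n)) {v₁ v₂ b : DVertex n}
    (h₁ : v₁.num + 1 = n) (h₂ : v₂.num = n) {i m : ℕ} (him : i < m) (hm : m + 1 ≤ n)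
    (hb : b.num = i) (x : M.obj v₁) (y : M.obj v₂)
    (χ : M.obj b →ₗ[K] K) (β : ∀ k, M.obj k →ₗ[K] K)
    (hχ : χ (M.trans v₁ b x) = 1)
    (hxy : ∀ k : DVertex n, k.num < m → M.trans v₁ k x = M.trans v₂ k y)
    (hx : ∀ k : DVertex n, k.num < i → M.trans v₁ k x = 0)
    (hβ : ∀ k l (a : k ⟶ l) (z : M.obj k), m ≤ l.num → β l (M.map a z) = β k z)
    (hβ₁ : β v₁ = 0) (hβ₂ : β v₂ = χ ∘ₗ M.trans v₂ b) :
    IsRetract (thickRep K n i m) M := by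
  have hβt : ∀ u k (z : M.obj u), Reach u k → m ≤ k.num → β k (M.trans u k z) = β u z := by
    intro u k z h
    obtain ⟨p⟩ := h.nonempty_path
    induction p with
    | nil => intro _; rw [trans_self]
    | cons p a ih =>
      intro hk
      have hp := reach_of_path p
      have := a.down
      rw [← map_trans M hp a, hβ _ _ _ _ hk, ih hp (by omega)]
  have hr₁ : ∀ k : DVertex n, k.num ≠ n → Reach v₁ k := fun k hk => by
    have := k.num_le
    unfold Reach
    omega
  have hr₂ : ∀ k : DVertex n, k.num + 1 ≠ n → Reach v₂ k := fun k hk => by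
    have := k.num_le
    unfold Reach
    omega
  -- The coefficients of the two generators are `w 1 - w 0` and `w 0`. They vanish at `n` and at `n
  -- - 1` respectively, where the corresponding transport is not available.
  let f : thickRep K n i m ⟶ M := ⟨fun k =>
      (LinearMap.toSpanSingleton K _ (M.trans v₁ k x) ∘ₗ
          (LinearMap.proj (R := K) (φ := fun _ => K) (1 : Fin 2) - LinearMap.proj 0) +
        LinearMap.toSpanSingleton K _ (M.trans v₂ k y) ∘ₗ LinearMap.proj 0) ∘ₗ
      (thickSpace K i m k).subtype, fun k l α => LinearMap.ext fun w => by
    let w' : thickSpace K i m k := w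
    have hα := α.down
    change ((if i ≤ l.num then w'.1 1 else 0) - (if m ≤ l.num then w'.1 0 else 0)) •
        M.trans v₁ l x + (if m ≤ l.num then w'.1 0 else 0) • M.trans v₂ l y =
      M.map α ((w'.1 1 - w'.1 0) • M.trans v₁ k x + w'.1 0 • M.trans v₂ k y)
    have e₁ : (w'.1 1 - w'.1 0) • M.map α (M.trans v₁ k x) =
        (w'.1 1 - w'.1 0) • M.trans v₁ l x := by
      by_cases hk : k.num = n
      · rw [w'.2.2.2.2 hk, sub_self, zero_smul, zero_smul]
      · rw [map_trans M (hr₁ k hk)]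
    have e₂ : w'.1 0 • M.map α (M.trans v₂ k y) = w'.1 0 • M.trans v₂ l y := by
      by_cases hk : k.num + 1 = n
      · rw [w'.2.2.2.1 hk, zero_smul, zero_smul]
      · rw [map_trans M (hr₂ k hk)]
    rw [map_add, map_smul, map_smul, e₁, e₂]
    by_cases hml : m ≤ l.num
    · rw [if_pos hml, if_pos (by omega)]
    · rw [if_neg hml, sub_zero, zero_smul, add_zero, ← hxy l (by omega), ← add_smul,
        sub_add_cancel]
      split_ifs with hil
      · rfl
      · rw [hx l (by omega), smul_zero, smul_zero]⟩
  let G : ∀ k, M.obj k →ₗ[K] (Fin 2 → K) := fun k => LinearMap.pi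
    ![if m ≤ k.num then β k else 0, if i ≤ k.num then χ ∘ₗ M.trans k b else 0]
  have hG0 : ∀ k z, G k z 0 = if m ≤ k.num then β k z else 0 := fun k z => by
    change (if m ≤ k.num then β k else 0) z = _
    split_ifs <;> rfl
  have hG1 : ∀ k z, G k z 1 = if i ≤ k.num then χ (M.trans k b z) else 0 := fun k z => by
    change (if i ≤ k.num then χ ∘ₗ M.trans k b else 0) z = _
    split_ifs <;> rfl
  let g : M ⟶ thickRep K n i m := coordLift _ G
    (fun k z => by
      refine ⟨fun h => ?_, fun h => ?_, fun h => ?_, fun h => ?_⟩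
      · rw [hG0, if_neg (by omega)]
      · rw [hG1, if_neg (by omega)]
      · obtain rfl : k = v₁ := num_injective (by omega)
        rw [hG0, hβ₁, LinearMap.zero_apply, ite_self]
      · obtain rfl : k = v₂ := num_injective (by omega)
        rw [hG0, hG1, if_pos (by omega), if_pos (by omega), hβ₂, LinearMap.comp_apply])
    fun k l α z => by
      have hα := α.down
      refine funext (Fin.forall_fin_two.2 ⟨?_, ?_⟩)
      · refine (hG0 l _).trans (Eq.trans ?_ (cut_apply _ _ _).symm)
        refine if_ctx_congr Iff.rfl (fun (hl : m ≤ l.num) => ?_) fun _ => rfl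
        rw [hβ _ _ _ _ hl, hG0, if_pos (by omega)]
      · refine (hG1 l _).trans (Eq.trans ?_ (cut_apply _ _ _).symm)
        refine if_ctx_congr Iff.rfl (fun (hl : i ≤ l.num) => ?_) fun _ => rfl
        rw [hG1, if_pos (by omega), trans_map M α (by unfold Reach; omega)]
  refine ⟨f, g, hom_ext fun k w => ?_⟩
  let w' : thickSpace K i m k := w
  have hf : f.1 k w = (w'.1 1 - w'.1 0) • M.trans v₁ k x + w'.1 0 • M.trans v₂ k y := rfl
  refine thickSpace_ext ?_ ?_
  · change G k (f.1 k w) 0 = w'.1 0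
    rw [hG0]
    by_cases hk : m ≤ k.num
    · have e₁ : (w'.1 1 - w'.1 0) • β k (M.trans v₁ k x) = 0 := by
        by_cases hk' : k.num = n
        · rw [w'.2.2.2.2 hk', sub_self, zero_smul]
        · rw [hβt _ _ _ (hr₁ k hk') hk, hβ₁, LinearMap.zero_apply, smul_zero]
      have e₂ : w'.1 0 • β k (M.trans v₂ k y) = w'.1 0 := by
        by_cases hk' : k.num + 1 = n
        · rw [w'.2.2.2.1 hk', zero_smul]
        · rw [hβt _ _ _ (hr₂ k hk') hk, hβ₂, LinearMap.comp_apply, ← hxy b (by omega), hχ,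
            smul_eq_mul, mul_one]
      rw [if_pos hk, hf, map_add, map_smul, map_smul, e₁, e₂, zero_add]
    · rw [if_neg hk, w'.2.1 (by omega)]
  · change G k (f.1 k w) 1 = w'.1 1
    rw [hG1]
    by_cases hk : i ≤ k.num
    · have hkb : Reach k b := by unfold Reach; omega
      have e₁ : (w'.1 1 - w'.1 0) • χ (M.trans k b (M.trans v₁ k x)) = w'.1 1 - w'.1 0 := by
        by_cases hk' : k.num = n
        · rw [w'.2.2.2.2 hk', sub_self, zero_smul]
        · rw [trans_trans M (hr₁ k hk') hkb, hχ, smul_eq_mul, mul_one]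
      have e₂ : w'.1 0 • χ (M.trans k b (M.trans v₂ k y)) = w'.1 0 := by
        by_cases hk' : k.num + 1 = n
        · rw [w'.2.2.2.1 hk', zero_smul]
        · rw [trans_trans M (hr₂ k hk') hkb, ← hxy b (by omega), hχ, smul_eq_mul, mul_one]
      rw [if_pos hk, hf, map_add, map_add, map_smul, map_smul, map_smul, map_smul, e₁, e₂,
        sub_add_cancel]
    · rw [if_neg hk, w'.2.2.1 (by omega)]

/-! ### Existence of retracts -/

theorem exists_functional {V : Type u} [AddCommGroup V] [Module K V] (W : Submodule K V) {v : V}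
    (hv : v ∉ W) : ∃ φ : V →ₗ[K] K, φ v = 1 ∧ ∀ w ∈ W, φ w = 0 := by
  obtain ⟨f, hf, hW⟩ := Submodule.exists_le_ker_of_notMem hv
  refine ⟨(f v)⁻¹ • f, inv_mul_cancel₀ hf, fun w hw => ?_⟩
  rw [LinearMap.smul_apply, LinearMap.mem_ker.1 (hW hw), smul_zero]

theorem exists_last (a : DVertex n) (P : DVertex n → Prop) (ha : P a) :
    ∃ b, Reach a b ∧ P b ∧ ∀ l, Reach a l → l.num < b.num → ¬ P l := by
  obtain ⟨b, hb, hmin⟩ := (measure (DVertex.num (n := n))).wf.has_min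
    {b | Reach a b ∧ P b} ⟨a, Reach.refl a, ha⟩
  exact ⟨b, hb.1, hb.2, fun l hl hlt hP => hmin l ⟨hl, hP⟩ hlt⟩

/-- The thin representation supported between `a` and `b`. -/
abbrev between (a b k : DVertex n) : Prop := Reach a k ∧ Reach k b

/-- Let `J` be the part of the space at `a` that comes from larger vertices. Follow `x` to the last
vertex `b` where it stays outside the image of `J`; a functional at `b` that kills this image then
splits off the thin summand between `a` and `b`. -/
theorem exists_retract_of_not_generated (M : QRep K (DVertex n)) {a : DVertex n}
    (ha : a.num + 2 ≤ n) (x : M.obj a)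
    (hx : x ∉ ⨆ (k) (_ : ¬ Reach a k), LinearMap.range (M.trans k a)) :
    ∃ b, Reach a b ∧ IsRetract (thinRep K (between a b)) M := by
  set J := ⨆ (k) (_ : ¬ Reach a k), LinearMap.range (M.trans k a) with hJ
  obtain ⟨b, hab, hb, hmin⟩ := exists_last a (fun b => M.trans a b x ∉ J.map (M.trans a b)) (by
    rintro ⟨z, hz, hzx⟩
    rw [trans_self, trans_self] at hzx
    exact hx (hzx ▸ hz))
  obtain ⟨x', hx', hx0⟩ : ∃ x', M.trans a b x' ∉ J.map (M.trans a b) ∧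
      ∀ l, Reach a l → ¬ Reach l b → M.trans a l x' = 0 := by
    by_cases hb1 : b.num = 1
    · refine ⟨x, hb, fun l hl hlb => ?_⟩
      have := l.num_pos
      unfold Reach at *
      omega
    · have hbp := b.num_pos
      have hbl := b.num_le
      let c : DVertex n := ofNum (b.num - 1) (by omega) (by omega)
      have hc : c.num = b.num - 1 := rfl
      have hac : Reach a c := by unfold Reach at *; omega
      obtain ⟨z, hz, hzx⟩ := not_not.1 (hmin c hac (by omega))
      -- At `b - 1` the image of `x` equals that of some `z ∈ J`. The difference dies there, and at
      -- `b` it is still outside the image of `J`.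
      refine ⟨x - z, fun h => hb ?_, fun l hl hlb => ?_⟩
      · rw [map_sub] at h
        have := add_mem h (Submodule.mem_map_of_mem (f := M.trans a b) hz)
        rwa [sub_add_cancel] at this
      · have hcl : Reach c l := by unfold Reach at *; omega
        rw [← trans_trans M hac hcl, map_sub, hzx, sub_self, map_zero]
  obtain ⟨φ, h1, h0⟩ := exists_functional _ hx'
  refine ⟨b, hab, thinRep_isRetract M (fun _ => Iff.rfl) x' φ h1 hx0 fun k y hkb hak => ?_⟩
  have hka : Reach k a := by
    have := a.num_le
    unfold Reach at *
    omega
  refine h0 _ ⟨M.trans k a y, ?_, trans_trans M hka hab y⟩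
  exact Submodule.mem_iSup_of_mem k (Submodule.mem_iSup_of_mem hak ⟨y, rfl⟩)

/-- If nothing new is generated at the vertices `≤ n - 2`, induction on the distance from `n` shows
that everything comes from the two sources. -/
theorem exists_eq_add (M : QRep K (DVertex n)) {v₁ v₂ : DVertex n} (h₁ : v₁.num + 1 = n)
    (h₂ : v₂.num = n)
    (h : ∀ a : DVertex n, a.num + 2 ≤ n → ∀ x : M.obj a,
      x ∈ ⨆ (k) (_ : ¬ Reach a k), LinearMap.range (M.trans k a)) :
    ∀ (a : DVertex n), a.num + 2 ≤ n → ∀ z : M.obj a,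
      ∃ x y, M.trans v₁ a x + M.trans v₂ a y = z := by
  have key : ∀ (d : ℕ) (a : DVertex n), a.num + d = n → a.num + 2 ≤ n → ∀ z : M.obj a,
      ∃ x y, M.trans v₁ a x + M.trans v₂ a y = z := by
    intro d
    induction d using Nat.strong_induction_on with
    | _ d ih =>
      intro a had ha z
      have hle : (⨆ (k) (_ : ¬ Reach a k), LinearMap.range (M.trans k a)) ≤
          LinearMap.range (M.trans v₁ a) ⊔ LinearMap.range (M.trans v₂ a) := by
        refine iSup₂_le fun k hk => ?_
        by_cases hk₁ : k = v₁
        · subst hk₁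
          exact le_sup_left
        by_cases hk₂ : k = v₂
        · subst hk₂
          exact le_sup_right
        have hkn := k.num_le
        have hk1 : k.num ≠ v₁.num := fun h => hk₁ (num_injective h)
        have hk2 : k.num ≠ v₂.num := fun h => hk₂ (num_injective h)
        have hka : Reach k a := by unfold Reach at *; omega
        rintro _ ⟨w, rfl⟩
        obtain ⟨x, y, rfl⟩ := ih (n - k.num) (by unfold Reach at *; omega) k (by omega)
          (by omega) w
        rw [map_add, trans_trans M (by unfold Reach; omega) hka,
          trans_trans M (by unfold Reach; omega) hka]
        exact Submodule.add_mem_sup ⟨x, rfl⟩ ⟨y, rfl⟩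
      obtain ⟨_, ⟨x, rfl⟩, _, ⟨y, rfl⟩, hxy⟩ := Submodule.mem_sup.1 (hle (h a ha z))
      exact ⟨x, y, hxy⟩
  exact fun a ha => key (n - a.num) a (by omega) ha

/-- The images of the two sources are independent, so at the last vertex where `x` survives some
functional is `1` on `x` and kills all that comes from the other source. -/
theorem exists_retract_of_source (M : QRep K (DVertex n)) {v v' : DVertex n}
    (hv : (v.num + 1 = n ∧ v'.num = n) ∨ (v.num = n ∧ v'.num + 1 = n))
    (h : ∀ k : DVertex n, k.num + 2 ≤ n → ∀ x y, M.trans v k x = M.trans v' k y →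
      M.trans v k x = 0) (x : M.obj v) (hx : x ≠ 0) :
    ∃ b, Reach v b ∧ IsRetract (thinRep K (between v b)) M := by
  obtain ⟨b, hvb, hb, hmin⟩ := exists_last v (fun b => M.trans v b x ≠ 0) (by rwa [trans_self])
  obtain ⟨φ, h1, h0⟩ := exists_functional (LinearMap.range (M.trans v' b))
    (v := M.trans v b x) (by
      rintro ⟨y, hy⟩
      by_cases hb2 : b.num + 2 ≤ n
      · exact hb (h b hb2 x y hy.symm)
      · have : ¬ Reach v' b := by unfold Reach at *; omega
        rw [trans_of_not_reach M this] at hy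
        exact hb hy.symm)
  refine ⟨b, hvb, thinRep_isRetract M (fun _ => Iff.rfl) x φ h1 (fun l hl hlb => ?_)
    fun k y hkb hk => ?_⟩
  · exact not_not.1 (hmin l hl (by unfold Reach at *; omega))
  · obtain rfl : k = v' := num_injective (by
      have := k.num_le
      unfold Reach at *
      omega)
    exact h0 _ ⟨y, rfl⟩

/-- Take `c` as the largest vertex where the images of the two sources meet, and `b` as the last
vertex where a common element survives. The thick summand has `i = b` and `m = c + 1`. -/
theorem exists_retract_of_inter (M : QRep K (DVertex n)) {v₁ v₂ : DVertex n}
    (h₁ : v₁.num + 1 = n) (h₂ : v₂.num = n)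
    (hgen : ∀ (a : DVertex n), a.num + 2 ≤ n → ∀ z : M.obj a,
      ∃ x y, M.trans v₁ a x + M.trans v₂ a y = z)
    {c : DVertex n} (hc : c.num + 2 ≤ n) {x : M.obj v₁} {y : M.obj v₂}
    (hxy : M.trans v₁ c x = M.trans v₂ c y) (hx : M.trans v₁ c x ≠ 0)
    (hmax : ∀ k : DVertex n, k.num + 2 ≤ n → c.num < k.num → ∀ x y,
      M.trans v₁ k x = M.trans v₂ k y → M.trans v₁ k x = 0) :
    ∃ i m : ℕ, 1 ≤ i ∧ i < m ∧ m + 1 ≤ n ∧ IsRetract (thickRep K n i m) M := by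
  have hr₁ : ∀ k : DVertex n, k.num + 2 ≤ n → Reach v₁ k := fun k hk => by unfold Reach; omega
  have hr₂ : ∀ k : DVertex n, k.num + 2 ≤ n → Reach v₂ k := fun k hk => by unfold Reach; omega
  obtain ⟨b, hcb, hb, hmin⟩ := exists_last c (fun b => M.trans v₁ b x ≠ 0) hx
  have hbc : b.num ≤ c.num := by unfold Reach at hcb; omega
  obtain ⟨χ, hχ, -⟩ := exists_functional (⊥ : Submodule K (M.obj b)) (v := M.trans v₁ b x) hb
  have hβ : ∃ β : ∀ k, M.obj k →ₗ[K] K,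
      (∀ k l (a : k ⟶ l) (z : M.obj k), c.num + 1 ≤ l.num → β l (M.map a z) = β k z) ∧
      β v₁ = 0 ∧ β v₂ = χ ∘ₗ M.trans v₂ b := by
    by_cases hm : c.num + 3 ≤ n
    · let d : DVertex n := ofNum (c.num + 1) (by omega) (by omega)
      have hd : d.num = c.num + 1 := rfl
      have hdb : Reach d b := by unfold Reach; omega
      -- By the maximality of `c`, the images of the sources are complementary at `c + 1`, so `β`
      -- can be defined through the projection onto the image of `n`.
      have hcompl : IsCompl (LinearMap.range (M.trans v₂ d)) (LinearMap.range (M.trans v₁ d)) := by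
        refine IsCompl.of_eq ?_ ?_
        · rw [eq_bot_iff]
          rintro _ ⟨⟨q, rfl⟩, ⟨p, hp⟩⟩
          rw [Submodule.mem_bot, ← hp]
          exact hmax d (by omega) (by omega) p q hp
        · rw [eq_top_iff]
          rintro z -
          obtain ⟨p, q, rfl⟩ := hgen d (by omega) z
          rw [add_comm]
          exact Submodule.add_mem_sup ⟨q, rfl⟩ ⟨p, rfl⟩
      let β : M.obj d →ₗ[K] K := χ ∘ₗ M.trans d b ∘ₗ Submodule.projection _ _ hcompl
      refine ⟨fun k => β ∘ₗ M.trans k d, fun k l a z hl => ?_, ?_, ?_⟩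
      · have := a.down
        exact congrArg β (trans_map M a (by unfold Reach; omega) z)
      · refine LinearMap.ext fun z => ?_
        have : Submodule.projection _ _ hcompl (M.trans v₁ d z) = 0 :=
          (Submodule.projection_apply_eq_zero_iff hcompl).2 ⟨z, rfl⟩
        change χ (M.trans d b (Submodule.projection _ _ hcompl (M.trans v₁ d z))) = 0
        rw [this, map_zero, map_zero]
      · refine LinearMap.ext fun z => ?_
        have : Submodule.projection _ _ hcompl (M.trans v₂ d z) = M.trans v₂ d z :=
          Submodule.projection_apply_left hcompl ⟨_, z, rfl⟩
        change χ (M.trans d b (Submodule.projection _ _ hcompl (M.trans v₂ d z))) = _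
        rw [this, trans_trans M (hr₂ d (by omega)) hdb]
        rfl
    -- Here `c = n - 2` and `m = n - 1`: no arrow ends at or above `m`, so `β` may be prescribed
    -- freely at the two sources.
    · classical
      refine ⟨fun k => if k = v₂ then χ ∘ₗ M.trans k b else 0, fun k l a z hl => ?_, ?_, ?_⟩
      · have := a.down
        omega
      · refine if_neg fun h => ?_
        rw [h] at h₁
        omega
      · exact if_pos rfl
  obtain ⟨β, hβ, hβ₁, hβ₂⟩ := hβ
  refine ⟨b.num, c.num + 1, b.num_pos, by omega, by omega,
    thickRep_isRetract M h₁ h₂ (by omega) (by omega) rfl x y χ β hχ (fun k hk => ?_)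
    (fun k hk => ?_) hβ hβ₁ hβ₂⟩
  · have hck : Reach c k := by unfold Reach; omega
    rw [← trans_trans M (hr₁ c hc) hck, hxy, trans_trans M (hr₂ c hc) hck]
  · exact not_not.1 (hmin k (by unfold Reach; omega) hk)

/-- Every nonzero representation has a thin or thick retract. -/
theorem exists_retract (hn : 2 ≤ n) (M : QRep K (DVertex n)) (hM : ¬ IsZero M) :
    (∃ a b : DVertex n, Reach a b ∧ IsRetract (thinRep K (between a b)) M) ∨
    ∃ i m : ℕ, 1 ≤ i ∧ i < m ∧ m + 1 ≤ n ∧ IsRetract (thickRep K n i m) M := by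
  let v₁ : DVertex n := ofNum (n - 1) (by omega) (by omega)
  let v₂ : DVertex n := ofNum n (by omega) le_rfl
  have h₁ : v₁.num + 1 = n := show n - 1 + 1 = n by omega
  have h₂ : v₂.num = n := rfl
  by_contra! hcon
  obtain ⟨hthin, hthick⟩ := hcon
  have hgen := exists_eq_add M h₁ h₂ fun a ha x => by
    by_contra hx
    obtain ⟨b, hab, hr⟩ := exists_retract_of_not_generated M ha x hx
    exact hthin a b hab hr
  have hinter : ∀ k : DVertex n, k.num + 2 ≤ n → ∀ x y, M.trans v₁ k x = M.trans v₂ k y →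
      M.trans v₁ k x = 0 := by
    by_contra! hex
    obtain ⟨c, ⟨hc, x, y, hxy, hx⟩, hmax⟩ := (measure fun k : DVertex n => n - k.num).wf.has_min
      {k | k.num + 2 ≤ n ∧ ∃ x y, M.trans v₁ k x = M.trans v₂ k y ∧ M.trans v₁ k x ≠ 0} hex
    obtain ⟨i, m, hi, him, hm, hr⟩ := exists_retract_of_inter M h₁ h₂ hgen hc hxy hx
      fun k hk hck x y h => by
        by_contra h0
        exact hmax k ⟨hk, x, y, h, h0⟩ (show n - k.num < n - c.num by omega)
    exact hthick i m hi him hm hr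
  have hz₁ : ∀ x : M.obj v₁, x = 0 := by
    by_contra! hex
    obtain ⟨x, hx⟩ := hex
    obtain ⟨b, hvb, hr⟩ := exists_retract_of_source M (Or.inl ⟨h₁, h₂⟩) hinter x hx
    exact hthin _ b hvb hr
  have hz₂ : ∀ x : M.obj v₂, x = 0 := by
    by_contra! hex
    obtain ⟨x, hx⟩ := hex
    obtain ⟨b, hvb, hr⟩ := exists_retract_of_source M (Or.inr ⟨h₂, h₁⟩)
      (fun k hk x y h => h.trans (hinter k hk y x h.symm)) x hx
    exact hthin _ b hvb hr
  -- Without thin or thick retracts, both sources carry the zero space, and they generate everything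
  -- else.
  refine hM (isZero_of_subsingleton fun k => subsingleton_of_forall_eq 0 fun z => ?_)
  have hk := k.num_le
  by_cases hk2 : k.num + 2 ≤ n
  · obtain ⟨x, y, rfl⟩ := hgen k hk2 z
    rw [hz₁ x, hz₂ y, map_zero, map_zero, add_zero]
  · by_cases hk1 : k.num = n
    · obtain rfl : k = v₂ := num_injective hk1
      exact hz₂ z
    · obtain rfl : k = v₁ := num_injective (by omega)
      exact hz₁ z

end QRep

end

noncomputable section

open DVertex QRep

/-! ### Essential curves -/

/-- The pairs of endpoints of essential curves. -/
def IsEssential (n : ℕ) (i j : ℤ) : Prop :=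
  1 ≤ i ∧ i + 1 ≤ n ∧ ((i < j ∧ j ≤ n) ∨ (j < -i ∧ -(n : ℤ) ≤ j))

theorem IsEssential.isCurve {n : ℕ} {i j : ℤ} (h : IsEssential n i j) : IsCurve n s(i, j) := by
  unfold IsEssential at h
  refine ⟨i, j, rfl, ?_, ?_, ?_, ?_⟩ <;> omega

theorem IsEssential.essentialEnds_eq {n : ℕ} {i j : ℤ} (h : IsEssential n i j) :
    essentialEnds s(i, j) = (i, j) := by
  unfold IsEssential at h
  rw [essentialEnds, Sym2.lift_mk]
  simp only
  rw [if_pos (by omega), abs_of_pos (by omega), Int.sign_eq_one_of_pos (by omega), one_mul]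

/-- The class of an essential curve. -/
def IsEssential.toClass {n : ℕ} {i j : ℤ} (h : IsEssential n i j) : CurveClass n :=
  Quotient.mk (curveSetoid n) ⟨s(i, j), h.isCurve⟩

theorem IsEssential.rep_toClass (K : Type u) [Field K] {n : ℕ} {i j : ℤ}
    (h : IsEssential n i j) : h.toClass.rep K = endsRep K n i j := by
  change endsRep K n (essentialEnds s(i, j)).1 (essentialEnds s(i, j)).2 = _
  rw [h.essentialEnds_eq]

theorem CurveClass.exists_toClass {n : ℕ} (x : CurveClass n) :
    ∃ (i j : ℤ) (h : IsEssential n i j), x = h.toClass := by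
  induction x using Quotient.inductionOn with
  | _ γ =>
    obtain ⟨hs, h0, hmin⟩ := essentialEnds_spec γ
    generalize (essentialEnds γ.1).1 = i at *
    generalize (essentialEnds γ.1).2 = j at *
    have hj : j ∈ γ.1 ∨ j ∈ γ.opp.1 := by
      rcases hs with h | h
      · exact Or.inl (h ▸ Sym2.mem_mk_right i j)
      · exact Or.inr (h ▸ Sym2.mem_mk_right i j)
    have hj' : -j ∈ γ.1 ∨ -j ∈ γ.opp.1 := by
      rcases hj with h | h
      · exact Or.inr (Sym2.mem_map.2 ⟨j, h, rfl⟩)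
      · obtain ⟨k, hk, rfl⟩ := Sym2.mem_map.1 h
        exact Or.inl ((neg_neg k).symm ▸ hk)
    have h1 := hmin j hj
    have h2 := hmin (-j) hj'
    have hc : IsCurve n s(i, j) := by
      rcases hs with h | h
      · exact h ▸ γ.2
      · exact h ▸ γ.opp.2
    have hess : IsEssential n i j := by
      obtain ⟨i', j', h, hi, hj, h3, h4⟩ := hc
      rw [Sym2.eq_iff] at h
      unfold IsEssential
      omega
    refine ⟨i, j, hess, Quotient.sound (hs.imp (fun h => Subtype.ext h) fun h => Subtype.ext h)⟩

/-- The effect of the rotation on the endpoints of essential curves. -/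
inductive RotEnds (n : ℕ) (i j i' j' : ℤ) : Prop
  | top (h : 2 ≤ i ∧ j = n ∧ i' = i - 1 ∧ j' = -n)
  | bot (h : 2 ≤ i ∧ j = -n ∧ i' = i - 1 ∧ j' = n)
  | interval (h : 2 ≤ i ∧ 0 < j ∧ j < n ∧ i' = i - 1 ∧ j' = j - 1)
  | thick (h : 2 ≤ i ∧ j < 0 ∧ -n < j ∧ i' = i - 1 ∧ j' = j + 1)
  | top_one (h : i = 1 ∧ j = n ∧ i' = n - 1 ∧ j' = n)
  | bot_one (h : i = 1 ∧ j = -n ∧ i' = n - 1 ∧ j' = -n)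
  | interval_one (h : i = 1 ∧ 0 < j ∧ j < n ∧ i' = j - 1 ∧ j' = -(n - 1))
  | thick_one (h : i = 1 ∧ j < 0 ∧ -n < j ∧ i' = -j - 1 ∧ j' = n - 1)

theorem IsEssential.exists_rotEnds {n : ℕ} {i j : ℤ} (h : IsEssential n i j) :
    ∃ i' j', IsEssential n i' j' ∧ RotEnds n i j i' j' := by
  unfold IsEssential at *
  by_cases hi : i = 1
  · rcases lt_trichotomy j 0 with hj | hj | hj
    · by_cases hjn : j = -n
      · exact ⟨n - 1, -n, by omega, .bot_one (by omega)⟩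
      · exact ⟨-j - 1, n - 1, by omega, .thick_one (by omega)⟩
    · omega
    · by_cases hjn : j = n
      · exact ⟨n - 1, n, by omega, .top_one (by omega)⟩
      · exact ⟨j - 1, -(n - 1), by omega, .interval_one (by omega)⟩
  · rcases lt_trichotomy j 0 with hj | hj | hj
    · by_cases hjn : j = -n
      · exact ⟨i - 1, n, by omega, .bot (by omega)⟩
      · exact ⟨i - 1, j + 1, by omega, .thick ⟨by omega, by omega, by omega, by omega, by omega⟩⟩
    · omega
    · by_cases hjn : j = n
      · exact ⟨i - 1, -n, by omega, .top (by omega)⟩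
      · exact ⟨i - 1, j - 1, by omega, .interval ⟨by omega, by omega, by omega, by omega, by omega⟩⟩

/-- The inverse rotation returns to `i = 1` exactly when `n - 1` or `-(n - 1)` is an endpoint;
otherwise it raises `i` by one. -/
theorem IsEssential.exists_rotEnds_eq {n : ℕ} {i' j' : ℤ} (h : IsEssential n i' j') :
    ∃ i j, IsEssential n i j ∧ RotEnds n i j i' j' := by
  unfold IsEssential at *
  by_cases hi : i' = n - 1
  · by_cases hj : j' = n
    · exact ⟨1, n, by omega, .top_one (by omega)⟩
    · exact ⟨1, -n, by omega, .bot_one (by omega)⟩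
  · by_cases h1 : j' = n
    · exact ⟨i' + 1, -n, by omega, .bot (by omega)⟩
    by_cases h2 : j' = -n
    · exact ⟨i' + 1, n, by omega, .top (by omega)⟩
    by_cases h3 : j' = n - 1
    · exact ⟨1, -(i' + 1), by omega, .thick_one (by omega)⟩
    by_cases h4 : j' = -(n - 1)
    · exact ⟨1, i' + 1, by omega, .interval_one (by omega)⟩
    rcases lt_or_ge 0 j' with h5 | h5
    · exact ⟨i' + 1, j' + 1, by omega, .interval ⟨by omega, by omega, by omega, by omega, by omega⟩⟩
    · exact ⟨i' + 1, j' - 1, by omega, .thick ⟨by omega, by omega, by omega, by omega, by omega⟩⟩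

theorem RotEnds.injective {n : ℕ} {i j k l i' j' : ℤ} (h : IsEssential n i j)
    (h' : IsEssential n k l) (hij : RotEnds n i j i' j') (hkl : RotEnds n k l i' j') :
    i = k ∧ j = l := by
  unfold IsEssential at *
  rcases hij with h1 | h1 | h1 | h1 | h1 | h1 | h1 | h1 <;>
    rcases hkl with h2 | h2 | h2 | h2 | h2 | h2 | h2 | h2 <;> omega

theorem IsEssential.rot_toClass {n : ℕ} {i j i' j' : ℤ} (h : IsEssential n i j)
    (h' : IsEssential n i' j') (hrot : RotEnds n i j i' j') : h.toClass.rot = h'.toClass := by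
  have hi : (i = 1 → rotLabel n i = -((n : ℤ) - 1)) ∧ (2 ≤ i → rotLabel n i = i - 1) := by
    unfold IsEssential at h
    unfold rotLabel
    constructor <;> intro <;> split_ifs <;> omega
  have hj : (j = n → rotLabel n j = -n) ∧ (j = -n → rotLabel n j = n) ∧
      (0 < j → j < n → rotLabel n j = j - 1) ∧ (j < 0 → -n < j → rotLabel n j = j + 1) := by
    unfold IsEssential at h
    unfold rotLabel
    refine ⟨?_, ?_, ?_, ?_⟩ <;> intros <;> split_ifs <;> omega
  -- The second alternative is needed for `i = 1`: the endpoint `1` turns to `-(n - 1)`, and the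
  -- essential curve may be the opposite of the rotated one.
  have key : s(i', j') = s(rotLabel n i, rotLabel n j) ∨
      s(i', j') = s(-rotLabel n i, -rotLabel n j) := by
    rw [Sym2.eq_iff, Sym2.eq_iff]
    obtain ⟨hi1, hi2⟩ := hi
    obtain ⟨hj1, hj2, hj3, hj4⟩ := hj
    unfold IsEssential at h
    rcases hrot with ⟨h1, h2, h3, h4⟩ | ⟨h1, h2, h3, h4⟩ | ⟨h1, h2, h5, h3, h4⟩ |
      ⟨h1, h2, h5, h3, h4⟩ | ⟨h1, h2, h3, h4⟩ | ⟨h1, h2, h3, h4⟩ | ⟨h1, h2, h5, h3, h4⟩ |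
      ⟨h1, h2, h5, h3, h4⟩
    · rw [hi2 h1, hj1 h2]; omega
    · rw [hi2 h1, hj2 h2]; omega
    · rw [hi2 h1, hj3 h2 h5]; omega
    · rw [hi2 h1, hj4 h2 h5]; omega
    · rw [hi1 h1, hj1 h2]; omega
    · rw [hi1 h1, hj2 h2]; omega
    · rw [hi1 h1, hj3 h2 h5]; omega
    · rw [hi1 h1, hj4 h2 h5]; omega
  exact Quotient.sound (key.imp (fun h => Subtype.ext h) fun h => Subtype.ext h)

theorem curveDim_top (n : ℕ) (i : ℤ) (k : ℕ) :
    curveDim n i n k = if (i ≤ k ∧ k + 2 ≤ n) ∨ k = n then 1 else 0 := if_pos rfl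

theorem curveDim_bot {n : ℕ} (hn : 1 ≤ n) (i : ℤ) (k : ℕ) :
    curveDim n i (-n) k = if (i ≤ k ∧ k + 2 ≤ n) ∨ k + 1 = n then 1 else 0 := by
  rw [curveDim, if_neg (by omega), if_pos rfl]

theorem curveDim_interval {n : ℕ} {i j : ℤ} (hj : 0 < j) (hjn : j < n) (k : ℕ) :
    curveDim n i j k = if i ≤ k ∧ k ≤ j - 1 then 1 else 0 := by
  rw [curveDim, if_neg (by omega), if_neg (by omega), if_pos hj]

theorem curveDim_thick {n : ℕ} {i j : ℤ} (hj : j < 0) (hjn : -n < j) (k : ℕ) :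
    curveDim n i j k = if -j ≤ k ∧ k + 2 ≤ n then 2
      else if (i ≤ k ∧ k ≤ -j - 1) ∨ k + 1 = n ∨ k = n then 1 else 0 := by
  rw [curveDim, if_neg (by omega), if_neg (by omega), if_neg (by omega)]

theorem IsEssential.cases {n : ℕ} {i j : ℤ} (h : IsEssential n i j) :
    j = n ∨ j = -n ∨ (0 < j ∧ j < n) ∨ (j < 0 ∧ -n < j) := by
  unfold IsEssential at h
  omega

/-- The dimensions at `n` and `n - 1` are `(1, 0)`, `(0, 1)`, `(0, 0)`, `(1, 1)` in the four cases
for `j`, so they determine the case. Within a case, the vertices where the dimension changes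
determine `i` and `j`. -/
theorem IsEssential.eq_of_curveDim {n : ℕ} (hn : 4 ≤ n) {i j i' j' : ℤ} (h : IsEssential n i j)
    (h' : IsEssential n i' j')
    (hd : ∀ k : ℕ, 1 ≤ k → k ≤ n → curveDim n i j k = curveDim n i' j' k) : i = i' ∧ j = j' := by
  have a1 := hd n (by omega) le_rfl
  have a2 := hd (n - 1) (by omega) (by omega)
  have a3 := hd i.toNat (by unfold IsEssential at h; omega) (by unfold IsEssential at h; omega)
  have a4 := hd i'.toNat (by unfold IsEssential at h'; omega) (by unfold IsEssential at h'; omega)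
  obtain ⟨hi1, hi2, hj⟩ := h
  obtain ⟨hi1', hi2', hj'⟩ := h'
  rcases IsEssential.cases ⟨hi1, hi2, hj⟩ with rfl | rfl | ⟨hjc, hjd⟩ | ⟨hjc, hjd⟩ <;>
    rcases IsEssential.cases ⟨hi1', hi2', hj'⟩ with rfl | rfl | ⟨hjc', hjd'⟩ | ⟨hjc', hjd'⟩
  · simp only [curveDim_top] at a3 a4
    split_ifs at a3 a4 <;> omega
  · rw [curveDim_top, curveDim_bot (by omega)] at a1
    split_ifs at a1 <;> omega
  · rw [curveDim_top, curveDim_interval (by omega) (by omega)] at a1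
    split_ifs at a1 <;> omega
  · rw [curveDim_top, curveDim_thick (by omega) (by omega)] at a2
    split_ifs at a2 <;> omega
  · rw [curveDim_bot (by omega), curveDim_top] at a1
    split_ifs at a1 <;> omega
  · rw [curveDim_bot (by omega), curveDim_bot (by omega)] at a3 a4
    split_ifs at a3 a4 <;> omega
  · rw [curveDim_bot (by omega), curveDim_interval (by omega) (by omega)] at a2
    split_ifs at a2 <;> omega
  · rw [curveDim_bot (by omega), curveDim_thick (by omega) (by omega)] at a1
    split_ifs at a1 <;> omega
  · rw [curveDim_interval (by omega) (by omega), curveDim_top] at a1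
    split_ifs at a1 <;> omega
  · rw [curveDim_interval (by omega) (by omega), curveDim_bot (by omega)] at a2
    split_ifs at a2 <;> omega
  · have a5 := hd (j - 1).toNat (by omega) (by omega)
    have a6 := hd (j' - 1).toNat (by omega) (by omega)
    rw [curveDim_interval (by omega) (by omega), curveDim_interval (by omega) (by omega)]
      at a3 a4 a5 a6
    rw [if_pos (by omega)] at a3 a5
    rw [eq_comm, if_pos (by omega)] at a4 a6
    split_ifs at a3 a4 a5 a6; omega
  · rw [curveDim_interval (by omega) (by omega), curveDim_thick (by omega) (by omega)] at a1
    split_ifs at a1 <;> omega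
  · rw [curveDim_thick (by omega) (by omega), curveDim_top] at a2
    split_ifs at a2 <;> omega
  · rw [curveDim_thick (by omega) (by omega), curveDim_bot (by omega)] at a1
    split_ifs at a1 <;> omega
  · rw [curveDim_thick (by omega) (by omega), curveDim_interval (by omega) (by omega)] at a1
    split_ifs at a1 <;> omega
  · have a5 := hd (-j).toNat (by omega) (by omega)
    have a6 := hd (-j').toNat (by omega) (by omega)
    rw [curveDim_thick (by omega) (by omega), curveDim_thick (by omega) (by omega)] at a3 a4 a5 a6
    have hi : i = i' := by
      clear a5 a6
      split_ifs at a3 a4 <;> omega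
    clear a3 a4
    split_ifs at a5 a6 <;> omega

theorem curveDim_eq_of_iso {K : Type u} [Field K] {n : ℕ} {i j i' j' : ℤ}
    (e : endsRep K n i j ≅ endsRep K n i' j') (k : ℕ) (h1 : 1 ≤ k) (hk : k ≤ n) :
    curveDim n i j k = curveDim n i' j' k := by
  let f : (Fin (curveDim n i j k) → K) ≃ₗ[K] (Fin (curveDim n i' j' k) → K) :=
    isoEquiv e (ofNum k h1 hk)
  simpa using f.finrank_eq

/-! ### Representations of essential curves -/

section Ends

variable {K : Type u} [Field K] {n : ℕ}

theorem curveDim_eq_thickDim {i m : ℕ} (him : i < m) (hm : m + 1 ≤ n)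
    (k : DVertex n) : curveDim n i (-m) k.num = thickDim n i m k.num := by
  have := k.num_le
  unfold curveDim thickDim
  split_ifs <;> omega

/-- The vertex `a` is the generator of the thin representation with endpoints `i` and `j`. -/
def IsGenerator (i : ℕ) (j : ℤ) (a : DVertex n) : Prop :=
  (j = n ∧ a.num = n) ∨ (j = -n ∧ a.num + 1 = n) ∨ (i < j ∧ j < n ∧ (a.num : ℤ) = j - 1)

/-- The support is that of `P_a` cut off below `i`, which is the cokernel of `P_{i-1} → P_a` for `i
≥ 2` and `P_a` for `i = 1`. -/
theorem curveDim_eq_of_isGenerator {i : ℕ} (hi : 1 ≤ i) (hin : i + 1 ≤ n) {j : ℤ} {a : DVertex n}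
    (ha : IsGenerator i j a) (k : DVertex n) :
    curveDim n i j k.num = if Reach a k ∧ i ≤ k.num then 1 else 0 := by
  have := k.num_le
  unfold IsGenerator at ha
  unfold curveDim Reach
  split_ifs <;> omega

/-- This is the support of the kernel of `I_{i-1} → I_a`. For `a = n` it contains `n - 1` but not
`n`, and vice versa, which is why the two labels of the puncture are exchanged. -/
theorem curveDim_rot_of_isGenerator {i : ℕ} (hi : 2 ≤ i) (hin : i + 1 ≤ n) {j i' j' : ℤ}
    {a : DVertex n} (ha : IsGenerator i j a) (hrot : RotEnds n i j i' j') (k : DVertex n) :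
    curveDim n i' j' k.num = if i ≤ k.num + 1 ∧ ¬ Reach k a then 1 else 0 := by
  have := k.num_le
  unfold Reach
  rcases ha with ⟨rfl, ha⟩ | ⟨rfl, ha⟩ | ⟨hij, hjn, ha⟩
  · obtain ⟨rfl, rfl⟩ : i' = i - 1 ∧ j' = -n := by
      rcases hrot with h | h | h | h | h | h | h | h <;> omega
    rw [curveDim_bot (by omega)]
    exact if_congr (by omega) rfl rfl
  · obtain ⟨rfl, rfl⟩ : i' = i - 1 ∧ j' = n := by
      rcases hrot with h | h | h | h | h | h | h | h <;> omega
    rw [curveDim_top]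
    exact if_congr (by omega) rfl rfl
  · obtain ⟨rfl, rfl⟩ : i' = i - 1 ∧ j' = j - 1 := by
      rcases hrot with h | h | h | h | h | h | h | h <;> omega
    rw [curveDim_interval (by omega) (by omega)]
    exact if_congr (by omega) rfl rfl

/-- This is the support of `I_a`. For `a ≤ n - 2` it arises from a curve ending at `-(n - 1)`, whose
range of two-dimensional spaces is empty. -/
theorem curveDim_rot_of_isGenerator_one (hn : 4 ≤ n) {j i' j' : ℤ} {a : DVertex n}
    (ha : IsGenerator 1 j a) (hrot : RotEnds n 1 j i' j') (k : DVertex n) :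
    curveDim n i' j' k.num = if Reach k a then 1 else 0 := by
  have := k.num_le
  unfold Reach
  rcases ha with ⟨rfl, ha⟩ | ⟨rfl, ha⟩ | ⟨hij, hjn, ha⟩
  · obtain ⟨rfl, rfl⟩ : i' = n - 1 ∧ j' = n := by
      rcases hrot with h | h | h | h | h | h | h | h <;> omega
    rw [curveDim_top]
    exact if_congr (by omega) rfl rfl
  · obtain ⟨rfl, rfl⟩ : i' = n - 1 ∧ j' = -n := by
      rcases hrot with h | h | h | h | h | h | h | h <;> omega
    rw [curveDim_bot (by omega)]
    exact if_congr (by omega) rfl rfl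
  · obtain ⟨rfl, rfl⟩ : i' = j - 1 ∧ j' = -(n - 1) := by
      rcases hrot with h | h | h | h | h | h | h | h <;> omega
    rw [curveDim_thick (by omega) (by omega), if_neg (by omega)]
    exact if_congr (by omega) rfl rfl

theorem IsEssential.thin_or_thick {i j : ℤ} (h : IsEssential n i j) :
    ∃ i₀ : ℕ, i = i₀ ∧ 1 ≤ i₀ ∧ i₀ + 1 ≤ n ∧ ((∃ a : DVertex n, IsGenerator i₀ j a) ∨
      ∃ m : ℕ, j = -(m : ℤ) ∧ i₀ < m ∧ m + 1 ≤ n) := by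
  unfold IsEssential at h
  refine ⟨i.toNat, by omega, by omega, by omega, ?_⟩
  by_cases h1 : j = n
  · exact Or.inl ⟨ofNum n (by omega) le_rfl, Or.inl ⟨h1, rfl⟩⟩
  by_cases h2 : j = -n
  · exact Or.inl ⟨ofNum (n - 1) (by omega) (by omega), Or.inr (Or.inl ⟨h2, by
      rw [num_ofNum]; omega⟩)⟩
  by_cases h3 : 0 < j
  · exact Or.inl ⟨ofNum (j - 1).toNat (by omega) (by omega), Or.inr (Or.inr ⟨by omega, by omega, by
      rw [num_ofNum]; omega⟩)⟩
  · exact Or.inr ⟨(-j).toNat, by omega, by omega, by omega⟩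

theorem exists_sources (hn : 4 ≤ n) :
    ∃ v₁ v₂ : DVertex n, v₁.num + 1 = n ∧ v₂.num = n :=
  ⟨ofNum (n - 1) (by omega) (by omega), ofNum n (by omega) le_rfl, by rw [num_ofNum]; omega, rfl⟩

theorem endsRep_indecomposable (hn : 4 ≤ n) {i j : ℤ} (h : IsEssential n i j) :
    Indecomposable (endsRep K n i j) := by
  obtain ⟨v₁, v₂, h₁, h₂⟩ := exists_sources hn
  obtain ⟨i, rfl, hi, hin, ⟨a, ha⟩ | ⟨m, rfl, him, hm⟩⟩ := h.thin_or_thick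
  · obtain ⟨e⟩ := endsRep_iso_thinRep (K := K) (curveDim_eq_of_isGenerator hi hin ha)
    refine indecomposable_of_iso e.symm (thinRep_indecomposable (a := a) ?_ ?_ ?_)
    · rintro k l α hk ⟨-, hl⟩
      have := num_lt α
      exact ⟨hk, by omega⟩
    · exact fun k hk => hk.1
    · refine ⟨Reach.refl a, ?_⟩
      unfold IsGenerator at ha
      omega
  · obtain ⟨e⟩ := endsRep_iso_thickRep (K := K) him hm (curveDim_eq_thickDim him hm)
    exact indecomposable_of_iso e.symm (thickRep_indecomposable h₁ h₂ hi him hm)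

theorem endsRep_tau_or_nakayama (hn : 4 ≤ n) {i j i' j' : ℤ} (h : IsEssential n i j)
    (hrot : RotEnds n i j i' j') : ∃ q : MinProjPres (endsRep K n i j),
      Nonempty (endsRep K n i' j' ≅ q.tau) ∨ (Projective (endsRep K n i j) ∧
        Nonempty (endsRep K n i' j' ≅ nakayama (endsRep K n i j))) := by
  obtain ⟨v₁, v₂, h₁, h₂⟩ := exists_sources hn
  obtain ⟨i, rfl, hi, hin, ⟨a, ha⟩ | ⟨m, rfl, him, hm⟩⟩ := h.thin_or_thick
  · obtain ⟨e⟩ := endsRep_iso_thinRep (K := K) (curveDim_eq_of_isGenerator hi hin ha)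
    by_cases hi1 : i = 1
    · subst hi1
      obtain ⟨e'⟩ := endsRep_iso_thinRep (K := K)
        (curveDim_rot_of_isGenerator_one hn ha (by simpa using hrot))
      have hS : ∀ k, Reach a k ∧ 1 ≤ k.num ↔ Reach a k := fun k => and_iff_left k.num_pos
      obtain ⟨q⟩ := nonempty_minProjPres_thinRep (K := K) hS
      obtain ⟨e₁⟩ := thinRep_nakayama (K := K) hS (S' := fun k => Reach k a) fun _ => Iff.rfl
      obtain ⟨e₂⟩ := nonempty_nakayama_iso e
      exact ⟨q.ofIso e.symm, Or.inr ⟨Projective.of_iso e.symm (projective_thinRep hS),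
        ⟨e' ≪≫ e₁ ≪≫ e₂.symm⟩⟩⟩
    · obtain ⟨e'⟩ := endsRep_iso_thinRep (K := K)
        (curveDim_rot_of_isGenerator (by omega) hin ha hrot)
      let b : DVertex n := ofNum (i - 1) (by omega) (by omega)
      have hb : b.num = i - 1 := rfl
      obtain ⟨q, ⟨e₁⟩⟩ := thinRep_tau (K := K) (a := a) (b := b)
        (S := fun k => Reach a k ∧ i ≤ k.num) (S' := fun k => i ≤ k.num + 1 ∧ ¬ Reach k a)
        (by unfold IsGenerator at ha; unfold Reach; omega)
        (fun hab => by unfold IsGenerator at ha; rw [hab] at ha; omega)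
        (fun k => by unfold Reach; omega) (fun k => by unfold Reach; omega)
      exact ⟨q.ofIso e.symm, Or.inl ⟨e' ≪≫ e₁⟩⟩
  · obtain ⟨e⟩ := endsRep_iso_thickRep (K := K) him hm (curveDim_eq_thickDim him hm)
    by_cases hi1 : i = 1
    · subst hi1
      obtain ⟨q, ⟨e₁⟩⟩ := thickRep_tau_of_eq_one (K := K) h₁ h₂ him hm rfl
        (S := fun k => m - 1 ≤ k.num ∧ k.num + 2 ≤ n) fun _ => Iff.rfl
      obtain ⟨e'⟩ := endsRep_iso_thinRep (K := K) (i := i') (j := j')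
        (S := fun k : DVertex n => m - 1 ≤ k.num ∧ k.num + 2 ≤ n) (fun k => by
          have := k.num_le
          obtain ⟨rfl, rfl⟩ : i' = m - 1 ∧ j' = n - 1 := by
            rcases hrot with h | h | h | h | h | h | h | h <;> omega
          rw [curveDim_interval (by omega) (by omega)]
          exact if_congr (by omega) rfl rfl)
      exact ⟨q.ofIso e.symm, Or.inl ⟨e' ≪≫ e₁⟩⟩
    · obtain ⟨q, ⟨e₁⟩⟩ := thickRep_tau (K := K) h₁ h₂ him hm (by omega)
      obtain ⟨e'⟩ := endsRep_iso_thickRep (K := K) (n := n) (i := i - 1) (m := m - 1)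
        (by omega) (by omega) (i' := i') (j := j') (fun k => by
          have hd := curveDim_eq_thickDim (n := n) (i := i - 1) (m := m - 1) (by omega)
            (by omega) k
          rw [← hd]
          obtain ⟨rfl, rfl⟩ : i' = (i - 1 : ℕ) ∧ j' = -(m - 1 : ℕ) := by
            rcases hrot with h | h | h | h | h | h | h | h <;> omega
          rfl)
      exact ⟨q.ofIso e.symm, Or.inl ⟨e' ≪≫ e₁⟩⟩

theorem exists_endsRep_iso (hn : 4 ≤ n) (M : QRep K (DVertex n)) (hM : Indecomposable M) :
    ∃ i j, IsEssential n i j ∧ Nonempty (M ≅ endsRep K n i j) := by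
  obtain ⟨v₁, v₂, h₁, h₂⟩ := exists_sources hn
  obtain ⟨a, b, hab, f, g, hfg⟩ | ⟨i, m, hi, him, hm, f, g, hfg⟩ :=
    exists_retract (by omega) M hM.1
  · obtain ⟨e⟩ := iso_of_retract hM (thinRep_ne_zero ⟨Reach.refl a, hab⟩) f g hfg
    have ha := a.num_le
    have hb := b.num_pos
    obtain ⟨i, j, hij, hd⟩ : ∃ i j, IsEssential n i j ∧ ∀ k : DVertex n,
        curveDim n i j k.num = if between a b k then 1 else 0 := by
      -- If `b` is one of the two sources, the support is a single vertex; `i = n - 1` makes the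
      -- range `i ≤ k ≤ n - 2` empty.
      refine ⟨if b.num + 2 ≤ n then b.num else n - 1,
        if a.num = n then n else if a.num + 1 = n then -n else a.num + 1, ?_, fun k => ?_⟩
      · unfold IsEssential
        unfold Reach at hab
        split_ifs <;> omega
      · have := k.num_le
        unfold between Reach curveDim
        unfold Reach at hab
        split_ifs <;> omega
    obtain ⟨e'⟩ := endsRep_iso_thinRep (K := K) hd
    exact ⟨i, j, hij, ⟨e ≪≫ e'.symm⟩⟩
  · obtain ⟨e⟩ := iso_of_retract hM (thickRep_ne_zero h₁ h₂ him hm) f g hfg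
    obtain ⟨e'⟩ := endsRep_iso_thickRep (K := K) him hm (curveDim_eq_thickDim him hm)
    refine ⟨i, -m, ?_, ⟨e ≪≫ e'.symm⟩⟩
    unfold IsEssential
    omega

end Ends

/-! ### The permutation of curve classes and the conclusion. -/

theorem CurveClass.rot_bijective (n : ℕ) :
    Function.Bijective (CurveClass.rot : CurveClass n → CurveClass n) := by
  constructor
  · intro x y hxy
    obtain ⟨i, j, h, rfl⟩ := x.exists_toClass
    obtain ⟨k, l, h', rfl⟩ := y.exists_toClass
    obtain ⟨i', j', hr, hij⟩ := h.exists_rotEnds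
    obtain ⟨k', l', hr', hkl⟩ := h'.exists_rotEnds
    rw [h.rot_toClass hr hij, h'.rot_toClass hr' hkl] at hxy
    have he : s(k', l') = s(i', j') ∨ s(k', l') = s(-i', -j') :=
      (Quotient.exact hxy).imp (congrArg Subtype.val) (congrArg Subtype.val)
    -- Each class contains only one essential pair of endpoints.
    have : i' = k' ∧ j' = l' := by
      rw [Sym2.eq_iff, Sym2.eq_iff] at he
      unfold IsEssential at hr hr'
      omega
    obtain ⟨rfl, rfl⟩ := this
    obtain ⟨rfl, rfl⟩ := hij.injective h h' hkl
    rfl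
  · intro y
    obtain ⟨i', j', h', rfl⟩ := y.exists_toClass
    obtain ⟨i, j, h, hij⟩ := h'.exists_rotEnds_eq
    exact ⟨h.toClass, h.rot_toClass h' hij⟩

end

theorem proposition3p3 {K : Type u} [Field K] [IsAlgClosed K] {n : ℕ} (hn : 4 ≤ n) :
    -- the rotation of curves induces a permutation of the indecomposables
    (∃ hV : ∀ x : CurveClass n, Indecomposable (x.rep K),
      ∃ ρ : Equiv.Perm (QRep.IndecClass K (DVertex n)),
        (∀ x : CurveClass n, ρ (QRep.indecClass (x.rep K) (hV x)) =
          QRep.indecClass (x.rot.rep K) (hV x.rot)) ∧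
        ∀ c : QRep.IndecClass K (DVertex n),
          ∃ x : CurveClass n, c = QRep.indecClass (x.rep K) (hV x)) ∧
    -- and it is given by the translation, respectively by the Nakayama functor
    ∀ x : CurveClass n, Nonempty (QRep.MinProjPres (x.rep K)) ∧
      ∀ p : QRep.MinProjPres (x.rep K),
        (¬ IsZero p.tau → Nonempty (x.rot.rep K ≅ p.tau)) ∧
        (IsZero p.tau → Nonempty (x.rot.rep K ≅ QRep.nakayama (x.rep K))) ∧
        (IsZero p.tau ↔ Projective (x.rep K)) := by
  have hV : ∀ x : CurveClass n, Indecomposable (x.rep K) := fun x => by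
    obtain ⟨i, j, h, rfl⟩ := x.exists_toClass
    rw [h.rep_toClass K]
    exact endsRep_indecomposable hn h
  refine ⟨⟨hV, ?_⟩, fun x => ?_⟩
  · have hsurj : ∀ c : QRep.IndecClass K (DVertex n),
        ∃ x : CurveClass n, c = QRep.indecClass (x.rep K) (hV x) := by
      intro c
      induction c using Quotient.inductionOn with
      | _ M =>
        obtain ⟨i, j, h, ⟨e⟩⟩ := exists_endsRep_iso hn M.1 M.2
        exact ⟨h.toClass, Quotient.sound ⟨e ≪≫ eqToIso (h.rep_toClass K).symm⟩⟩
    have hbij : Function.Bijective fun x : CurveClass n => QRep.indecClass (x.rep K) (hV x) := by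
      refine ⟨fun x y hxy => ?_, fun c => (hsurj c).imp fun _ => Eq.symm⟩
      obtain ⟨e⟩ := Quotient.exact hxy
      obtain ⟨i, j, h, rfl⟩ := x.exists_toClass
      obtain ⟨k, l, h', rfl⟩ := y.exists_toClass
      have e' : endsRep K n i j ≅ endsRep K n k l :=
        eqToIso (h.rep_toClass K).symm ≪≫ e ≪≫ eqToIso (h'.rep_toClass K)
      obtain ⟨rfl, rfl⟩ := h.eq_of_curveDim hn h' (curveDim_eq_of_iso e')
      rfl
    let F := Equiv.ofBijective _ hbij
    -- The rotation is conjugated by the bijection between curve classes and isomorphism classes of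
    -- indecomposables.
    refine ⟨F.symm.trans ((Equiv.ofBijective _ (CurveClass.rot_bijective n)).trans F),
      fun x => ?_, hsurj⟩
    change F ((Equiv.ofBijective _ (CurveClass.rot_bijective n)) (F.symm (F x))) = _
    rw [Equiv.symm_apply_apply]
    rfl
  · have hrot := hV x.rot
    obtain ⟨i, j, h, rfl⟩ := x.exists_toClass
    obtain ⟨i', j', h', hij⟩ := h.exists_rotEnds
    rw [h.rot_toClass h' hij, h'.rep_toClass K] at hrot ⊢
    rw [h.rep_toClass K]
    obtain ⟨q, hq⟩ := endsRep_tau_or_nakayama (K := K) hn h hij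
    refine ⟨⟨q⟩, fun p => ?_⟩
    obtain ⟨e⟩ := q.nonempty_tau_iso p
    rcases hq with ⟨⟨e'⟩⟩ | ⟨hproj, e'⟩
    -- The translate is isomorphic to the indecomposable representation of the rotated curve, so it
    -- is nonzero; hence the representation is not projective.
    · have hz : ¬ IsZero p.tau := fun hz => hrot.1 (hz.of_iso (e' ≪≫ e))
      exact ⟨fun _ => ⟨e' ≪≫ e⟩, fun h0 => (hz h0).elim,
        fun h0 => (hz h0).elim, fun h0 => (hz (p.isZero_tau h0)).elim⟩
    · have hz := p.isZero_tau hproj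
      exact ⟨fun h0 => (h0 hz).elim, fun _ => e', fun _ => hproj, fun _ => hz⟩
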